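/- Let $0<\epsilon<1<M$, $T>0$, $\overline c>0$, $R>0$, put $\Omega_T=(\epsilon,M)\times(0,T)$, and let $[\cdot,\cdot]$, $[\cdot]$ be the scalar product and the norm of the real Sobolev space $H^5(\Omega_T)\subset C^3(\overline{\Omega_T})$; boundary values below are those of the $C^3(\overline{\Omega_T})$ representative. For real functions $g_0,g_1$ let $$H=\Big\{q\in H^5(\Omega_T): q(\epsilon,t)=g_0(t+\epsilon),\ q_x(\epsilon,t)=g_1(t+\epsilon)+g_0'(t+\epsilon),\ q_x(M,t)=0\ \ \forall t\in[0,T];\ \ q(x,0)\ge \tfrac1{2\overline c^{1/4}}\ \ \forall x\in[\epsilon,M]\Big\},$$ where $g_0'$ is the derivative on $[\epsilon,T+\epsilon]$ (one-sided at the end points), and let $$H_0=\{h\in H^5(\Omega_T): h(\epsilon,t)=h_x(\epsilon,t)=h_x(M,t)=0\ \ \forall t\in[0,T]\},\qquad \overline{B(R)}=\{q\in H^5(\Omega_T):[q]\le R\}.$$ For real $\lambda,\alpha,\beta$ put $$F(q)=q_{xx}-\frac{q_{xt}}{2q^2(x,0)}+\frac{q_t\,q_x(x,0)}{2q^3(x,0)},\qquad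 J_{\lambda,\alpha,\beta}(q)=\int_{\Omega_T}e^{-2\lambda(x+\alpha t)}|F(q)|^2\,dx\,dt+\beta[q]^2 .$$ 1. For all $g_0,g_1$, all real $\lambda,\alpha,\beta$ and every $q\in H$ the functional $J_{\lambda,\alpha,\beta}$ has a unique Fréchet derivative $J'_{\lambda,\alpha,\beta}(q)\in H_0$, that is, $J_{\lambda,\alpha,\beta}(q+h)-J_{\lambda,\alpha,\beta}(q)=[J'_{\lambda,\alpha,\beta}(q),h]+o([h])$ as $[h]\to0$, $h\in H_0$. It is Lipschitz continuous on $\overline{B(R)}\cap H$: there is a constant $D>0$ such that $[J'_{\lambda,\alpha,\beta}(q_2)-J'_{\lambda,\alpha,\beta}(q_1)]\le D[q_2-q_1]$ for all $q_1,q_2\in\overline{B(R)}\cap H$. 2. Let $\alpha\in\big(0,1/(2\sqrt{\overline c})\big)$. There are constants $C>0$ and $\lambda_1\ge1$, depending only on $R,T,\epsilon,\overline c,\alpha,M$ (and not on $g_0,g_1$), where $\lambda_1$ may be taken larger than any prescribed number $\lambda_0\ge 1$ without changing $C$, such that for all $\lambda\ge\lambda_1$ and all $\beta\in[2e^{-\lambda\alpha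 T},1)$ the functional $J_{\lambda,\alpha,\beta}$ is strictly convex on $\overline{B(R)}\cap H$ and, for all $q,q+h\in\overline{B(R)}\cap H$, $$J_{\lambda,\alpha,\beta}(q+h)-J_{\lambda,\alpha,\beta}(q)-[J'_{\lambda,\alpha,\beta}(q),h]\ge C\int_{\Omega_T}e^{-2\lambda(x+\alpha t)}\big(|h_x|^2+|h_t|^2+|h|^2\big)\,dx\,dt+C\int_\epsilon^Me^{-2\lambda x}\big(|h_x(x,0)|^2+|h(x,0)|^2\big)\,dx+\frac\beta2[h]^2 .$$ 3. For the same $\alpha,\lambda,\beta$, if $\overline{B(R)}\cap H\ne\varnothing$, then $J_{\lambda,\alpha,\beta}$ has a unique minimizer $q_{\min}$ on $\overline{B(R)}\cap H$, and a point $q_{\min}\in\overline{B(R)}\cap H$ is this minimizer if and only if $[J'_{\lambda,\alpha,\beta}(q_{\min}),q_{\min}-q]\le0$ for all $q\in\overline{B(R)}\cap H$. -/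

import Mathlib

open MeasureTheory Set Topology
open scoped ContDiff

noncomputable section

namespace Convexification

/-- The partial derivative in the first variable. -/
def dx (φ : ℝ × ℝ → ℝ) : ℝ × ℝ → ℝ := fun p => deriv (fun s => φ (s, p.2)) p.1

/-- The partial derivative in the second variable. -/
def dt (φ : ℝ × ℝ → ℝ) : ℝ × ℝ → ℝ := fun p => deriv (fun s => φ (p.1, s)) p.2

/-- The classical mixed derivative `∂ₓⁱ ∂ₜʲ φ`, used for test functions. -/
def mixedDeriv (i j : ℕ) (φ : ℝ × ℝ → ℝ) : ℝ × ℝ → ℝ := dx^[i] (dt^[j] φ)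

/-- Test functions on `Ω`: smooth functions with compact support contained in `Ω`. -/
def IsTest (Ω : Set (ℝ × ℝ)) (φ : ℝ × ℝ → ℝ) : Prop :=
  ContDiff ℝ ∞ φ ∧ HasCompactSupport φ ∧ tsupport φ ⊆ Ω

/-- Multi-indices `(i, j)` of order `i + j ≤ k`. -/
abbrev MIdx (k : ℕ) : Type := {a : Fin (k + 1) × Fin (k + 1) // a.1.val + a.2.val ≤ k}

/-- The multi-index `(0, 0)`. -/
def MIdx.zero (k : ℕ) : MIdx k := ⟨(0, 0), by simp⟩

/-- The real Hilbert space `L²(Ω)`. -/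
abbrev L2 (Ω : Set (ℝ × ℝ)) : Type := Lp ℝ 2 ((volume : Measure (ℝ × ℝ)).restrict Ω)

/-- `w` is the weak derivative `∂ₓⁱ ∂ₜʲ u` on `Ω`. -/
def IsWeakDeriv (Ω : Set (ℝ × ℝ)) (i j : ℕ) (u w : L2 Ω) : Prop :=
  ∀ φ : ℝ × ℝ → ℝ, IsTest Ω φ →
    ∫ p in Ω, u p * mixedDeriv i j φ p = (-1) ^ (i + j) * ∫ p in Ω, w p * φ p

lemma IsTest.dx {Ω : Set (ℝ × ℝ)} {φ : ℝ × ℝ → ℝ} (h : IsTest Ω φ) : IsTest Ω (dx φ) := by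
  obtain ⟨h1, h2, h3⟩ := h
  have hd : Convexification.dx φ = fun p => fderiv ℝ φ p (1, 0) := by
    funext p
    have hc : HasDerivAt (fun s : ℝ => (s, p.2)) ((1 : ℝ), (0 : ℝ)) p.1 :=
      (hasDerivAt_id p.1).prodMk (hasDerivAt_const p.1 p.2)
    exact (((h1.differentiable (by simp)) p).hasFDerivAt.comp_hasDerivAt p.1 hc).deriv
  have hs : tsupport (Convexification.dx φ) ⊆ tsupport φ := by
    rw [hd]; exact tsupport_fderiv_apply_subset ℝ _
  refine ⟨?_, ?_, hs.trans h3⟩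
  · rw [hd]; exact (h1.fderiv_right (m := ∞) (by simp)).clm_apply contDiff_const
  · exact h2.of_isClosed_subset (isClosed_tsupport _) hs

lemma IsTest.dt {Ω : Set (ℝ × ℝ)} {φ : ℝ × ℝ → ℝ} (h : IsTest Ω φ) : IsTest Ω (dt φ) := by
  obtain ⟨h1, h2, h3⟩ := h
  have hd : Convexification.dt φ = fun p => fderiv ℝ φ p (0, 1) := by
    funext p
    have hc : HasDerivAt (fun s : ℝ => (p.1, s)) ((0 : ℝ), (1 : ℝ)) p.2 :=
      (hasDerivAt_const p.2 p.1).prodMk (hasDerivAt_id p.2)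
    exact (((h1.differentiable (by simp)) p).hasFDerivAt.comp_hasDerivAt p.2 hc).deriv
  have hs : tsupport (Convexification.dt φ) ⊆ tsupport φ := by
    rw [hd]; exact tsupport_fderiv_apply_subset ℝ _
  refine ⟨?_, ?_, hs.trans h3⟩
  · rw [hd]; exact (h1.fderiv_right (m := ∞) (by simp)).clm_apply contDiff_const
  · exact h2.of_isClosed_subset (isClosed_tsupport _) hs

lemma IsTest.mixedDeriv {Ω : Set (ℝ × ℝ)} {φ : ℝ × ℝ → ℝ} (h : IsTest Ω φ) (i j : ℕ) :
    IsTest Ω (mixedDeriv i j φ) := by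
  have hj : IsTest Ω (Convexification.dt^[j] φ) := by
    induction j with
    | zero => exact h
    | succ n ih => rw [Function.iterate_succ_apply']; exact ih.dt
  unfold Convexification.mixedDeriv
  induction i with
  | zero => exact hj
  | succ n ih => rw [Function.iterate_succ_apply']; exact ih.dx

lemma integrable_mul_test {Ω : Set (ℝ × ℝ)} {φ : ℝ × ℝ → ℝ} (u : L2 Ω) (h : IsTest Ω φ) :
    Integrable (fun p => u p * φ p) ((volume : Measure (ℝ × ℝ)).restrict Ω) :=
  (Lp.memLp u).integrable_mul
    ((h.1.continuous.memLp_of_hasCompactSupport (p := 2) h.2.1).restrict Ω)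

lemma IsWeakDeriv.zero {Ω : Set (ℝ × ℝ)} (i j : ℕ) : IsWeakDeriv Ω i j 0 0 := by
  intro φ _
  have h0 : ∀ ψ : ℝ × ℝ → ℝ, ∫ p in Ω, (0 : L2 Ω) p * ψ p = 0 := by
    intro ψ
    rw [integral_eq_zero_of_ae]
    filter_upwards [Lp.coeFn_zero ℝ 2 ((volume : Measure (ℝ × ℝ)).restrict Ω)] with p hp
    rw [hp]; simp
  rw [h0, h0, mul_zero]

lemma integral_add_mul_test {Ω : Set (ℝ × ℝ)} {φ : ℝ × ℝ → ℝ} (u v : L2 Ω) (h : IsTest Ω φ) :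
    ∫ p in Ω, (u + v) p * φ p = (∫ p in Ω, u p * φ p) + ∫ p in Ω, v p * φ p := by
  rw [← integral_add (integrable_mul_test u h) (integrable_mul_test v h)]
  refine integral_congr_ae ?_
  filter_upwards [Lp.coeFn_add u v] with p hp
  rw [hp, Pi.add_apply, add_mul]

lemma integral_smul_mul_test {Ω : Set (ℝ × ℝ)} (φ : ℝ × ℝ → ℝ) (c : ℝ) (u : L2 Ω) :
    ∫ p in Ω, (c • u) p * φ p = c * ∫ p in Ω, u p * φ p := by
  rw [← integral_const_mul]
  refine integral_congr_ae ?_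
  filter_upwards [Lp.coeFn_smul c u] with p hp
  rw [hp, Pi.smul_apply, smul_eq_mul, mul_assoc]

/-- The Sobolev space `Hᵏ(Ω) = Wᵏ˒²(Ω)`: an element is the tuple of all weak derivatives of order at
most `k` of an `L²` function. As a subspace of a finite Hilbert sum of copies of `L²(Ω)` it carries
the standard scalar product `[u, v] = ∑_{|a| ≤ k} ∫_Ω Dᵃu Dᵃv`. -/
def sobolev (k : ℕ) (Ω : Set (ℝ × ℝ)) : Submodule ℝ (PiLp 2 (fun _ : MIdx k => L2 Ω)) where
  carrier := {u | ∀ a : MIdx k, IsWeakDeriv Ω a.1.1 a.1.2 (u (MIdx.zero k)) (u a)}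
  zero_mem' := fun a => IsWeakDeriv.zero _ _
  add_mem' := by
    intro u v hu hv a φ hφ
    simp only [PiLp.add_apply]
    rw [integral_add_mul_test _ _ (hφ.mixedDeriv _ _), integral_add_mul_test _ _ hφ,
      hu a φ hφ, hv a φ hφ, mul_add]
  smul_mem' := by
    intro c u hu a φ hφ
    simp only [PiLp.smul_apply]
    rw [integral_smul_mul_test, integral_smul_mul_test, hu a φ hφ]
    ring

/-- The rectangle `Ω_T = (ε, M) × (0, T)`. -/
def rect (ε M T : ℝ) : Set (ℝ × ℝ) := Ioo ε M ×ˢ Ioo 0 T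

/-- The Hilbert space `H⁵(Ω_T)`; `‖·‖` and `inner ℝ` are its norm and scalar product. -/
abbrev H5 (ε M T : ℝ) : Type := ↥(sobolev 5 (rect ε M T))

variable {ε M T : ℝ}

open Classical in
/-- A function on `[ε, M] × [0, T]` that is continuous there and agrees almost everywhere in `Ω_T`
with the given `L²` function (unique on the closed rectangle when it exists). -/
def contRep (w : L2 (rect ε M T)) : ℝ × ℝ → ℝ :=
  if h : ∃ f : ℝ × ℝ → ℝ, ContinuousOn f (Icc ε M ×ˢ Icc 0 T) ∧
      f =ᵐ[(volume : Measure (ℝ × ℝ)).restrict (rect ε M T)] w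
  then h.choose else 0

/-- The value at `(x, t) ∈ [ε, M] × [0, T]` of the derivative `∂ₓⁱ ∂ₜʲ q`, `i + j ≤ 5`. It is used for
`i + j ≤ 2` only, where the continuous representative exists because `H⁵(Ω_T) ⊂ C³` of the closed
rectangle. -/
def D (q : H5 ε M T) (i j : ℕ) (x t : ℝ) (hij : i + j ≤ 5 := by norm_num) : ℝ :=
  contRep (q.1 ⟨(⟨i, by omega⟩, ⟨j, by omega⟩), hij⟩) (x, t)

/-- `F(q) = q_xx - q_xt / (2 q²(x,0)) + q_t q_x(x,0) / (2 q³(x,0))`. -/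
def F (q : H5 ε M T) (x t : ℝ) : ℝ :=
  D q 2 0 x t - D q 1 1 x t / (2 * D q 0 0 x 0 ^ 2)
    + D q 0 1 x t * D q 1 0 x 0 / (2 * D q 0 0 x 0 ^ 3)

/-- The weighted Tikhonov-like functional `J_{λ,α,β}`. -/
def J (lam α β : ℝ) (q : H5 ε M T) : ℝ :=
  (∫ p in rect ε M T, Real.exp (-2 * lam * (p.1 + α * p.2)) * |F q p.1 p.2| ^ 2) + β * ‖q‖ ^ 2

/-- The set `H` of admissible functions for the data `g₀, g₁`. The data enter only through their
values on `[ε, T + ε]`; `g₀'` is the derivative on that interval (one-sided at its end points). -/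
def admissible (ε M T cbar : ℝ) (g₀ g₁ : ℝ → ℝ) : Set (H5 ε M T) :=
  {q | (∀ t ∈ Icc 0 T,
          D q 0 0 ε t = g₀ (t + ε) ∧
          D q 1 0 ε t = g₁ (t + ε) + derivWithin g₀ (Icc ε (T + ε)) (t + ε) ∧
          D q 1 0 M t = 0) ∧
        ∀ x ∈ Icc ε M, 1 / (2 * cbar ^ (1 / 4 : ℝ)) ≤ D q 0 0 x 0}

/-- The subspace `H₀` of `H⁵(Ω_T)`. -/
def H0 (ε M T : ℝ) : Set (H5 ε M T) :=
  {h | ∀ t ∈ Icc 0 T,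
    D h 0 0 ε t = 0 ∧ D h 1 0 ε t = 0 ∧ D h 1 0 M t = 0}

/-- `G ∈ H₀` is the Fréchet derivative of `I` at `q`:
`I (q + h) - I q = [G, h] + o([h])` as `[h] → 0`, `h ∈ H₀`. -/
def IsFrechetDeriv (I : H5 ε M T → ℝ) (q G : H5 ε M T) : Prop :=
  G ∈ H0 ε M T ∧ HasFDerivWithinAt (fun h => I (q + h)) (innerSL ℝ G) (H0 ε M T) 0

/-- The set `closure B(R) ∩ H`. -/
def feasible (ε M T cbar R : ℝ) (g₀ g₁ : ℝ → ℝ) : Set (H5 ε M T) :=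
  Metric.closedBall 0 R ∩ admissible ε M T cbar g₀ g₁

end Convexification

end

/-!
On an interval a function is its mean against a bump plus the integral of its weak derivative
against a bounded kernel. Applied in both variables, this gives the derivatives of order at most
three of a function in `H⁵(Ω_T)` representatives that are continuous on the closed rectangle and
bounded by the Sobolev norm.

The principal part of `F(q + h) - F(q)` is `h_xx - a h_xt` with `a(x) = 1 / (2 (q + h)²(x, 0))`.
Multiplying the transport operator `∂ₓ - a ∂ₜ` applied to `h_x` by `e^{-2λ(x + αt)} h_x` and
integrating by parts gives a Carleman estimate as long as `α a < 1`, which is the restriction on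
`α`; Hardy's inequality in `x` then controls `h_t` and `h`. The remaining quadratic terms in the
Taylor expansion of `J` are dominated, after integrating the product of `h_xt` and `h(x, 0)` by
parts in `t`, by the left-hand side of this estimate once `λ` is large, and the contributions of the
face `t = T`, of size `e^{-2λαT}`, by `β [h]²`.

The resulting gradient inequality makes `J` strongly convex on a closed convex set, so minimizing
sequences are Cauchy. The derivative itself comes from the Riesz representation theorem on the
closed subspace `H₀`, and its Lipschitz continuity from the uniform quadratic bound on the Taylor
remainder.
-/

noncomputable section

namespace Convexification

section TestFunctions

variable {Ω : Set (ℝ × ℝ)} {a b c d : ℝ} {φ ψ : ℝ × ℝ → ℝ}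

lemma exists_Icc_of_isCompact_subset_Ioo {K : Set ℝ} (hK : IsCompact K) (h : K ⊆ Ioo a b) :
    ∃ a' b', a < a' ∧ b' < b ∧ K ⊆ Icc a' b' := by
  rcases K.eq_empty_or_nonempty with rfl | hne
  · exact ⟨a + 1, b - 1, by linarith, by linarith, empty_subset _⟩
  · obtain ⟨x, hx⟩ := hK.exists_isLeast hne
    obtain ⟨y, hy⟩ := hK.exists_isGreatest hne
    exact ⟨x, y, (h hx.1).1, (h hy.1).2, fun z hz => ⟨hx.2 hz, hy.2 hz⟩⟩

lemma IsTest.exists_support_subset_Icc_prod (h : IsTest (Ioo a b ×ˢ Ioo c d) φ) :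
    ∃ a' b' c' d', a < a' ∧ b' < b ∧ c < c' ∧ d' < d ∧
      Function.support φ ⊆ Icc a' b' ×ˢ Icc c' d' := by
  obtain ⟨-, hcomp, hsub⟩ := h
  have hK : IsCompact (tsupport φ) := hcomp
  obtain ⟨a', b', ha, hb, hfst⟩ := exists_Icc_of_isCompact_subset_Ioo (a := a) (b := b)
    (hK.image continuous_fst) (image_subset_iff.2 fun _ hp => (hsub hp).1)
  obtain ⟨c', d', hc, hd, hsnd⟩ := exists_Icc_of_isCompact_subset_Ioo (a := c) (b := d)
    (hK.image continuous_snd) (image_subset_iff.2 fun _ hp => (hsub hp).2)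
  exact ⟨a', b', c', d', ha, hb, hc, hd, fun p hp =>
    ⟨hfst ⟨p, subset_tsupport _ hp, rfl⟩, hsnd ⟨p, subset_tsupport _ hp, rfl⟩⟩⟩

lemma isTest_of_support_subset_Icc_prod {a' b' c' d' : ℝ} (hφ : ContDiff ℝ ∞ φ) (ha : a < a')
    (hb : b' < b) (hc : c < c') (hd : d' < d)
    (h : Function.support φ ⊆ Icc a' b' ×ˢ Icc c' d') : IsTest (Ioo a b ×ˢ Ioo c d) φ := by
  have hs : tsupport φ ⊆ Icc a' b' ×ˢ Icc c' d' :=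
    closure_minimal h (isClosed_Icc.prod isClosed_Icc)
  exact ⟨hφ, (isCompact_Icc.prod isCompact_Icc).of_isClosed_subset (isClosed_tsupport _) hs,
    hs.trans (prod_mono (Icc_subset_Ioo ha hb) (Icc_subset_Ioo hc hd))⟩

lemma IsTest.sub (hφ : IsTest Ω φ) (hψ : IsTest Ω ψ) : IsTest Ω (φ - ψ) :=
  ⟨hφ.1.sub hψ.1, hφ.2.1.sub hψ.2.1,
    (tsupport_sub φ ψ).trans (union_subset hφ.2.2 hψ.2.2)⟩

lemma IsTest.continuous_slice (h : IsTest Ω φ) (t : ℝ) : Continuous fun x => φ (x, t) :=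
  h.1.continuous.comp (by fun_prop)

lemma IsTest.integrable_slice (h : IsTest Ω φ) (t : ℝ) : Integrable fun x => φ (x, t) := by
  have hemb : IsClosedEmbedding fun x : ℝ => (x, t) :=
    Topology.IsClosedEmbedding.of_continuous_injective_isClosedMap (by fun_prop)
      (Prod.mk_left_injective t) (isClosedMap_prodMk_right t)
  exact (h.continuous_slice t).integrable_of_hasCompactSupport (h.2.1.comp_isClosedEmbedding hemb)

lemma hasDerivAt_integral_Iic {g : ℝ → ℝ} (hg : Continuous g) (hi : Integrable g) (s : ℝ) :
    HasDerivAt (fun s => ∫ x in Iic s, g x) (g s) s := by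
  have h : (fun s => ∫ x in Iic s, g x) =
      fun s => (∫ x in Iic 0, g x) + ∫ x in (0 : ℝ)..s, g x := by
    funext s
    rw [← intervalIntegral.integral_Iic_sub_Iic hi.integrableOn hi.integrableOn, add_sub_cancel]
  rw [h]
  exact (hg.integral_hasStrictDerivAt 0 s).hasDerivAt.const_add _

/-- The primitive from `-∞` in the first variable. -/
def xprim (χ : ℝ × ℝ → ℝ) : ℝ × ℝ → ℝ := fun p => ∫ x in Iic p.1, χ (x, p.2)

lemma xprim_eq_convolution (χ : ℝ × ℝ → ℝ) (p : ℝ × ℝ) :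
    xprim χ p = convolution ((Ici (0 : ℝ)).indicator fun _ => (1 : ℝ)) (fun x => χ (x, p.2))
      (ContinuousLinearMap.mul ℝ ℝ) volume p.1 := by
  rw [xprim, convolution, ← integral_indicator measurableSet_Iic,
    ← integral_sub_left_eq_self _ volume p.1]
  refine integral_congr_ae (.of_forall fun y => ?_)
  by_cases hy : 0 ≤ y <;> simp [indicator, hy]

lemma contDiff_xprim (hφ : ContDiff ℝ ∞ φ) (hs : HasCompactSupport φ) : ContDiff ℝ ∞ (xprim φ) := by
  have hflip : ContDiff ℝ ∞ fun p : ℝ × ℝ => φ (p.2, p.1) :=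
    hφ.comp (contDiff_snd.prodMk contDiff_fst)
  have hconv := contDiffOn_convolution_right_with_param (n := ⊤) (μ := (volume : Measure ℝ))
    (f := (Ici (0 : ℝ)).indicator fun _ => (1 : ℝ)) (ContinuousLinearMap.mul ℝ ℝ)
    (g := fun t x => φ (x, t)) (s := univ) isOpen_univ (IsCompact.image hs continuous_fst)
    (fun t x _ hx => by_contra fun hne => hx ⟨(x, t), subset_tsupport _ hne, rfl⟩)
    ((locallyIntegrable_const (1 : ℝ)).indicator measurableSet_Ici) hflip.contDiffOn
  rw [univ_prod_univ, contDiffOn_univ] at hconv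
  rw [funext (xprim_eq_convolution φ)]
  exact hconv.comp (contDiff_snd.prodMk contDiff_fst)

lemma dx_xprim (h : IsTest Ω φ) : dx (xprim φ) = φ := by
  funext p
  exact (hasDerivAt_integral_Iic (h.continuous_slice p.2) (h.integrable_slice p.2) p.1).deriv

lemma IsTest.xprim (h : IsTest (Ioo a b ×ˢ Ioo c d) φ) (hmean : ∀ t, ∫ x, φ (x, t) = 0) :
    IsTest (Ioo a b ×ˢ Ioo c d) (xprim φ) := by
  obtain ⟨a', b', c', d', ha, hb, hc, hd, hs⟩ := h.exists_support_subset_Icc_prod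
  have hzero : ∀ x t, ¬(x ∈ Icc a' b' ∧ t ∈ Icc c' d') → φ (x, t) = 0 := fun x t hx =>
    by_contra fun hne => hx (hs (a := (x, t)) hne)
  refine isTest_of_support_subset_Icc_prod (contDiff_xprim h.1 h.2.1) ha hb hc hd ?_
  rintro ⟨s, t⟩ hst
  by_contra hcon
  rcases not_and_or.1 hcon with hsx | ht
  · rcases lt_or_ge s a' with hsa | hsa
    · exact hst (setIntegral_eq_zero_of_forall_eq_zero fun x hx =>
        hzero x t fun hx' => (hx.trans_lt hsa).not_ge hx'.1.1)
    · have hbs : b' < s := lt_of_not_ge fun hsb => hsx ⟨hsa, hsb⟩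
      refine hst ?_
      change ∫ x in Iic s, φ (x, t) = 0
      rw [setIntegral_eq_integral_of_forall_compl_eq_zero, hmean t]
      exact fun x hx => hzero x t fun hx' => hx (hx'.1.2.trans hbs.le)
  · exact hst (setIntegral_eq_zero_of_forall_eq_zero fun x _ => hzero x t fun hx' => ht hx'.2)

end TestFunctions

section Cutoff

variable {a b c d : ℝ} {ψ : ℝ × ℝ → ℝ}

/-- A smooth bump of integral one supported in the middle half of `(a, b)`; zero if `b ≤ a`. -/
def cutoff (a b : ℝ) : ℝ → ℝ :=
  if h : a < b then
    (⟨(b - a) / 8, (b - a) / 4, by linarith, by linarith⟩ :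
      ContDiffBump ((a + b) / 2)).normed volume
  else 0

lemma contDiff_cutoff : ContDiff ℝ ∞ (cutoff a b) := by
  unfold cutoff
  split_ifs
  · exact ContDiffBump.contDiff_normed _
  · exact contDiff_const

lemma cutoff_nonneg (x : ℝ) : 0 ≤ cutoff a b x := by
  unfold cutoff
  split_ifs
  · exact ContDiffBump.nonneg_normed _ _
  · exact le_rfl

lemma integral_cutoff (h : a < b) : ∫ x, cutoff a b x = 1 := by
  simp only [cutoff, h, dif_pos]
  exact ContDiffBump.integral_normed _

lemma support_cutoff_subset :
    Function.support (cutoff a b) ⊆ Icc (a + (b - a) / 4) (b - (b - a) / 4) := by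
  by_cases h : a < b
  · intro x hx
    simp only [cutoff, h, dif_pos, ContDiffBump.support_normed_eq, Metric.mem_ball, Real.dist_eq,
      abs_lt] at hx
    constructor <;> linarith [hx.1, hx.2]
  · simp [cutoff, h]

lemma hasCompactSupport_cutoff : HasCompactSupport (cutoff a b) :=
  .of_support_subset_isCompact isCompact_Icc support_cutoff_subset

lemma integrable_cutoff : Integrable (cutoff a b) :=
  contDiff_cutoff.continuous.integrable_of_hasCompactSupport hasCompactSupport_cutoff

lemma exists_norm_cutoff_le (a b : ℝ) : ∃ K, ∀ x, ‖cutoff a b x‖ ≤ K :=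
  contDiff_cutoff.continuous.bounded_above_of_compact_support hasCompactSupport_cutoff

/-- The kernel of the one-dimensional Sobolev representation
`u(x) = ∫ cutoff · u + ∫ kernel(x, s) u'(s) ds` on `(a, b)`. -/
def kernel (a b x s : ℝ) : ℝ := (∫ y in Iic s, cutoff a b y) - (Iic s).indicator 1 x

lemma norm_kernel_le_one (h : a < b) (x s : ℝ) : ‖kernel a b x s‖ ≤ 1 := by
  have hnonneg : 0 ≤ ∫ y in Iic s, cutoff a b y := integral_nonneg cutoff_nonneg
  have hle : ∫ y in Iic s, cutoff a b y ≤ 1 := by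
    rw [← integral_cutoff h]
    exact setIntegral_le_integral integrable_cutoff (.of_forall cutoff_nonneg)
  rw [kernel, Real.norm_eq_abs, abs_le]
  by_cases hx : x ∈ Iic s
  · simp only [hx, indicator_of_mem, Pi.one_apply]; constructor <;> linarith
  · simp only [hx, not_false_eq_true, indicator_of_notMem]; constructor <;> linarith

lemma measurable_kernel : Measurable fun p : ℝ × ℝ => kernel a b p.1 p.2 := by
  have hprim : Continuous fun s => ∫ y in Iic s, cutoff a b y :=
    continuous_iff_continuousAt.2 fun s =>
      (hasDerivAt_integral_Iic contDiff_cutoff.continuous integrable_cutoff s).continuousAt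
  have hind : (fun p : ℝ × ℝ => (Iic p.2).indicator (1 : ℝ → ℝ) p.1)
      = {p : ℝ × ℝ | p.1 ≤ p.2}.indicator 1 := by
    funext p; simp [indicator]
  unfold kernel
  refine (hprim.measurable.comp measurable_snd).sub ?_
  rw [hind]
  exact measurable_one.indicator (measurableSet_le measurable_fst measurable_snd)

lemma kernel_sub_kernel {x₁ x₂ : ℝ} (h : x₁ ≤ x₂) (s : ℝ) :
    kernel a b x₂ s - kernel a b x₁ s = (Ico x₁ x₂).indicator 1 s := by
  simp only [kernel, indicator, mem_Iic, mem_Ico]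
  by_cases h₁ : x₁ ≤ s
  · by_cases h₂ : x₂ ≤ s
    · simp [h₁, h₂]
    · simp [h₁, h₂, not_le.1 h₂]
  · have h₂ : s < x₂ := (not_le.1 h₁).trans_le h
    simp [h₁, h₂]

lemma continuousAt_kernel {x s : ℝ} (h : s ≠ x) : ContinuousAt (fun x => kernel a b x s) x := by
  unfold kernel
  refine continuousAt_const.sub ?_
  rcases lt_or_gt_of_ne h with hs | hs
  · refine (continuousAt_const (y := (0 : ℝ))).congr ?_
    filter_upwards [Ioi_mem_nhds hs] with y hy
    exact (indicator_of_notMem (notMem_Iic.2 hy) _).symm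
  · refine (continuousAt_const (y := (1 : ℝ))).congr ?_
    filter_upwards [Iio_mem_nhds hs] with y hy
    have hys : y ∈ Iic s := (mem_Iio.1 hy).le
    simp [hys]

/-- The function with the same integrals over horizontal lines as `ψ` and profile `cutoff`. -/
def xmean (a b : ℝ) (ψ : ℝ × ℝ → ℝ) : ℝ × ℝ → ℝ := fun p => cutoff a b p.1 * ∫ x, ψ (x, p.2)

lemma IsTest.xmean (hab : a < b) (h : IsTest (Ioo a b ×ˢ Ioo c d) ψ) :
    IsTest (Ioo a b ×ˢ Ioo c d) (xmean a b ψ) := by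
  obtain ⟨a', b', c', d', -, hb, hc, hd, hs⟩ := h.exists_support_subset_Icc_prod
  have hzero : ∀ x t, ¬(x ∈ Icc a' b' ∧ t ∈ Icc c' d') → ψ (x, t) = 0 := fun x t hx =>
    by_contra fun hne => hx (hs (a := (x, t)) hne)
  have hmean : ∀ t, ∫ x, ψ (x, t) = Convexification.xprim ψ (b, t) := fun t => by
    rw [Convexification.xprim, setIntegral_eq_integral_of_forall_compl_eq_zero]
    exact fun x hx => hzero x t fun hx' => hx (hx'.1.2.trans hb.le)
  have hsmooth : ContDiff ℝ ∞ (Convexification.xmean a b ψ) := by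
    unfold Convexification.xmean
    simp only [hmean]
    exact (contDiff_cutoff.comp contDiff_fst).mul
      ((contDiff_xprim h.1 h.2.1).comp (contDiff_const.prodMk contDiff_snd))
  refine isTest_of_support_subset_Icc_prod (a' := a + (b - a) / 4) (b' := b - (b - a) / 4) hsmooth
    (by linarith) (by linarith) hc hd ?_
  rintro ⟨x, t⟩ hxt
  refine ⟨support_cutoff_subset (left_ne_zero_of_mul hxt), by_contra fun ht => ?_⟩
  exact right_ne_zero_of_mul hxt (integral_eq_zero_of_ae
    (.of_forall fun x => hzero x t fun hx' => ht hx'.2))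

lemma integral_xmean_sub (hab : a < b) (h : IsTest (Ioo a b ×ˢ Ioo c d) ψ) (t : ℝ) :
    ∫ x, (xmean a b ψ - ψ) (x, t) = 0 := by
  simp only [Pi.sub_apply]
  rw [integral_sub ((h.xmean hab).integrable_slice t) (h.integrable_slice t)]
  simp only [xmean, integral_mul_const, integral_cutoff hab, one_mul, sub_self]

lemma xprim_xmean_sub (hab : a < b) (h : IsTest (Ioo a b ×ˢ Ioo c d) ψ) (s t : ℝ) :
    xprim (xmean a b ψ - ψ) (s, t) = ∫ x, kernel a b x s * ψ (x, t) := by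
  have hind : (fun x => (Iic s).indicator 1 x * ψ (x, t)) =
      (Iic s).indicator fun x => ψ (x, t) := by
    funext x; simp [indicator]
  have hint : Integrable fun x => (Iic s).indicator 1 x * ψ (x, t) := by
    rw [hind]; exact (h.integrable_slice t).indicator measurableSet_Iic
  simp only [xprim, Pi.sub_apply]
  rw [integral_sub ((h.xmean hab).integrable_slice t).integrableOn
    (h.integrable_slice t).integrableOn]
  simp only [xmean, kernel, sub_mul]
  rw [integral_mul_const, integral_sub ((h.integrable_slice t).const_mul _) hint,
    integral_const_mul, hind, integral_indicator measurableSet_Iic]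

end Cutoff

section Representation

variable {Ω : Set (ℝ × ℝ)} {a b c d : ℝ} {u v φ ψ : ℝ × ℝ → ℝ}

/-- `v` is the weak derivative of `u` on `Ω` in the first variable. -/
def HasWeakDx (Ω : Set (ℝ × ℝ)) (u v : ℝ × ℝ → ℝ) : Prop :=
  ∀ φ : ℝ × ℝ → ℝ, IsTest Ω φ → ∫ p in Ω, u p * dx φ p = -∫ p in Ω, v p * φ p

/-- `v` is the weak derivative of `u` on `Ω` in the second variable. -/
def HasWeakDt (Ω : Set (ℝ × ℝ)) (u v : ℝ × ℝ → ℝ) : Prop :=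
  ∀ φ : ℝ × ℝ → ℝ, IsTest Ω φ → ∫ p in Ω, u p * dt φ p = -∫ p in Ω, v p * φ p

lemma HasWeakDx.congr {u' v' : ℝ × ℝ → ℝ} (h : HasWeakDx Ω u v) (hu : u =ᵐ[volume.restrict Ω] u')
    (hv : v =ᵐ[volume.restrict Ω] v') : HasWeakDx Ω u' v' := fun φ hφ => by
  have hdx : ∫ p in Ω, u' p * dx φ p = ∫ p in Ω, u p * dx φ p :=
    integral_congr_ae (hu.symm.mul .rfl)
  have hid : ∫ p in Ω, v' p * φ p = ∫ p in Ω, v p * φ p := integral_congr_ae (hv.symm.mul .rfl)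
  rw [hdx, hid, h φ hφ]

lemma HasWeakDt.congr {u' v' : ℝ × ℝ → ℝ} (h : HasWeakDt Ω u v) (hu : u =ᵐ[volume.restrict Ω] u')
    (hv : v =ᵐ[volume.restrict Ω] v') : HasWeakDt Ω u' v' := fun φ hφ => by
  have hdt : ∫ p in Ω, u' p * dt φ p = ∫ p in Ω, u p * dt φ p :=
    integral_congr_ae (hu.symm.mul .rfl)
  have hid : ∫ p in Ω, v' p * φ p = ∫ p in Ω, v p * φ p := integral_congr_ae (hv.symm.mul .rfl)
  rw [hdt, hid, h φ hφ]

lemma IsTest.eq_zero_of_notMem (h : IsTest Ω φ) {p : ℝ × ℝ} (hp : p ∉ Ω) : φ p = 0 :=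
  image_eq_zero_of_notMem_tsupport fun hmem => hp (h.2.2 hmem)

lemma IsTest.integrableOn_mul (h : IsTest Ω φ) {f : ℝ × ℝ → ℝ} (hf : IntegrableOn f Ω) :
    IntegrableOn (fun p => f p * φ p) Ω := by
  obtain ⟨K, hK⟩ := h.1.continuous.bounded_above_of_compact_support h.2.1
  exact Integrable.mul_bdd hf h.1.continuous.aestronglyMeasurable (.of_forall hK)

lemma IsTest.integral_mul_slice (h : IsTest (Ioo a b ×ˢ Ioo c d) ψ) (g : ℝ → ℝ) (t : ℝ) :
    ∫ x, g x * ψ (x, t) = ∫ x in Ioo a b, g x * ψ (x, t) := by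
  refine (setIntegral_eq_integral_of_forall_compl_eq_zero fun x hx => ?_).symm
  rw [h.eq_zero_of_notMem fun hp => hx hp.1, mul_zero]

lemma measurePreserving_exchange {X Y : Type*} [MeasurableSpace X] [MeasurableSpace Y]
    (μ : Measure X) (ν : Measure Y) [SFinite μ] [SFinite ν] :
    MeasurePreserving (fun z : (X × Y) × X => ((z.2, z.1.2), z.1.1))
      ((μ.prod ν).prod μ) ((μ.prod ν).prod μ) := by
  have hassoc : MeasurePreserving (fun z : (X × Y) × X => (z.1.1, (z.1.2, z.2)))
      ((μ.prod ν).prod μ) (μ.prod (ν.prod μ)) := measurePreserving_prodAssoc μ ν μ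
  have hinner : MeasurePreserving (fun z : X × (Y × X) => (z.1, z.2.swap))
      (μ.prod (ν.prod μ)) (μ.prod (μ.prod ν)) :=
    (MeasurePreserving.id μ).prod Measure.measurePreserving_swap
  have houter : MeasurePreserving (Prod.swap : X × (X × Y) → (X × Y) × X)
      (μ.prod (μ.prod ν)) ((μ.prod ν).prod μ) := Measure.measurePreserving_swap
  exact houter.comp (hinner.comp hassoc)

lemma integral_integral_exchange {X Y : Type*} [MeasurableSpace X] [MeasurableSpace Y]
    {μ : Measure X} {ν : Measure Y} [SFinite μ] [SFinite ν] {f : (X × Y) × X → ℝ}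
    (hf : Integrable f ((μ.prod ν).prod μ)) :
    ∫ p, ∫ s, f (p, s) ∂μ ∂(μ.prod ν) = ∫ p, ∫ s, f ((s, p.2), p.1) ∂μ ∂(μ.prod ν) := by
  have hσ := measurePreserving_exchange μ ν
  have hmap := integral_map (μ := (μ.prod ν).prod μ) hσ.measurable.aemeasurable (f := f)
    (by rw [hσ.map_eq]; exact hf.aestronglyMeasurable)
  rw [hσ.map_eq] at hmap
  have hf' : Integrable (fun z : (X × Y) × X => f ((z.2, z.1.2), z.1.1)) ((μ.prod ν).prod μ) :=
    hσ.integrable_comp_of_integrable hf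
  rw [← integral_prod _ hf, hmap, integral_prod _ hf']

lemma volume_restrict_box : (volume : Measure (ℝ × ℝ)).restrict (Ioo a b ×ˢ Ioo c d)
    = (volume.restrict (Ioo a b)).prod (volume.restrict (Ioo c d)) := by
  rw [Measure.prod_restrict]; rfl

/-- The Sobolev representation along horizontal lines of a function `u` with `∂ₓu = v`: the mean of
`u` against `cutoff` plus the integral of `v` against `kernel`. -/
def xRep (a b : ℝ) (u v : ℝ × ℝ → ℝ) (p : ℝ × ℝ) : ℝ :=
  ∫ s in Ioo a b, (cutoff a b s * u (s, p.2) + kernel a b p.1 s * v (s, p.2))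

lemma integrable_xRep_integrand (hab : a < b) (hu : IntegrableOn u (Ioo a b ×ˢ Ioo c d))
    (hv : IntegrableOn v (Ioo a b ×ˢ Ioo c d)) :
    Integrable (fun z : (ℝ × ℝ) × ℝ =>
      cutoff a b z.2 * u (z.2, z.1.2) + kernel a b z.1.1 z.2 * v (z.2, z.1.2))
      (((volume.restrict (Ioo a b)).prod (volume.restrict (Ioo c d))).prod
        (volume.restrict (Ioo a b))) := by
  rw [IntegrableOn, volume_restrict_box] at hu hv
  obtain ⟨K, hK⟩ := exists_norm_cutoff_le a b
  have hσ := measurePreserving_exchange (volume.restrict (Ioo a b)) (volume.restrict (Ioo c d))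
  have hu' := hσ.integrable_comp_of_integrable (hu.comp_fst (volume.restrict (Ioo a b)))
  have hv' := hσ.integrable_comp_of_integrable (hv.comp_fst (volume.restrict (Ioo a b)))
  refine (hu'.bdd_mul (c := K) ?_ (.of_forall fun z => hK _)).add
    (hv'.bdd_mul (c := 1) ?_ (.of_forall fun z => norm_kernel_le_one hab _ _))
  · exact (contDiff_cutoff.continuous.measurable.comp measurable_snd).aestronglyMeasurable
  · exact (measurable_kernel.comp (measurable_fst.fst.prodMk measurable_snd)).aestronglyMeasurable

lemma integrableOn_xRep (hab : a < b) (hu : IntegrableOn u (Ioo a b ×ˢ Ioo c d))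
    (hv : IntegrableOn v (Ioo a b ×ˢ Ioo c d)) :
    IntegrableOn (xRep a b u v) (Ioo a b ×ˢ Ioo c d) := by
  rw [IntegrableOn, volume_restrict_box]
  exact (integrable_xRep_integrand hab hu hv).integral_prod_left

lemma IsTest.mul_xmean_add_mul_xprim (hab : a < b) (hψ : IsTest (Ioo a b ×ˢ Ioo c d) ψ)
    (p : ℝ × ℝ) (y z : ℝ) :
    y * Convexification.xmean a b ψ p
        + z * Convexification.xprim (Convexification.xmean a b ψ - ψ) p
      = ∫ x in Ioo a b, (cutoff a b p.1 * y + kernel a b x p.1 * z) * ψ (x, p.2) := by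
  have hmean : ∫ x, ψ (x, p.2) = ∫ x in Ioo a b, ψ (x, p.2) := by
    simpa only [one_mul] using hψ.integral_mul_slice (fun _ => 1) p.2
  have hslice := (hψ.integrable_slice p.2).integrableOn (s := Ioo a b)
  have hker : IntegrableOn (fun x => kernel a b x p.1 * ψ (x, p.2)) (Ioo a b) :=
    hslice.bdd_mul (c := 1)
      (measurable_kernel.comp (measurable_id.prodMk measurable_const)).aestronglyMeasurable
      (.of_forall fun x => norm_kernel_le_one hab x p.1)
  rw [xprim_xmean_sub hab hψ, hψ.integral_mul_slice, Convexification.xmean, hmean,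
    ← integral_const_mul, ← integral_const_mul, ← integral_const_mul,
    ← integral_add ((hslice.const_mul _).const_mul _) (hker.const_mul _)]
  exact integral_congr_ae (.of_forall fun x => by ring)

lemma setIntegral_xRep_mul_test (hab : a < b) (hu : IntegrableOn u (Ioo a b ×ˢ Ioo c d))
    (hv : IntegrableOn v (Ioo a b ×ˢ Ioo c d)) (hψ : IsTest (Ioo a b ×ˢ Ioo c d) ψ) :
    ∫ p in Ioo a b ×ˢ Ioo c d, xRep a b u v p * ψ p =
      ∫ p in Ioo a b ×ˢ Ioo c d, (u p * xmean a b ψ p + v p * xprim (xmean a b ψ - ψ) p) := by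
  obtain ⟨K, hK⟩ := hψ.1.continuous.bounded_above_of_compact_support hψ.2.1
  have hint := (integrable_xRep_integrand hab hu hv).mul_bdd (c := K)
    (hψ.1.continuous.comp continuous_fst).aestronglyMeasurable (.of_forall fun z => hK z.1)
  rw [volume_restrict_box]
  simp only [xRep, ← integral_mul_const, hψ.mul_xmean_add_mul_xprim hab]
  exact integral_integral_exchange hint

lemma HasWeakDx.setIntegral_xRep_mul_test (hab : a < b)
    (hu : IntegrableOn u (Ioo a b ×ˢ Ioo c d)) (hv : IntegrableOn v (Ioo a b ×ˢ Ioo c d))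
    (h : HasWeakDx (Ioo a b ×ˢ Ioo c d) u v) (hψ : IsTest (Ioo a b ×ˢ Ioo c d) ψ) :
    ∫ p in Ioo a b ×ˢ Ioo c d, xRep a b u v p * ψ p = ∫ p in Ioo a b ×ˢ Ioo c d, u p * ψ p := by
  have hmean := hψ.xmean hab
  have hdiff := hmean.sub hψ
  have hprim := hdiff.xprim (integral_xmean_sub hab hψ)
  have hweak := h _ hprim
  simp only [dx_xprim hdiff, Pi.sub_apply, mul_sub] at hweak
  rw [integral_sub (hmean.integrableOn_mul hu) (hψ.integrableOn_mul hu)] at hweak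
  rw [Convexification.setIntegral_xRep_mul_test hab hu hv hψ,
    integral_add (hmean.integrableOn_mul hu) (hprim.integrableOn_mul hv)]
  linarith

lemma HasWeakDx.ae_eq_xRep (hab : a < b) (hu : IntegrableOn u (Ioo a b ×ˢ Ioo c d))
    (hv : IntegrableOn v (Ioo a b ×ˢ Ioo c d)) (h : HasWeakDx (Ioo a b ×ˢ Ioo c d) u v) :
    ∀ᵐ p ∂(volume.restrict (Ioo a b ×ˢ Ioo c d)), u p = xRep a b u v p := by
  have hopen : IsOpen (Ioo a b ×ˢ Ioo c d) := isOpen_Ioo.prod isOpen_Ioo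
  have hw := integrableOn_xRep hab hu hv
  have hzero := hopen.ae_eq_zero_of_integral_contDiff_smul_eq_zero (μ := volume)
    (f := fun p => u p - xRep a b u v p) (hu.sub hw).locallyIntegrableOn fun ψ hψ hc hs => by
      have htest : IsTest (Ioo a b ×ˢ Ioo c d) ψ := ⟨hψ, hc, hs⟩
      rw [← setIntegral_eq_integral_of_forall_compl_eq_zero (s := Ioo a b ×ˢ Ioo c d)
        fun p hp => by rw [htest.eq_zero_of_notMem hp, zero_smul]]
      simp only [smul_eq_mul, mul_comm (ψ _), sub_mul]
      rw [integral_sub (htest.integrableOn_mul hu) (htest.integrableOn_mul hw),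
        h.setIntegral_xRep_mul_test hab hu hv htest, sub_self]
  rw [ae_restrict_iff' hopen.measurableSet]
  filter_upwards [hzero] with p hp hmem using sub_eq_zero.1 (hp hmem)

lemma IsTest.swap (h : IsTest (Ioo a b ×ˢ Ioo c d) φ) :
    IsTest (Ioo c d ×ˢ Ioo a b) (fun p => φ p.swap) := by
  obtain ⟨a', b', c', d', ha, hb, hc, hd, hs⟩ := h.exists_support_subset_Icc_prod
  exact isTest_of_support_subset_Icc_prod (h.1.comp (contDiff_snd.prodMk contDiff_fst)) hc hd ha hb
    fun p hp => (hs (a := p.swap) hp).symm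

lemma HasWeakDt.swap (h : HasWeakDt (Ioo a b ×ˢ Ioo c d) u v) :
    HasWeakDx (Ioo c d ×ˢ Ioo a b) (fun p => u p.swap) (fun p => v p.swap) := by
  intro φ hφ
  have hweak := h _ hφ.swap
  have hdt := setIntegral_prod_swap (μ := volume) (ν := volume) (Ioo a b) (Ioo c d)
    (fun p : ℝ × ℝ => u p * dt (fun p => φ p.swap) p)
  have hid := setIntegral_prod_swap (μ := volume) (ν := volume) (Ioo a b) (Ioo c d)
    (fun p : ℝ × ℝ => v p * φ p.swap)
  simp only [Prod.swap_swap] at hid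
  rw [← Measure.volume_eq_prod] at hdt hid
  rwa [← hdt, ← hid] at hweak

lemma integrableOn_swap (hu : IntegrableOn u (Ioo a b ×ˢ Ioo c d)) :
    IntegrableOn (fun p => u p.swap) (Ioo c d ×ˢ Ioo a b) := by
  rw [IntegrableOn, volume_restrict_box] at *
  exact hu.swap

lemma HasWeakDt.ae_eq_xRep_swap (hcd : c < d) (hu : IntegrableOn u (Ioo a b ×ˢ Ioo c d))
    (hv : IntegrableOn v (Ioo a b ×ˢ Ioo c d)) (h : HasWeakDt (Ioo a b ×ˢ Ioo c d) u v) :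
    ∀ᵐ p ∂(volume.restrict (Ioo a b ×ˢ Ioo c d)),
      u p = xRep c d (fun q => u q.swap) (fun q => v q.swap) p.swap := by
  have hrep := h.swap.ae_eq_xRep hcd (integrableOn_swap hu) (integrableOn_swap hv)
  rw [volume_restrict_box] at hrep ⊢
  exact Measure.measurePreserving_swap.quasiMeasurePreserving.ae hrep

end Representation

section Embedding

variable {a b c d : ℝ} {w wx wt wxt u v : ℝ × ℝ → ℝ}

lemma integrableOn_of_continuous_box (hu : Continuous u) : IntegrableOn u (Ioo a b ×ˢ Ioo c d) :=
  (hu.continuousOn.integrableOn_compact (isCompact_Icc.prod isCompact_Icc)).mono_set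
    (prod_mono Ioo_subset_Icc_self Ioo_subset_Icc_self)

lemma integrableOn_cutoff_mul_fst {Ω : Set (ℝ × ℝ)} (hw : IntegrableOn w Ω) :
    IntegrableOn (fun z => cutoff a b z.1 * w z) Ω := by
  obtain ⟨K, hK⟩ := exists_norm_cutoff_le a b
  exact Integrable.bdd_mul hw
    (contDiff_cutoff.continuous.comp continuous_fst).aestronglyMeasurable (.of_forall fun _ => hK _)

lemma integrableOn_cutoff_mul_snd {Ω : Set (ℝ × ℝ)} (hw : IntegrableOn w Ω) :
    IntegrableOn (fun z => cutoff c d z.2 * w z) Ω := by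
  obtain ⟨K, hK⟩ := exists_norm_cutoff_le c d
  exact Integrable.bdd_mul hw
    (contDiff_cutoff.continuous.comp continuous_snd).aestronglyMeasurable (.of_forall fun _ => hK _)

lemma integrableOn_kernel_mul_fst {Ω : Set (ℝ × ℝ)} (hab : a < b) (x : ℝ)
    (hw : IntegrableOn w Ω) : IntegrableOn (fun z => kernel a b x z.1 * w z) Ω :=
  Integrable.bdd_mul hw
    (measurable_kernel.comp (measurable_const.prodMk measurable_fst)).aestronglyMeasurable
    (.of_forall fun _ => norm_kernel_le_one hab _ _)

lemma integrableOn_kernel_mul_snd {Ω : Set (ℝ × ℝ)} (hcd : c < d) (t : ℝ)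
    (hw : IntegrableOn w Ω) : IntegrableOn (fun z => kernel c d t z.2 * w z) Ω :=
  Integrable.bdd_mul hw
    (measurable_kernel.comp (measurable_const.prodMk measurable_snd)).aestronglyMeasurable
    (.of_forall fun _ => norm_kernel_le_one hcd _ _)

/-- The integrand of the two-dimensional Sobolev representation `boxRep`. -/
def boxRepIntegrand (a b c d : ℝ) (w wx wt wxt : ℝ × ℝ → ℝ) (p z : ℝ × ℝ) : ℝ :=
  cutoff a b z.1 * (cutoff c d z.2 * w z + kernel c d p.2 z.2 * wt z)
    + kernel a b p.1 z.1 * (cutoff c d z.2 * wx z + kernel c d p.2 z.2 * wxt z)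

/-- The continuous representative of a function `w` with weak derivatives `wx`, `wt` and `wxt` on
the box `(a, b) × (c, d)`: `xRep` applied in both variables. -/
def boxRep (a b c d : ℝ) (w wx wt wxt : ℝ × ℝ → ℝ) (p : ℝ × ℝ) : ℝ :=
  ∫ z in Ioo a b ×ˢ Ioo c d, boxRepIntegrand a b c d w wx wt wxt p z

lemma integrableOn_boxRepIntegrand {Ω : Set (ℝ × ℝ)} (hab : a < b) (hcd : c < d)
    (hw : IntegrableOn w Ω) (hwx : IntegrableOn wx Ω) (hwt : IntegrableOn wt Ω)
    (hwxt : IntegrableOn wxt Ω) (p : ℝ × ℝ) :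
    IntegrableOn (boxRepIntegrand a b c d w wx wt wxt p) Ω :=
  (integrableOn_cutoff_mul_fst
    ((integrableOn_cutoff_mul_snd hw).add (integrableOn_kernel_mul_snd hcd _ hwt))).add
    (integrableOn_kernel_mul_fst hab _
      ((integrableOn_cutoff_mul_snd hwx).add (integrableOn_kernel_mul_snd hcd _ hwxt)))

lemma ae_ae_of_ae_box {P : ℝ × ℝ → Prop}
    (h : ∀ᵐ p ∂(volume.restrict (Ioo a b ×ˢ Ioo c d)), P p) :
    ∀ᵐ p ∂(volume.restrict (Ioo a b ×ˢ Ioo c d)),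
      ∀ᵐ s ∂(volume.restrict (Ioo a b)), P (s, p.2) := by
  rw [volume_restrict_box] at h ⊢
  exact Measure.quasiMeasurePreserving_snd.ae (Measure.ae_ae_of_ae_prod (p := fun z => P z.swap)
    (Measure.measurePreserving_swap.quasiMeasurePreserving.ae h))

lemma boxRep_eq_integral_xRep (hab : a < b) (hcd : c < d)
    (hw : IntegrableOn w (Ioo a b ×ˢ Ioo c d)) (hwx : IntegrableOn wx (Ioo a b ×ˢ Ioo c d))
    (hwt : IntegrableOn wt (Ioo a b ×ˢ Ioo c d)) (hwxt : IntegrableOn wxt (Ioo a b ×ˢ Ioo c d))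
    (p : ℝ × ℝ) :
    boxRep a b c d w wx wt wxt p = ∫ s in Ioo a b,
      (cutoff a b s * xRep c d (fun q => w q.swap) (fun q => wt q.swap) (p.2, s)
        + kernel a b p.1 s * xRep c d (fun q => wx q.swap) (fun q => wxt q.swap) (p.2, s)) := by
  have hint := integrableOn_boxRepIntegrand hab hcd hw hwx hwt hwxt p
  have hval : IntegrableOn (fun z => cutoff c d z.2 * w z + kernel c d p.2 z.2 * wt z)
      (Ioo a b ×ˢ Ioo c d) :=
    (integrableOn_cutoff_mul_snd hw).add (integrableOn_kernel_mul_snd hcd p.2 hwt)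
  have hder : IntegrableOn (fun z => cutoff c d z.2 * wx z + kernel c d p.2 z.2 * wxt z)
      (Ioo a b ×ˢ Ioo c d) :=
    (integrableOn_cutoff_mul_snd hwx).add (integrableOn_kernel_mul_snd hcd p.2 hwxt)
  rw [IntegrableOn, volume_restrict_box] at hint hval hder
  rw [boxRep, volume_restrict_box, integral_prod _ hint]
  refine integral_congr_ae ?_
  filter_upwards [hval.prod_right_ae, hder.prod_right_ae] with s hvals hders
  simp only [xRep, ← integral_const_mul]
  exact integral_add (hvals.const_mul (cutoff a b s)) (hders.const_mul (kernel a b p.1 s))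

lemma ae_eq_boxRep (hab : a < b) (hcd : c < d) (hw : IntegrableOn w (Ioo a b ×ˢ Ioo c d))
    (hwx : IntegrableOn wx (Ioo a b ×ˢ Ioo c d)) (hwt : IntegrableOn wt (Ioo a b ×ˢ Ioo c d))
    (hwxt : IntegrableOn wxt (Ioo a b ×ˢ Ioo c d))
    (hdx : HasWeakDx (Ioo a b ×ˢ Ioo c d) w wx) (hdt : HasWeakDt (Ioo a b ×ˢ Ioo c d) w wt)
    (hdxt : HasWeakDt (Ioo a b ×ˢ Ioo c d) wx wxt) :
    w =ᵐ[volume.restrict (Ioo a b ×ˢ Ioo c d)] boxRep a b c d w wx wt wxt := by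
  filter_upwards [hdx.ae_eq_xRep hab hw hwx, ae_ae_of_ae_box (hdt.ae_eq_xRep_swap hcd hw hwt),
    ae_ae_of_ae_box (hdxt.ae_eq_xRep_swap hcd hwx hwxt)] with p hp hpw hpwx
  rw [hp, boxRep_eq_integral_xRep hab hcd hw hwx hwt hwxt]
  refine integral_congr_ae ?_
  filter_upwards [hpw, hpwx] with s hs hsx
  rw [hs, hsx]
  rfl

lemma exists_norm_boxRepIntegrand_le (hab : a < b) (hcd : c < d) :
    ∃ K > 0, ∀ (w wx wt wxt : ℝ × ℝ → ℝ) (p z : ℝ × ℝ),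
      ‖boxRepIntegrand a b c d w wx wt wxt p z‖ ≤ K * (‖w z‖ + ‖wx z‖ + ‖wt z‖ + ‖wxt z‖) := by
  obtain ⟨K₁, hK₁⟩ := exists_norm_cutoff_le a b
  obtain ⟨K₂, hK₂⟩ := exists_norm_cutoff_le c d
  have hK₁0 : 0 ≤ K₁ := (norm_nonneg _).trans (hK₁ 0)
  have hK₂0 : 0 ≤ K₂ := (norm_nonneg _).trans (hK₂ 0)
  refine ⟨(K₁ + 1) * (K₂ + 1), by positivity, fun w wx wt wxt p z => ?_⟩
  have hcut₁ : ‖cutoff a b z.1‖ ≤ K₁ + 1 := (hK₁ _).trans (by linarith)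
  have hcut₂ : ‖cutoff c d z.2‖ ≤ K₂ + 1 := (hK₂ _).trans (by linarith)
  have hker₁ : ‖kernel a b p.1 z.1‖ ≤ K₁ + 1 := (norm_kernel_le_one hab _ _).trans (by linarith)
  have hker₂ : ‖kernel c d p.2 z.2‖ ≤ K₂ + 1 := (norm_kernel_le_one hcd _ _).trans (by linarith)
  have hbound : ∀ {k k₁ k₂ y y' : ℝ}, ‖k‖ ≤ K₁ + 1 → ‖k₁‖ ≤ K₂ + 1 → ‖k₂‖ ≤ K₂ + 1 →
      ‖k * (k₁ * y + k₂ * y')‖ ≤ (K₁ + 1) * ((K₂ + 1) * ‖y‖ + (K₂ + 1) * ‖y'‖) := by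
    intro k k₁ k₂ y y' hk hk₁ hk₂
    rw [norm_mul]
    have hsum : ‖k₁ * y + k₂ * y'‖ ≤ ‖k₁‖ * ‖y‖ + ‖k₂‖ * ‖y'‖ := by
      simpa only [norm_mul] using norm_add_le (k₁ * y) (k₂ * y')
    exact mul_le_mul hk (hsum.trans (by gcongr)) (norm_nonneg _) (by positivity)
  calc ‖boxRepIntegrand a b c d w wx wt wxt p z‖
      ≤ (K₁ + 1) * ((K₂ + 1) * ‖w z‖ + (K₂ + 1) * ‖wt z‖)
        + (K₁ + 1) * ((K₂ + 1) * ‖wx z‖ + (K₂ + 1) * ‖wxt z‖) :=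
        norm_add_le_of_le (hbound hcut₁ hcut₂ hker₂) (hbound hker₁ hcut₂ hker₂)
    _ = (K₁ + 1) * (K₂ + 1) * (‖w z‖ + ‖wx z‖ + ‖wt z‖ + ‖wxt z‖) := by ring

lemma ae_continuousAt_boxRepIntegrand (p : ℝ × ℝ) :
    ∀ᵐ z ∂(volume.restrict (Ioo a b ×ˢ Ioo c d)),
      ContinuousAt (fun p => boxRepIntegrand a b c d w wx wt wxt p z) p := by
  have hfst : ∀ᵐ z : ℝ × ℝ ∂(volume.restrict (Ioo a b ×ˢ Ioo c d)), z.1 ≠ p.1 := by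
    rw [volume_restrict_box]
    exact Measure.quasiMeasurePreserving_fst.ae (ae_restrict_of_ae (Measure.ae_ne volume p.1))
  have hsnd : ∀ᵐ z : ℝ × ℝ ∂(volume.restrict (Ioo a b ×ˢ Ioo c d)), z.2 ≠ p.2 := by
    rw [volume_restrict_box]
    exact Measure.quasiMeasurePreserving_snd.ae (ae_restrict_of_ae (Measure.ae_ne volume p.2))
  filter_upwards [hfst, hsnd] with z hz₁ hz₂
  have hker₁ : ContinuousAt (fun p : ℝ × ℝ => kernel a b p.1 z.1) p :=
    (continuousAt_kernel hz₁).comp (f := Prod.fst) continuousAt_fst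
  have hker₂ : ContinuousAt (fun p : ℝ × ℝ => kernel c d p.2 z.2) p :=
    (continuousAt_kernel hz₂).comp (f := Prod.snd) continuousAt_snd
  exact (continuousAt_const.mul (continuousAt_const.add (hker₂.mul continuousAt_const))).add
    (hker₁.mul (continuousAt_const.add (hker₂.mul continuousAt_const)))

lemma continuous_boxRep (hab : a < b) (hcd : c < d) (hw : IntegrableOn w (Ioo a b ×ˢ Ioo c d))
    (hwx : IntegrableOn wx (Ioo a b ×ˢ Ioo c d)) (hwt : IntegrableOn wt (Ioo a b ×ˢ Ioo c d))
    (hwxt : IntegrableOn wxt (Ioo a b ×ˢ Ioo c d)) :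
    Continuous (boxRep a b c d w wx wt wxt) := by
  obtain ⟨K, -, hK⟩ := exists_norm_boxRepIntegrand_le hab hcd
  exact continuous_iff_continuousAt.2 fun p => continuousAt_of_dominated
    (.of_forall fun p =>
      (integrableOn_boxRepIntegrand hab hcd hw hwx hwt hwxt p).aestronglyMeasurable)
    (.of_forall fun p => .of_forall fun z => hK _ _ _ _ _ _)
    ((((hw.norm.add hwx.norm).add hwt.norm).add hwxt.norm).const_mul K)
    (ae_continuousAt_boxRepIntegrand p)

lemma exists_abs_boxRep_le (hab : a < b) (hcd : c < d) :
    ∃ K > 0, ∀ (w wx wt wxt : ℝ × ℝ → ℝ), IntegrableOn w (Ioo a b ×ˢ Ioo c d) →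
      IntegrableOn wx (Ioo a b ×ˢ Ioo c d) → IntegrableOn wt (Ioo a b ×ˢ Ioo c d) →
      IntegrableOn wxt (Ioo a b ×ˢ Ioo c d) → ∀ p,
      |boxRep a b c d w wx wt wxt p| ≤ K * ((∫ z in Ioo a b ×ˢ Ioo c d, ‖w z‖)
        + (∫ z in Ioo a b ×ˢ Ioo c d, ‖wx z‖) + (∫ z in Ioo a b ×ˢ Ioo c d, ‖wt z‖)
        + ∫ z in Ioo a b ×ˢ Ioo c d, ‖wxt z‖) := by
  obtain ⟨K, hK0, hK⟩ := exists_norm_boxRepIntegrand_le hab hcd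
  refine ⟨K, hK0, fun w wx wt wxt hw hwx hwt hwxt p => ?_⟩
  have hsum₂ : IntegrableOn (fun z => ‖w z‖ + ‖wx z‖) (Ioo a b ×ˢ Ioo c d) := hw.norm.add hwx.norm
  have hsum₃ : IntegrableOn (fun z => ‖w z‖ + ‖wx z‖ + ‖wt z‖) (Ioo a b ×ˢ Ioo c d) :=
    hsum₂.add hwt.norm
  have hsum₄ : IntegrableOn (fun z => ‖w z‖ + ‖wx z‖ + ‖wt z‖ + ‖wxt z‖) (Ioo a b ×ˢ Ioo c d) :=
    hsum₃.add hwxt.norm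
  rw [← integral_add hw.norm hwx.norm, ← integral_add hsum₂ hwt.norm,
    ← integral_add hsum₃ hwxt.norm, ← integral_const_mul]
  exact norm_integral_le_of_norm_le (hsum₄.const_mul K) (.of_forall fun z => hK _ _ _ _ _ _)

lemma eqOn_closedBox (hab : a < b) (hcd : c < d) (hu : ContinuousOn u (Icc a b ×ˢ Icc c d))
    (hv : ContinuousOn v (Icc a b ×ˢ Icc c d))
    (h : u =ᵐ[volume.restrict (Ioo a b ×ˢ Ioo c d)] v) : EqOn u v (Icc a b ×ˢ Icc c d) := by
  have hsub : Ioo a b ×ˢ Ioo c d ⊆ Icc a b ×ˢ Icc c d :=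
    prod_mono Ioo_subset_Icc_self Ioo_subset_Icc_self
  refine (Measure.eqOn_open_of_ae_eq h (isOpen_Ioo.prod isOpen_Ioo) (hu.mono hsub)
    (hv.mono hsub)).of_subset_closure hu hv hsub ?_
  rw [closure_prod_eq, closure_Ioo hab.ne, closure_Ioo hcd.ne]

lemma intervalIntegral_eq_setIntegral_Ioo {f : ℝ → ℝ} (hab : a ≤ b) :
    ∫ s in a..b, f s = ∫ s in Ioo a b, f s := by
  rw [intervalIntegral.integral_of_le hab, integral_Ioc_eq_integral_Ioo]

lemma intervalIntegral_eq_setIntegral_indicator {f : ℝ → ℝ} {x : ℝ} (hx : x ∈ Icc a b) :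
    ∫ s in a..x, f s = ∫ s in Ioo a b, (Ico a x).indicator 1 s * f s := by
  have hmul : ∀ s, (Ico a x).indicator (1 : ℝ → ℝ) s * f s = (Ico a x).indicator f s := fun s => by
    simp [indicator]
  have hinter : Ioo a b ∩ Ico a x = Ioo a x := by
    ext s
    exact ⟨fun hs => ⟨hs.1.1, hs.2.2⟩, fun hs => ⟨⟨hs.1, hs.2.trans_le hx.2⟩, hs.1.le, hs.2⟩⟩
  simp only [hmul]
  rw [setIntegral_indicator measurableSet_Ico, hinter, intervalIntegral_eq_setIntegral_Ioo hx.1]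

lemma continuous_xRep_left (hab : a ≤ b) (hu : Continuous u) (hv : Continuous v) :
    Continuous fun t => xRep a b u v (a, t) := by
  have hcut : Continuous (cutoff a b) := contDiff_cutoff.continuous
  have hprim : Continuous fun s => ∫ y in Iic s, cutoff a b y :=
    continuous_iff_continuousAt.2 fun s =>
      (hasDerivAt_integral_Iic hcut integrable_cutoff s).continuousAt
  have hker : ∀ t, xRep a b u v (a, t) = ∫ s in a..b,
      (cutoff a b s * u (s, t) + ((∫ y in Iic s, cutoff a b y) - 1) * v (s, t)) := fun t => by
    rw [intervalIntegral_eq_setIntegral_Ioo hab]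
    refine setIntegral_congr_fun measurableSet_Ioo fun s hs => ?_
    simp [kernel, indicator, hs.1.le]
  simp only [hker]
  exact intervalIntegral.continuous_parametric_intervalIntegral_of_continuous'
    (((hcut.comp continuous_snd).mul (hu.comp continuous_swap)).add
      (((hprim.comp continuous_snd).sub continuous_const).mul (hv.comp continuous_swap))) a b

lemma xRep_eq_xRep_left_add_integral (hab : a < b) (hu : Continuous u) (hv : Continuous v)
    {x t : ℝ} (hx : x ∈ Icc a b) :
    xRep a b u v (x, t) = xRep a b u v (a, t) + ∫ s in a..x, v (s, t) := by
  have hslice : ∀ {f : ℝ → ℝ}, Continuous f → IntegrableOn f (Ioo a b) := fun hf =>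
    hf.continuousOn.integrableOn_Icc.mono_set Ioo_subset_Icc_self
  have hcut : Continuous (cutoff a b) := contDiff_cutoff.continuous
  have hus : IntegrableOn (fun s => cutoff a b s * u (s, t)) (Ioo a b) := hslice (by fun_prop)
  have hvs : IntegrableOn (fun s => v (s, t)) (Ioo a b) := hslice (by fun_prop)
  have hker : IntegrableOn (fun s => kernel a b a s * v (s, t)) (Ioo a b) :=
    hvs.bdd_mul
      (measurable_kernel.comp (measurable_const.prodMk measurable_id)).aestronglyMeasurable
      (.of_forall fun _ => norm_kernel_le_one hab _ _)
  have hind : IntegrableOn (fun s => (Ico a x).indicator 1 s * v (s, t)) (Ioo a b) := by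
    refine hvs.bdd_mul (c := 1)
      (measurable_one.indicator measurableSet_Ico).aestronglyMeasurable (.of_forall fun s => ?_)
    exact (norm_indicator_le_norm_self _ _).trans (by simp)
  have hleft : IntegrableOn (fun s => cutoff a b s * u (s, t) + kernel a b a s * v (s, t))
      (Ioo a b) := hus.add hker
  rw [intervalIntegral_eq_setIntegral_indicator hx, xRep, xRep, ← integral_add hleft hind]
  refine integral_congr_ae (.of_forall fun s => ?_)
  simp only [← kernel_sub_kernel (a := a) (b := b) hx.1 s]
  ring

lemma HasWeakDx.eq_xRep_left_add_integral (hab : a < b) (hcd : c < d) (hu : Continuous u)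
    (hv : Continuous v) (h : HasWeakDx (Ioo a b ×ˢ Ioo c d) u v) {x t : ℝ} (hx : x ∈ Icc a b)
    (ht : t ∈ Icc c d) : u (x, t) = xRep a b u v (a, t) + ∫ s in a..x, v (s, t) := by
  have hleft := continuous_xRep_left hab.le hu hv
  have hprim : Continuous fun p : ℝ × ℝ => ∫ s in a..p.1, v (s, p.2) :=
    intervalIntegral.continuous_parametric_intervalIntegral_of_continuous
      (f := fun (p : ℝ × ℝ) s => v (s, p.2)) (by fun_prop) continuous_fst
  refine eqOn_closedBox hab hcd hu.continuousOn
    (v := fun p => xRep a b u v (a, p.2) + ∫ s in a..p.1, v (s, p.2))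
    ((hleft.comp continuous_snd).add hprim).continuousOn ?_
    (mk_mem_prod hx ht)
  filter_upwards [ae_restrict_mem (measurableSet_Ioo.prod measurableSet_Ioo),
    h.ae_eq_xRep hab (integrableOn_of_continuous_box hu) (integrableOn_of_continuous_box hv)]
    with p hp hrep
  rw [hrep, ← xRep_eq_xRep_left_add_integral hab hu hv (Ioo_subset_Icc_self hp.1)]

lemma HasWeakDx.hasDerivAt (hab : a < b) (hcd : c < d) (hu : Continuous u)
    (hv : Continuous v) (h : HasWeakDx (Ioo a b ×ˢ Ioo c d) u v) {x t : ℝ} (hx : x ∈ Ioo a b)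
    (ht : t ∈ Icc c d) : HasDerivAt (fun s => u (s, t)) (v (x, t)) x := by
  have hvt : Continuous fun s => v (s, t) := by fun_prop
  refine ((hvt.integral_hasStrictDerivAt a x).hasDerivAt.const_add
    (xRep a b u v (a, t))).congr_of_eventuallyEq ?_
  filter_upwards [Ioo_mem_nhds hx.1 hx.2] with s hs
  exact h.eq_xRep_left_add_integral hab hcd hu hv (Ioo_subset_Icc_self hs) ht

lemma HasWeakDt.hasDerivAt (hab : a < b) (hcd : c < d) (hu : Continuous u)
    (hv : Continuous v) (h : HasWeakDt (Ioo a b ×ˢ Ioo c d) u v) {x t : ℝ} (hx : x ∈ Icc a b)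
    (ht : t ∈ Ioo c d) : HasDerivAt (fun s => u (x, s)) (v (x, t)) t :=
  h.swap.hasDerivAt hcd hab (hu.comp continuous_swap) (hv.comp continuous_swap) ht hx

end Embedding

section MixedDerivatives

lemma dx_eq_fderiv {φ : ℝ × ℝ → ℝ} (h : Differentiable ℝ φ) :
    dx φ = fun p => fderiv ℝ φ p (1, 0) := by
  funext p
  have hline : HasDerivAt (fun s : ℝ => (s, p.2)) ((1 : ℝ), (0 : ℝ)) p.1 :=
    (hasDerivAt_id p.1).prodMk (hasDerivAt_const p.1 p.2)
  exact ((h p).hasFDerivAt.comp_hasDerivAt p.1 hline).deriv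

lemma dt_eq_fderiv {φ : ℝ × ℝ → ℝ} (h : Differentiable ℝ φ) :
    dt φ = fun p => fderiv ℝ φ p (0, 1) := by
  funext p
  have hline : HasDerivAt (fun s : ℝ => (p.1, s)) ((0 : ℝ), (1 : ℝ)) p.2 :=
    (hasDerivAt_const p.2 p.1).prodMk (hasDerivAt_id p.2)
  exact ((h p).hasFDerivAt.comp_hasDerivAt p.2 hline).deriv

lemma dt_dx_comm {φ : ℝ × ℝ → ℝ} (h : ContDiff ℝ 2 φ) : dt (dx φ) = dx (dt φ) := by
  have hd : Differentiable ℝ φ := h.differentiable (by simp)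
  have hd' : Differentiable ℝ (fderiv ℝ φ) :=
    (h.fderiv_right (m := 1) (by norm_num)).differentiable (by simp)
  rw [dx_eq_fderiv hd, dt_eq_fderiv hd,
    dt_eq_fderiv (fun p => (hd' p).clm_apply (differentiableAt_const _)),
    dx_eq_fderiv (fun p => (hd' p).clm_apply (differentiableAt_const _))]
  funext p
  have hsymm : IsSymmSndFDerivAt ℝ φ p :=
    h.contDiffAt.isSymmSndFDerivAt (by rw [minSmoothness_of_isRCLikeNormedField])
  rw [fderiv_clm_apply (hd' p) (differentiableAt_const _),
    fderiv_clm_apply (hd' p) (differentiableAt_const _)]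
  simpa using hsymm (0, 1) (1, 0)

lemma IsTest.mixedDeriv_dx {Ω : Set (ℝ × ℝ)} {φ : ℝ × ℝ → ℝ} (h : IsTest Ω φ) (i j : ℕ) :
    Convexification.mixedDeriv i j (Convexification.dx φ)
      = Convexification.mixedDeriv (i + 1) j φ := by
  have hcomm : Convexification.dt^[j] (Convexification.dx φ)
      = Convexification.dx (Convexification.dt^[j] φ) := by
    induction j with
    | zero => rfl
    | succ n ih =>
      have hsmooth : ContDiff ℝ 2 (Convexification.dt^[n] φ) :=
        (h.mixedDeriv 0 n).1.of_le (by norm_cast)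
      rw [Function.iterate_succ_apply', ih, Function.iterate_succ_apply', dt_dx_comm hsmooth]
  rw [Convexification.mixedDeriv, hcomm, Convexification.mixedDeriv, Function.iterate_succ_apply]

lemma mixedDeriv_dt (φ : ℝ × ℝ → ℝ) (i j : ℕ) :
    mixedDeriv i j (dt φ) = mixedDeriv i (j + 1) φ := by
  rw [mixedDeriv, mixedDeriv, Function.iterate_succ_apply]

end MixedDerivatives

section Components

variable {k : ℕ} {Ω : Set (ℝ × ℝ)}

/-- The component `∂ₓⁱ ∂ₜʲ q` of an element of `Hᵏ(Ω)`, as a function; zero if `i + j > k`. -/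
def comp (q : sobolev k Ω) (i j : ℕ) : ℝ × ℝ → ℝ :=
  if h : i + j ≤ k then q.1 ⟨(⟨i, by omega⟩, ⟨j, by omega⟩), h⟩ else 0

lemma comp_of_le (q : sobolev k Ω) {i j : ℕ} (h : i + j ≤ k) :
    comp q i j = q.1 ⟨(⟨i, by omega⟩, ⟨j, by omega⟩), h⟩ := dif_pos h

lemma setIntegral_comp_mul_mixedDeriv (q : sobolev k Ω) {i j : ℕ} (h : i + j ≤ k)
    {φ : ℝ × ℝ → ℝ} (hφ : IsTest Ω φ) :
    ∫ p in Ω, comp q 0 0 p * mixedDeriv i j φ p =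
      (-1) ^ (i + j) * ∫ p in Ω, comp q i j p * φ p := by
  rw [comp_of_le q h, comp_of_le q (Nat.zero_le k)]
  exact q.2 ⟨(⟨i, by omega⟩, ⟨j, by omega⟩), h⟩ φ hφ

lemma hasWeakDx_comp (q : sobolev k Ω) {i j : ℕ} (h : i + j + 1 ≤ k) :
    HasWeakDx Ω (comp q i j) (comp q (i + 1) j) := by
  intro φ hφ
  have hdx := setIntegral_comp_mul_mixedDeriv q (i := i) (j := j) (by omega) hφ.dx
  rw [hφ.mixedDeriv_dx, setIntegral_comp_mul_mixedDeriv q (by omega) hφ, add_right_comm,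
    pow_succ] at hdx
  refine mul_left_cancel₀ (pow_ne_zero (i + j) (neg_ne_zero.2 (one_ne_zero (α := ℝ)))) ?_
  rw [← hdx]
  ring

lemma hasWeakDt_comp (q : sobolev k Ω) {i j : ℕ} (h : i + j + 1 ≤ k) :
    HasWeakDt Ω (comp q i j) (comp q i (j + 1)) := by
  intro φ hφ
  have hdt := setIntegral_comp_mul_mixedDeriv q (i := i) (j := j) (by omega) hφ.dt
  rw [mixedDeriv_dt, setIntegral_comp_mul_mixedDeriv q (by omega) hφ, ← add_assoc,
    pow_succ] at hdt
  refine mul_left_cancel₀ (pow_ne_zero (i + j) (neg_ne_zero.2 (one_ne_zero (α := ℝ)))) ?_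
  rw [← hdt]
  ring

lemma comp_add (q h : sobolev k Ω) (i j : ℕ) :
    comp (q + h) i j =ᵐ[volume.restrict Ω] comp q i j + comp h i j := by
  unfold comp
  split_ifs with hij
  · exact Lp.coeFn_add _ _
  · simp

lemma comp_smul (c : ℝ) (q : sobolev k Ω) (i j : ℕ) :
    comp (c • q) i j =ᵐ[volume.restrict Ω] c • comp q i j := by
  unfold comp
  split_ifs with hij
  · exact Lp.coeFn_smul _ _
  · simp

lemma exists_integral_norm_le_norm_Lp {X : Type*} [MeasurableSpace X] (μ : Measure X)
    [IsFiniteMeasure μ] : ∃ K > 0, ∀ w : Lp ℝ 2 μ, ∫ p, ‖w p‖ ∂μ ≤ K * ‖w‖ := by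
  set c := μ univ ^ (1 / (1 : ENNReal).toReal - 1 / (2 : ENNReal).toReal)
  have hc : c ≠ ⊤ := ENNReal.rpow_ne_top_of_nonneg (by norm_num) (measure_ne_top _ _)
  refine ⟨c.toReal + 1, by positivity, fun w => ?_⟩
  have hHolder : eLpNorm w 1 μ ≤ eLpNorm w 2 μ * c :=
    eLpNorm_le_eLpNorm_mul_rpow_measure_univ (by norm_num) (Lp.memLp w).1
  calc ∫ p, ‖w p‖ ∂μ = (eLpNorm w 1 μ).toReal := by
        rw [eLpNorm_one_eq_lintegral_enorm, integral_norm_eq_lintegral_enorm (Lp.memLp w).1]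
    _ ≤ (eLpNorm w 2 μ * c).toReal :=
        ENNReal.toReal_mono (ENNReal.mul_ne_top (Lp.memLp w).2.ne hc) hHolder
    _ = ‖w‖ * c.toReal := by rw [ENNReal.toReal_mul, Lp.norm_def]
    _ ≤ (c.toReal + 1) * ‖w‖ := by linarith [norm_nonneg w]

variable [IsFiniteMeasure ((volume : Measure (ℝ × ℝ)).restrict Ω)]

lemma integrableOn_comp (q : sobolev k Ω) (i j : ℕ) : IntegrableOn (comp q i j) Ω := by
  unfold comp
  split_ifs with h
  · exact (Lp.memLp (q.1 ⟨(⟨i, by omega⟩, ⟨j, by omega⟩), h⟩)).integrable (by norm_num)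
  · exact integrable_zero _ _ _

variable (k Ω) in
lemma exists_integral_norm_comp_le :
    ∃ K > 0, ∀ (q : sobolev k Ω) (i j : ℕ), ∫ p in Ω, ‖comp q i j p‖ ≤ K * ‖q‖ := by
  obtain ⟨K, hK0, hK⟩ := exists_integral_norm_le_norm_Lp ((volume : Measure (ℝ × ℝ)).restrict Ω)
  refine ⟨K, hK0, fun q i j => ?_⟩
  unfold comp
  split_ifs with h
  · exact (hK _).trans (mul_le_mul_of_nonneg_left (PiLp.norm_apply_le q.1 _) hK0.le)
  · simp only [Pi.zero_apply, norm_zero, integral_zero]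
    positivity

end Components

section ContinuousRepresentative

variable {k : ℕ} {ε M T : ℝ}

instance isFiniteMeasure_restrict_rect :
    IsFiniteMeasure ((volume : Measure (ℝ × ℝ)).restrict (rect ε M T)) :=
  isFiniteMeasure_restrict.2
    ((Metric.isBounded_Ioo ε M).prod (Metric.isBounded_Ioo 0 T)).measure_lt_top.ne

/-- The continuous representative of `∂ₓⁱ ∂ₜʲ q`, `i + j + 2 ≤ k`, for `q ∈ Hᵏ`, extended
continuously to the plane. -/
def rep (q : sobolev k (rect ε M T)) (i j : ℕ) (x t : ℝ) : ℝ :=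
  boxRep ε M 0 T (comp q i j) (comp q (i + 1) j) (comp q i (j + 1)) (comp q (i + 1) (j + 1)) (x, t)

lemma rep_smul (c : ℝ) (q : sobolev k (rect ε M T)) (i j : ℕ) (x t : ℝ) :
    rep (c • q) i j x t = c * rep q i j x t := by
  rw [rep, rep, boxRep, boxRep, ← integral_const_mul]
  refine integral_congr_ae ?_
  filter_upwards [comp_smul c q i j, comp_smul c q (i + 1) j, comp_smul c q i (j + 1),
    comp_smul c q (i + 1) (j + 1)] with z hval hdx hdt hdxt
  simp only [boxRepIntegrand, hval, hdx, hdt, hdxt, Pi.smul_apply, smul_eq_mul]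
  ring

variable (hε : ε < M) (hT : 0 < T)
include hε hT

lemma rep_add (q h : sobolev k (rect ε M T)) (i j : ℕ) (x t : ℝ) :
    rep (q + h) i j x t = rep q i j x t + rep h i j x t := by
  have hint : ∀ w : sobolev k (rect ε M T), IntegrableOn (boxRepIntegrand ε M 0 T (comp w i j)
      (comp w (i + 1) j) (comp w i (j + 1)) (comp w (i + 1) (j + 1)) (x, t)) (rect ε M T) :=
    fun w => integrableOn_boxRepIntegrand hε hT (integrableOn_comp w i j)
      (integrableOn_comp w (i + 1) j) (integrableOn_comp w i (j + 1))
      (integrableOn_comp w (i + 1) (j + 1)) (x, t)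
  refine (integral_congr_ae ?_).trans (integral_add (hint q) (hint h))
  filter_upwards [comp_add q h i j, comp_add q h (i + 1) j, comp_add q h i (j + 1),
    comp_add q h (i + 1) (j + 1)] with z hval hdx hdt hdxt
  simp only [boxRepIntegrand, hval, hdx, hdt, hdxt, Pi.add_apply]
  ring

lemma rep_sub (q h : sobolev k (rect ε M T)) (i j : ℕ) (x t : ℝ) :
    rep (q - h) i j x t = rep q i j x t - rep h i j x t := by
  rw [sub_eq_add_neg, ← neg_one_smul ℝ h, rep_add hε hT, rep_smul]
  ring

lemma continuous_rep (q : sobolev k (rect ε M T)) (i j : ℕ) :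
    Continuous fun p : ℝ × ℝ => rep q i j p.1 p.2 :=
  continuous_boxRep hε hT (integrableOn_comp q i j) (integrableOn_comp q (i + 1) j)
    (integrableOn_comp q i (j + 1)) (integrableOn_comp q (i + 1) (j + 1))

lemma comp_ae_eq_rep (q : sobolev k (rect ε M T)) {i j : ℕ} (h : i + j + 2 ≤ k) :
    comp q i j =ᵐ[volume.restrict (rect ε M T)] fun p => rep q i j p.1 p.2 :=
  ae_eq_boxRep hε hT (integrableOn_comp q i j) (integrableOn_comp q (i + 1) j)
    (integrableOn_comp q i (j + 1)) (integrableOn_comp q (i + 1) (j + 1))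
    (hasWeakDx_comp q (by omega)) (hasWeakDt_comp q (by omega)) (hasWeakDt_comp q (by omega))

lemma hasDerivAt_rep_x (q : sobolev k (rect ε M T)) {i j : ℕ} (h : i + j + 3 ≤ k) {x t : ℝ}
    (hx : x ∈ Ioo ε M) (ht : t ∈ Icc 0 T) :
    HasDerivAt (fun s => rep q i j s t) (rep q (i + 1) j x t) x :=
  HasWeakDx.hasDerivAt hε hT (continuous_rep hε hT q i j) (continuous_rep hε hT q (i + 1) j)
    ((hasWeakDx_comp q (by omega)).congr (comp_ae_eq_rep hε hT q (by omega))
      (comp_ae_eq_rep hε hT q (by omega))) hx ht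

lemma hasDerivAt_rep_t (q : sobolev k (rect ε M T)) {i j : ℕ} (h : i + j + 3 ≤ k) {x t : ℝ}
    (hx : x ∈ Icc ε M) (ht : t ∈ Ioo 0 T) :
    HasDerivAt (fun s => rep q i j x s) (rep q i (j + 1) x t) t :=
  HasWeakDt.hasDerivAt hε hT (continuous_rep hε hT q i j) (continuous_rep hε hT q i (j + 1))
    ((hasWeakDt_comp q (by omega)).congr (comp_ae_eq_rep hε hT q (by omega))
      (comp_ae_eq_rep hε hT q (by omega))) hx ht

variable (k) in
lemma exists_abs_rep_le : ∃ K > 0, ∀ (q : sobolev k (rect ε M T)) (i j : ℕ) (x t : ℝ),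
    |rep q i j x t| ≤ K * ‖q‖ := by
  obtain ⟨K₁, hK₁0, hK₁⟩ := exists_abs_boxRep_le hε hT
  obtain ⟨K₂, hK₂0, hK₂⟩ := exists_integral_norm_comp_le k (rect ε M T)
  refine ⟨K₁ * (4 * K₂), by positivity, fun q i j x t => ?_⟩
  refine (hK₁ _ _ _ _ (integrableOn_comp q i j) (integrableOn_comp q (i + 1) j)
    (integrableOn_comp q i (j + 1)) (integrableOn_comp q (i + 1) (j + 1)) (x, t)).trans ?_
  rw [mul_assoc]
  refine mul_le_mul_of_nonneg_left ?_ hK₁0.le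
  change (∫ z in rect ε M T, ‖comp q i j z‖) + (∫ z in rect ε M T, ‖comp q (i + 1) j z‖)
    + (∫ z in rect ε M T, ‖comp q i (j + 1) z‖)
    + ∫ z in rect ε M T, ‖comp q (i + 1) (j + 1) z‖ ≤ 4 * K₂ * ‖q‖
  linarith [hK₂ q i j, hK₂ q (i + 1) j, hK₂ q i (j + 1), hK₂ q (i + 1) (j + 1)]

lemma D_eq_rep (q : H5 ε M T) {i j : ℕ} (h : i + j ≤ 3) {x t : ℝ} (hx : x ∈ Icc ε M)
    (ht : t ∈ Icc 0 T) : D q i j x t (h.trans (by norm_num)) = rep q i j x t := by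
  have h5 : i + j ≤ 5 := by omega
  have hrep : q.1 ⟨(⟨i, by omega⟩, ⟨j, by omega⟩), h5⟩
      =ᵐ[(volume : Measure (ℝ × ℝ)).restrict (rect ε M T)] fun p => rep q i j p.1 p.2 := by
    rw [← comp_of_le q h5]
    exact comp_ae_eq_rep hε hT q (by omega)
  have hcont : ContinuousOn (fun p : ℝ × ℝ => rep q i j p.1 p.2) (Icc ε M ×ˢ Icc 0 T) :=
    (continuous_rep hε hT q i j).continuousOn
  have hex : ∃ f : ℝ × ℝ → ℝ, ContinuousOn f (Icc ε M ×ˢ Icc 0 T) ∧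
      f =ᵐ[(volume : Measure (ℝ × ℝ)).restrict (rect ε M T)]
        q.1 ⟨(⟨i, by omega⟩, ⟨j, by omega⟩), h5⟩ := ⟨_, hcont, hrep.symm⟩
  rw [D, contRep, dif_pos hex]
  exact eqOn_closedBox hε hT hex.choose_spec.1 hcont (hex.choose_spec.2.trans hrep)
    (mk_mem_prod hx ht)

end ContinuousRepresentative

section RectIntegral

variable {ε M T : ℝ} {f g G : ℝ × ℝ → ℝ}

lemma integrableOn_rect_of_continuous (hf : Continuous f) : IntegrableOn f (rect ε M T) :=
  integrableOn_of_continuous_box hf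

lemma measurableSet_rect : MeasurableSet (rect ε M T) := measurableSet_Ioo.prod measurableSet_Ioo

lemma setIntegral_rect_mono (hf : Continuous f) (hg : Continuous g)
    (h : ∀ z ∈ rect ε M T, f z ≤ g z) : ∫ z in rect ε M T, f z ≤ ∫ z in rect ε M T, g z :=
  setIntegral_mono_on (integrableOn_rect_of_continuous hf) (integrableOn_rect_of_continuous hg)
    measurableSet_rect h

variable (hε : ε ≤ M) (hT : 0 ≤ T)
include hε hT

lemma setIntegral_rect (hf : Continuous f) :
    ∫ z in rect ε M T, f z = ∫ x in ε..M, ∫ t in (0 : ℝ)..T, f (x, t) := by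
  have hint : IntegrableOn f (rect ε M T) := integrableOn_rect_of_continuous hf
  rw [IntegrableOn, rect, volume_restrict_box] at hint
  rw [rect, volume_restrict_box, integral_prod _ hint]
  simp only [intervalIntegral_eq_setIntegral_Ioo hε, intervalIntegral_eq_setIntegral_Ioo hT]

lemma setIntegral_rect_symm (hf : Continuous f) :
    ∫ z in rect ε M T, f z = ∫ t in (0 : ℝ)..T, ∫ x in ε..M, f (x, t) := by
  have hint : IntegrableOn f (rect ε M T) := integrableOn_rect_of_continuous hf
  rw [IntegrableOn, rect, volume_restrict_box] at hint
  rw [rect, volume_restrict_box, integral_prod_symm _ hint]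
  simp only [intervalIntegral_eq_setIntegral_Ioo hε, intervalIntegral_eq_setIntegral_Ioo hT]

lemma setIntegral_rect_deriv_x (hG : Continuous G) (hg : Continuous g)
    (h : ∀ x ∈ Ioo ε M, ∀ t ∈ Icc 0 T, HasDerivAt (fun s => G (s, t)) (g (x, t)) x) :
    ∫ z in rect ε M T, g z = ∫ t in (0 : ℝ)..T, (G (M, t) - G (ε, t)) := by
  rw [setIntegral_rect_symm hε hT hg]
  refine intervalIntegral.integral_congr fun t ht => ?_
  rw [uIcc_of_le hT] at ht
  exact intervalIntegral.integral_eq_sub_of_hasDerivAt_of_le hε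
    (f := fun s => G (s, t)) (Continuous.continuousOn (by fun_prop)) (fun x hx => h x hx t ht)
    (Continuous.intervalIntegrable (by fun_prop) _ _)

lemma setIntegral_rect_deriv_t (hG : Continuous G) (hg : Continuous g)
    (h : ∀ x ∈ Icc ε M, ∀ t ∈ Ioo 0 T, HasDerivAt (fun s => G (x, s)) (g (x, t)) t) :
    ∫ z in rect ε M T, g z = ∫ x in ε..M, (G (x, T) - G (x, 0)) := by
  rw [setIntegral_rect hε hT hg]
  refine intervalIntegral.integral_congr fun x hx => ?_
  rw [uIcc_of_le hε] at hx
  exact intervalIntegral.integral_eq_sub_of_hasDerivAt_of_le hT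
    (f := fun s => G (x, s)) (Continuous.continuousOn (by fun_prop)) (fun t ht => h x hx t ht)
    (Continuous.intervalIntegrable (by fun_prop) _ _)

end RectIntegral

section WeightedEnergy

variable {ε M T lam α : ℝ}

/-- The Carleman weight `e^{-2λ(x + αt)}`. -/
def weight (lam α x t : ℝ) : ℝ := Real.exp (-2 * lam * (x + α * t))

lemma weight_pos (lam α x t : ℝ) : 0 < weight lam α x t := Real.exp_pos _

lemma weight_eq (x t : ℝ) :
    weight lam α x t = Real.exp (-2 * lam * x) * Real.exp (-2 * lam * α * t) := by
  rw [weight, ← Real.exp_add]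
  ring_nf

lemma weight_zero_right (x : ℝ) : weight lam α x 0 = Real.exp (-2 * lam * x) := by simp [weight]

@[fun_prop]
lemma continuous_weight {X : Type*} [TopologicalSpace X] {f g : X → ℝ} (hf : Continuous f)
    (hg : Continuous g) : Continuous fun z => weight lam α (f z) (g z) := by
  unfold weight
  fun_prop

lemma hasDerivAt_exp_const_mul (c x : ℝ) :
    HasDerivAt (fun s => Real.exp (c * s)) (c * Real.exp (c * x)) x := by
  simpa [mul_comm] using ((hasDerivAt_id x).const_mul c).exp

lemma hasDerivAt_weight_x (x t : ℝ) :
    HasDerivAt (fun s => weight lam α s t) (-2 * lam * weight lam α x t) x := by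
  simp only [weight_eq, ← mul_assoc]
  exact (hasDerivAt_exp_const_mul (-2 * lam) x).mul_const _

lemma hasDerivAt_weight_t (x t : ℝ) :
    HasDerivAt (fun s => weight lam α x s) (-2 * lam * α * weight lam α x t) t := by
  simp only [weight_eq]
  exact ((hasDerivAt_exp_const_mul (-2 * lam * α) t).const_mul _).congr_deriv (by ring)

lemma hasDerivAt_sq {f : ℝ → ℝ} {f' x : ℝ} (h : HasDerivAt f f' x) :
    HasDerivAt (fun x => f x ^ 2) (2 * f x * f') x := by
  simpa using h.fun_pow 2

lemma continuous_slice {f : ℝ → ℝ → ℝ} (hf : Continuous fun z : ℝ × ℝ => f z.1 z.2) (t : ℝ) :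
    Continuous fun x => f x t :=
  hf.comp (by fun_prop : Continuous fun x : ℝ => (x, t))

/-- The squared weighted norm `∫_{Ω_T} e^{-2λ(x + αt)} f²` of a function on the rectangle. -/
def bulkEnergy (ε M T lam α : ℝ) (f : ℝ → ℝ → ℝ) : ℝ :=
  ∫ z in rect ε M T, weight lam α z.1 z.2 * f z.1 z.2 ^ 2

/-- The squared weighted norm `∫_ε^M e^{-2λx} f²` of a function on a time slice. -/
def lineEnergy (ε M lam : ℝ) (f : ℝ → ℝ) : ℝ :=
  ∫ x in ε..M, Real.exp (-2 * lam * x) * f x ^ 2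

lemma bulkEnergy_nonneg (f : ℝ → ℝ → ℝ) : 0 ≤ bulkEnergy ε M T lam α f :=
  integral_nonneg fun _ => mul_nonneg (weight_pos _ _ _ _).le (sq_nonneg _)

lemma lineEnergy_nonneg (hε : ε ≤ M) (f : ℝ → ℝ) : 0 ≤ lineEnergy ε M lam f :=
  intervalIntegral.integral_nonneg hε fun _ _ => by positivity

lemma bulkEnergy_le_of_sq_le {f g k : ℝ → ℝ → ℝ} {b c : ℝ}
    (hf : Continuous fun z : ℝ × ℝ => f z.1 z.2) (hg : Continuous fun z : ℝ × ℝ => g z.1 z.2)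
    (hk : Continuous fun z : ℝ × ℝ => k z.1 z.2)
    (hle : ∀ x ∈ Icc ε M, ∀ t, k x t ^ 2 ≤ b * f x t ^ 2 + c * g x t ^ 2) :
    bulkEnergy ε M T lam α k ≤ b * bulkEnergy ε M T lam α f + c * bulkEnergy ε M T lam α g := by
  unfold bulkEnergy
  rw [← integral_const_mul, ← integral_const_mul,
    ← integral_add (integrableOn_rect_of_continuous (by fun_prop))
      (integrableOn_rect_of_continuous (by fun_prop))]
  refine setIntegral_rect_mono (by fun_prop) (by fun_prop) fun z hz => ?_
  linarith [mul_le_mul_of_nonneg_left (hle z.1 (Ioo_subset_Icc_self hz.1) z.2)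
    (weight_pos lam α z.1 z.2).le]

lemma lineEnergy_le_of_abs_le (h0 : 0 ≤ ε) (hε : ε ≤ M) (hlam : 0 ≤ lam) {f : ℝ → ℝ} {N : ℝ}
    (hf : Continuous f) (hN : ∀ x, |f x| ≤ N) : lineEnergy ε M lam f ≤ (M - ε) * N ^ 2 := by
  have hconst : ∫ _ in ε..M, N ^ 2 = (M - ε) * N ^ 2 := by simp
  rw [← hconst]
  refine intervalIntegral.integral_mono_on hε (Continuous.intervalIntegrable (by fun_prop) _ _)
    (Continuous.intervalIntegrable (by fun_prop) _ _) fun x hx => ?_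
  have hexp : Real.exp (-2 * lam * x) ≤ 1 := by
    rw [Real.exp_le_one_iff]
    linarith [mul_nonneg hlam (h0.trans hx.1)]
  calc Real.exp (-2 * lam * x) * f x ^ 2 ≤ 1 * f x ^ 2 := by gcongr
    _ ≤ N ^ 2 := by
      rw [one_mul]
      exact sq_le_sq' (abs_le.1 (hN x)).1 (abs_le.1 (hN x)).2

lemma continuous_lineEnergy_slice {f : ℝ → ℝ → ℝ} (hf : Continuous fun z : ℝ × ℝ => f z.1 z.2) :
    Continuous fun t => lineEnergy ε M lam fun x => f x t := by
  refine intervalIntegral.continuous_parametric_intervalIntegral_of_continuous'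
    (f := fun t x => Real.exp (-2 * lam * x) * f x t ^ 2) ?_ ε M
  exact (by fun_prop : Continuous fun z : ℝ × ℝ => Real.exp (-2 * lam * z.1) * f z.1 z.2 ^ 2).comp
    continuous_swap

lemma bulkEnergy_eq_integral_lineEnergy (hε : ε ≤ M) (hT : 0 ≤ T) {f : ℝ → ℝ → ℝ}
    (hf : Continuous fun z : ℝ × ℝ => f z.1 z.2) : bulkEnergy ε M T lam α f =
      ∫ t in (0 : ℝ)..T, Real.exp (-2 * lam * α * t) * lineEnergy ε M lam fun x => f x t := by
  rw [bulkEnergy, setIntegral_rect_symm hε hT (by fun_prop)]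
  simp only [lineEnergy, ← intervalIntegral.integral_const_mul, weight_eq]
  congr! 4 with t
  ring

end WeightedEnergy

section Carleman

variable {ε M T lam α : ℝ}

lemma hardy_lineEnergy (hε : ε ≤ M) (hlam : 0 ≤ lam) {f f' : ℝ → ℝ} (hf : Continuous f)
    (hf' : Continuous f') (hd : ∀ x ∈ Ioo ε M, HasDerivAt f (f' x) x) (h0 : f ε = 0) :
    lam ^ 2 * lineEnergy ε M lam f ≤ lineEnergy ε M lam f' := by
  have hint : ∀ {g : ℝ → ℝ}, Continuous g → IntervalIntegrable g volume ε M :=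
    fun hg => hg.intervalIntegrable _ _
  have hftc : ∫ x in ε..M, (-2 * lam * Real.exp (-2 * lam * x) * f x ^ 2
      + Real.exp (-2 * lam * x) * (2 * f x * f' x)) = Real.exp (-2 * lam * M) * f M ^ 2 := by
    rw [intervalIntegral.integral_eq_sub_of_hasDerivAt_of_le hε
      (f := fun x => Real.exp (-2 * lam * x) * f x ^ 2) (by fun_prop) ?_ (hint (by fun_prop)), h0]
    · simp
    · exact fun x hx => (hasDerivAt_exp_const_mul _ x).mul (hasDerivAt_sq (hd x hx))
  have hmono : ∫ x in ε..M, (lam * (-2 * lam * Real.exp (-2 * lam * x) * f x ^ 2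
      + Real.exp (-2 * lam * x) * (2 * f x * f' x))
      + lam ^ 2 * (Real.exp (-2 * lam * x) * f x ^ 2)) ≤ lineEnergy ε M lam f' := by
    refine intervalIntegral.integral_mono_on hε (hint (by fun_prop)) (hint (by fun_prop))
      fun x _ => ?_
    linarith [mul_nonneg (Real.exp_pos (-2 * lam * x)).le (sq_nonneg (f' x - lam * f x))]
  rw [intervalIntegral.integral_add (hint (by fun_prop)) (hint (by fun_prop)),
    intervalIntegral.integral_const_mul, intervalIntegral.integral_const_mul, hftc] at hmono
  have hboundary : 0 ≤ lam * (Real.exp (-2 * lam * M) * f M ^ 2) := by positivity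
  exact (le_add_of_nonneg_left hboundary).trans hmono

lemma hardy_bulkEnergy (hε : ε ≤ M) (hT : 0 ≤ T) (hlam : 0 ≤ lam) {g gx : ℝ → ℝ → ℝ}
    (hg : Continuous fun z : ℝ × ℝ => g z.1 z.2) (hgx : Continuous fun z : ℝ × ℝ => gx z.1 z.2)
    (hd : ∀ x ∈ Ioo ε M, ∀ t ∈ Icc 0 T, HasDerivAt (fun s => g s t) (gx x t) x)
    (h0 : ∀ t ∈ Icc 0 T, g ε t = 0) :
    lam ^ 2 * bulkEnergy ε M T lam α g ≤ bulkEnergy ε M T lam α gx := by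
  have hg' := continuous_lineEnergy_slice (ε := ε) (M := M) (lam := lam) hg
  have hgx' := continuous_lineEnergy_slice (ε := ε) (M := M) (lam := lam) hgx
  rw [bulkEnergy_eq_integral_lineEnergy hε hT hg, bulkEnergy_eq_integral_lineEnergy hε hT hgx,
    ← intervalIntegral.integral_const_mul]
  refine intervalIntegral.integral_mono_on hT (Continuous.intervalIntegrable (by fun_prop) _ _)
    (Continuous.intervalIntegrable (by fun_prop) _ _) fun t ht => ?_
  rw [mul_left_comm]
  gcongr
  exact hardy_lineEnergy hε hlam (continuous_slice hg t) (continuous_slice hgx t)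
    (fun x hx => hd x hx t ht) (h0 t ht)

section Transport

variable {γ a₀ a₁ : ℝ} {a : ℝ → ℝ} {p px pt : ℝ → ℝ → ℝ}

lemma setIntegral_weight_mul_deriv_x_sq_nonneg (hε : ε ≤ M) (hT : 0 ≤ T)
    (hp : Continuous fun z : ℝ × ℝ => p z.1 z.2) (hpx : Continuous fun z : ℝ × ℝ => px z.1 z.2)
    (hdx : ∀ x ∈ Ioo ε M, ∀ t ∈ Icc 0 T, HasDerivAt (fun s => p s t) (px x t) x)
    (h0 : ∀ t ∈ Icc 0 T, p ε t = 0) :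
    0 ≤ ∫ z in rect ε M T, (-2 * lam * weight lam α z.1 z.2 * p z.1 z.2 ^ 2
      + weight lam α z.1 z.2 * (2 * p z.1 z.2 * px z.1 z.2)) := by
  rw [setIntegral_rect_deriv_x hε hT (G := fun z => weight lam α z.1 z.2 * p z.1 z.2 ^ 2)
    (by fun_prop) (by fun_prop)
    (fun x hx t ht => (hasDerivAt_weight_x x t).mul (hasDerivAt_sq (hdx x hx t ht)))]
  refine intervalIntegral.integral_nonneg hT fun t ht => ?_
  simpa [h0 t ht] using mul_nonneg (weight_pos lam α M t).le (sq_nonneg (p M t))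

lemma setIntegral_weight_mul_deriv_t_sq_le (hε : ε ≤ M) (hT : 0 ≤ T) (ha : Continuous a)
    (ha₀ : ∀ x ∈ Icc ε M, a₀ ≤ a x) (ha₁ : ∀ x ∈ Icc ε M, a x ≤ a₁)
    (hp : Continuous fun z : ℝ × ℝ => p z.1 z.2) (hpt : Continuous fun z : ℝ × ℝ => pt z.1 z.2)
    (hdt : ∀ x ∈ Icc ε M, ∀ t ∈ Ioo 0 T, HasDerivAt (fun s => p x s) (pt x t) t) :
    ∫ z in rect ε M T, a z.1 * (-2 * lam * α * weight lam α z.1 z.2 * p z.1 z.2 ^ 2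
        + weight lam α z.1 z.2 * (2 * p z.1 z.2 * pt z.1 z.2))
      ≤ a₁ * Real.exp (-2 * lam * α * T) * lineEnergy ε M lam (fun x => p x T)
        - a₀ * lineEnergy ε M lam fun x => p x 0 := by
  have hpT := continuous_slice hp T
  have hp0 := continuous_slice hp 0
  rw [setIntegral_rect_deriv_t hε hT
    (G := fun z => a z.1 * (weight lam α z.1 z.2 * p z.1 z.2 ^ 2)) (by fun_prop) (by fun_prop)
    (fun x hx t ht =>
      ((hasDerivAt_weight_t x t).mul (hasDerivAt_sq (hdt x hx t ht))).const_mul (a x)),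
    lineEnergy, lineEnergy, ← intervalIntegral.integral_const_mul,
    ← intervalIntegral.integral_const_mul,
    ← intervalIntegral.integral_sub (Continuous.intervalIntegrable (by fun_prop) _ _)
      (Continuous.intervalIntegrable (by fun_prop) _ _)]
  refine intervalIntegral.integral_mono_on hε (Continuous.intervalIntegrable (by fun_prop) _ _)
    (Continuous.intervalIntegrable (by fun_prop) _ _) fun x hx => ?_
  rw [weight_zero_right, weight_eq]
  have hfinal := mul_le_mul_of_nonneg_right (ha₁ x hx) (by positivity :
    0 ≤ Real.exp (-2 * lam * x) * Real.exp (-2 * lam * α * T) * p x T ^ 2)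
  have hinitial := mul_le_mul_of_nonneg_right (ha₀ x hx) (by positivity :
    0 ≤ Real.exp (-2 * lam * x) * p x 0 ^ 2)
  linarith

lemma transport_estimate (hε : ε ≤ M) (hT : 0 ≤ T) (hlam : 0 ≤ lam) (hγ : 0 ≤ γ)
    (ha : Continuous a) (ha₀ : ∀ x ∈ Icc ε M, a₀ ≤ a x) (ha₁ : ∀ x ∈ Icc ε M, a x ≤ a₁)
    (hαa : ∀ x ∈ Icc ε M, γ ≤ 1 - α * a x)
    (hp : Continuous fun z : ℝ × ℝ => p z.1 z.2) (hpx : Continuous fun z : ℝ × ℝ => px z.1 z.2)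
    (hpt : Continuous fun z : ℝ × ℝ => pt z.1 z.2)
    (hdx : ∀ x ∈ Ioo ε M, ∀ t ∈ Icc 0 T, HasDerivAt (fun s => p s t) (px x t) x)
    (hdt : ∀ x ∈ Icc ε M, ∀ t ∈ Ioo 0 T, HasDerivAt (fun s => p x s) (pt x t) t)
    (h0 : ∀ t ∈ Icc 0 T, p ε t = 0) :
    lam ^ 2 * γ ^ 2 * bulkEnergy ε M T lam α p
        + lam * γ * a₀ * lineEnergy ε M lam (fun x => p x 0)
      ≤ bulkEnergy ε M T lam α (fun x t => px x t - a x * pt x t)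
        + lam * γ * a₁ * Real.exp (-2 * lam * α * T) * lineEnergy ε M lam fun x => p x T := by
  have hmono : ∫ z in rect ε M T, (lam * γ * (-2 * lam * weight lam α z.1 z.2 * p z.1 z.2 ^ 2
      + weight lam α z.1 z.2 * (2 * p z.1 z.2 * px z.1 z.2))
      - lam * γ * (a z.1 * (-2 * lam * α * weight lam α z.1 z.2 * p z.1 z.2 ^ 2
      + weight lam α z.1 z.2 * (2 * p z.1 z.2 * pt z.1 z.2)))
      + lam ^ 2 * γ ^ 2 * (weight lam α z.1 z.2 * p z.1 z.2 ^ 2))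
      ≤ bulkEnergy ε M T lam α (fun x t => px x t - a x * pt x t) := by
    refine setIntegral_rect_mono (by fun_prop) (by fun_prop) fun z hz => ?_
    have hw := (weight_pos lam α z.1 z.2).le
    have hsq := mul_nonneg hw (sq_nonneg (px z.1 z.2 - a z.1 * pt z.1 z.2 - lam * γ * p z.1 z.2))
    have hgap : 0 ≤ 2 * lam ^ 2 * γ * (weight lam α z.1 z.2 * p z.1 z.2 ^ 2)
        * (1 - α * a z.1 - γ) :=
      mul_nonneg (by positivity) (sub_nonneg.2 (hαa z.1 (Ioo_subset_Icc_self hz.1)))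
    linarith
  rw [integral_add (integrableOn_rect_of_continuous (by fun_prop))
      (integrableOn_rect_of_continuous (by fun_prop)),
    integral_sub (integrableOn_rect_of_continuous (by fun_prop))
      (integrableOn_rect_of_continuous (by fun_prop)), integral_const_mul, integral_const_mul,
    integral_const_mul, ← bulkEnergy] at hmono
  have hlamγ : 0 ≤ lam * γ := by positivity
  have hx := mul_nonneg hlamγ (setIntegral_weight_mul_deriv_x_sq_nonneg (lam := lam) (α := α)
    hε hT hp hpx hdx h0)
  have ht := mul_le_mul_of_nonneg_left (setIntegral_weight_mul_deriv_t_sq_le (lam := lam) (α := α)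
    hε hT ha ha₀ ha₁ hp hpt hdt) hlamγ
  linarith

end Transport

section MixedOperator

variable {γ a₀ a₁ : ℝ} {a a' : ℝ → ℝ} {h hx ht hxx hxt : ℝ → ℝ → ℝ}

/- `h_t` is recovered from `h_x` and `g = h_x - a h_t`; the latter vanishes at `x = ε` and
`g_x = (h_xx - a h_xt) - a' h_t`, so Hardy's inequality bounds it up to an absorbable term. -/
lemma sq_mul_bulkEnergy_dt_le (hε : ε ≤ M) (hT : 0 ≤ T) (hlam : 0 ≤ lam) (ha₀ : 0 ≤ a₀)
    (ha : Continuous a) (ha' : Continuous a') (hda : ∀ x ∈ Ioo ε M, HasDerivAt a (a' x) x)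
    (hage : ∀ x ∈ Icc ε M, a₀ ≤ a x) (hlama : ∀ x ∈ Icc ε M, 4 * |a' x| ≤ lam * a₀)
    (chx : Continuous fun z : ℝ × ℝ => hx z.1 z.2) (cht : Continuous fun z : ℝ × ℝ => ht z.1 z.2)
    (chxx : Continuous fun z : ℝ × ℝ => hxx z.1 z.2)
    (chxt : Continuous fun z : ℝ × ℝ => hxt z.1 z.2)
    (hdxx : ∀ x ∈ Ioo ε M, ∀ t ∈ Icc 0 T, HasDerivAt (fun s => hx s t) (hxx x t) x)
    (hdtx : ∀ x ∈ Ioo ε M, ∀ t ∈ Icc 0 T, HasDerivAt (fun s => ht s t) (hxt x t) x)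
    (hx0 : ∀ t ∈ Icc 0 T, hx ε t = 0) (ht0 : ∀ t ∈ Icc 0 T, ht ε t = 0) :
    lam ^ 2 * a₀ ^ 2 * bulkEnergy ε M T lam α ht ≤ 3 * (lam ^ 2 * bulkEnergy ε M T lam α hx)
      + 6 * bulkEnergy ε M T lam α (fun x t => hxx x t - a x * hxt x t) := by
  have hhardy := hardy_bulkEnergy (α := α) hε hT hlam (g := fun x t => hx x t - a x * ht x t)
    (gx := fun x t => (hxx x t - a x * hxt x t) - a' x * ht x t) (by fun_prop) (by fun_prop)
    (fun x hx' t ht' =>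
      ((hdxx x hx' t ht').sub ((hda x hx').mul (hdtx x hx' t ht'))).congr_deriv (by ring))
    (fun t ht' => by simp [hx0 t ht', ht0 t ht'])
  have hcoeff : bulkEnergy ε M T lam α (fun x t => (hxx x t - a x * hxt x t) - a' x * ht x t)
      ≤ 2 * bulkEnergy ε M T lam α (fun x t => hxx x t - a x * hxt x t)
        + (lam * a₀) ^ 2 / 8 * bulkEnergy ε M T lam α ht := by
    refine bulkEnergy_le_of_sq_le (by fun_prop) cht (by fun_prop) fun x hx' t => ?_
    have ha'sq : (4 * |a' x|) ^ 2 ≤ (lam * a₀) ^ 2 :=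
      pow_le_pow_left₀ (by positivity) (hlama x hx') 2
    rw [mul_pow, sq_abs] at ha'sq
    nlinarith [mul_le_mul_of_nonneg_right ha'sq (sq_nonneg (ht x t)),
      sq_nonneg ((hxx x t - a x * hxt x t) + a' x * ht x t)]
  have hsplit : bulkEnergy ε M T lam α (fun x t => a₀ * ht x t)
      ≤ 2 * bulkEnergy ε M T lam α hx
        + 2 * bulkEnergy ε M T lam α (fun x t => hx x t - a x * ht x t) := by
    refine bulkEnergy_le_of_sq_le chx (by fun_prop) (by fun_prop) fun x hx' t => ?_
    have hasq : a₀ ^ 2 ≤ a x ^ 2 := pow_le_pow_left₀ ha₀ (hage x hx') 2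
    nlinarith [mul_le_mul_of_nonneg_right hasq (sq_nonneg (ht x t)),
      sq_nonneg (2 * hx x t - a x * ht x t)]
  have hscale : bulkEnergy ε M T lam α (fun x t => a₀ * ht x t)
      = a₀ ^ 2 * bulkEnergy ε M T lam α ht := by
    simp only [bulkEnergy, mul_pow, mul_left_comm _ (a₀ ^ 2), integral_const_mul]
  rw [hscale] at hsplit
  have hx_nonneg := mul_nonneg (sq_nonneg lam) (bulkEnergy_nonneg (ε := ε) (M := M) (T := T)
    (lam := lam) (α := α) hx)
  have hop_nonneg := bulkEnergy_nonneg (ε := ε) (M := M) (T := T) (lam := lam) (α := α)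
    fun x t => hxx x t - a x * hxt x t
  linarith [mul_le_mul_of_nonneg_left hsplit (sq_nonneg lam)]

/-- The constant of the Carleman estimate for `∂ₓ² - a ∂ₓ∂ₜ` with `a₀ ≤ a ≤ a₁` and
`γ ≤ 1 - α a`. -/
def carlemanConst (γ a₀ a₁ : ℝ) : ℝ :=
  (1 + γ * a₁) * (2 / γ ^ 2 + (3 / γ ^ 2 + 6) / a₀ ^ 2 + 2 / (γ * a₀))

lemma carlemanConst_pos (hγ : 0 < γ) (ha₀ : 0 < a₀) (ha₁ : 0 ≤ a₁) :
    0 < carlemanConst γ a₀ a₁ := by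
  unfold carlemanConst
  positivity

lemma add_le_carlemanConst_mul {P Y U P₀ U₀ X E : ℝ} (hγ : 0 < γ) (ha₀ : 0 < a₀) (ha₁ : 0 ≤ a₁)
    (hlam : 1 ≤ lam) (hP : 0 ≤ P) (hP₀ : 0 ≤ P₀) (hU₀ : 0 ≤ U₀) (hX : 0 ≤ X) (hE : 0 ≤ E)
    (htransport : lam ^ 2 * γ ^ 2 * P + lam * γ * a₀ * P₀ ≤ X + γ * a₁ * E)
    (hY : lam ^ 2 * a₀ ^ 2 * Y ≤ 3 * (lam ^ 2 * P) + 6 * X) (hU : lam ^ 2 * U ≤ P)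
    (hU₀P₀ : lam ^ 2 * U₀ ≤ P₀) :
    lam ^ 2 * (P + Y + U) + lam * (P₀ + U₀) ≤ carlemanConst γ a₀ a₁ * (X + E) := by
  have hlam0 : 0 ≤ lam := by linarith
  have hlamsq : 1 ≤ lam ^ 2 := one_le_pow₀ hlam
  set S := X + γ * a₁ * E
  have hXS : X ≤ S := le_add_of_nonneg_right (by positivity)
  have hPS : lam ^ 2 * P ≤ S / γ ^ 2 := by
    rw [le_div_iff₀ (by positivity)]
    linarith [show 0 ≤ lam * γ * a₀ * P₀ by positivity]
  have hP₀S : lam * P₀ ≤ S / (γ * a₀) := by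
    rw [le_div_iff₀ (by positivity)]
    linarith [show 0 ≤ lam ^ 2 * γ ^ 2 * P by positivity]
  have hUS : lam ^ 2 * U ≤ S / γ ^ 2 := by linarith [mul_le_mul_of_nonneg_right hlamsq hP]
  have hU₀S : lam * U₀ ≤ S / (γ * a₀) :=
    (mul_le_mul_of_nonneg_left (by linarith [mul_le_mul_of_nonneg_right hlamsq hU₀])
      hlam0).trans hP₀S
  have hYS : lam ^ 2 * Y ≤ (3 / γ ^ 2 + 6) / a₀ ^ 2 * S := by
    rw [div_mul_eq_mul_div, le_div_iff₀ (by positivity)]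
    linarith [show 3 / γ ^ 2 * S = 3 * (S / γ ^ 2) by ring]
  have hSE : S ≤ (1 + γ * a₁) * (X + E) := by
    linarith [show 0 ≤ γ * a₁ * X by positivity]
  calc lam ^ 2 * (P + Y + U) + lam * (P₀ + U₀)
      ≤ (2 / γ ^ 2 + (3 / γ ^ 2 + 6) / a₀ ^ 2 + 2 / (γ * a₀)) * S := by
        linarith [show 2 / γ ^ 2 * S = 2 * (S / γ ^ 2) by ring,
          show 2 / (γ * a₀) * S = 2 * (S / (γ * a₀)) by ring]
    _ ≤ (2 / γ ^ 2 + (3 / γ ^ 2 + 6) / a₀ ^ 2 + 2 / (γ * a₀)) * ((1 + γ * a₁) * (X + E)) := by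
        gcongr
    _ = carlemanConst γ a₀ a₁ * (X + E) := by rw [carlemanConst]; ring

lemma carleman_estimate (hε : ε ≤ M) (hT : 0 ≤ T) (hlam : 1 ≤ lam) (hγ : 0 < γ) (ha₀ : 0 < a₀)
    (ha : Continuous a) (ha' : Continuous a') (hda : ∀ x ∈ Ioo ε M, HasDerivAt a (a' x) x)
    (hage : ∀ x ∈ Icc ε M, a₀ ≤ a x) (hale : ∀ x ∈ Icc ε M, a x ≤ a₁)
    (hlama : ∀ x ∈ Icc ε M, 4 * |a' x| ≤ lam * a₀) (hαa : ∀ x ∈ Icc ε M, γ ≤ 1 - α * a x)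
    (ch : Continuous fun z : ℝ × ℝ => h z.1 z.2) (chx : Continuous fun z : ℝ × ℝ => hx z.1 z.2)
    (cht : Continuous fun z : ℝ × ℝ => ht z.1 z.2) (chxx : Continuous fun z : ℝ × ℝ => hxx z.1 z.2)
    (chxt : Continuous fun z : ℝ × ℝ => hxt z.1 z.2)
    (hdx : ∀ x ∈ Ioo ε M, ∀ t ∈ Icc 0 T, HasDerivAt (fun s => h s t) (hx x t) x)
    (hdxx : ∀ x ∈ Ioo ε M, ∀ t ∈ Icc 0 T, HasDerivAt (fun s => hx s t) (hxx x t) x)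
    (hdxt : ∀ x ∈ Icc ε M, ∀ t ∈ Ioo 0 T, HasDerivAt (fun s => hx x s) (hxt x t) t)
    (hdtx : ∀ x ∈ Ioo ε M, ∀ t ∈ Icc 0 T, HasDerivAt (fun s => ht s t) (hxt x t) x)
    (h0 : ∀ t ∈ Icc 0 T, h ε t = 0) (hx0 : ∀ t ∈ Icc 0 T, hx ε t = 0)
    (ht0 : ∀ t ∈ Icc 0 T, ht ε t = 0) :
    lam ^ 2 * (bulkEnergy ε M T lam α hx + bulkEnergy ε M T lam α ht + bulkEnergy ε M T lam α h)
        + lam * (lineEnergy ε M lam (fun x => hx x 0) + lineEnergy ε M lam fun x => h x 0)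
      ≤ carlemanConst γ a₀ a₁ * (bulkEnergy ε M T lam α (fun x t => hxx x t - a x * hxt x t)
        + lam * Real.exp (-2 * lam * α * T) * lineEnergy ε M lam fun x => hx x T) := by
  have hlam0 : 0 ≤ lam := zero_le_one.trans hlam
  have hε_mem : ε ∈ Icc ε M := ⟨le_rfl, hε⟩
  have h0_mem : (0 : ℝ) ∈ Icc 0 T := ⟨le_rfl, hT⟩
  refine add_le_carlemanConst_mul hγ ha₀ (ha₀.le.trans ((hage ε hε_mem).trans (hale ε hε_mem)))
    hlam (bulkEnergy_nonneg _) (lineEnergy_nonneg hε _) (lineEnergy_nonneg hε _)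
    (bulkEnergy_nonneg _) (mul_nonneg (by positivity) (lineEnergy_nonneg hε _)) ?_ ?_ ?_ ?_
  · linarith [transport_estimate (α := α) hε hT hlam0 hγ.le ha hage hale hαa chx chxx chxt hdxx
      hdxt hx0]
  · exact sq_mul_bulkEnergy_dt_le hε hT hlam0 ha₀.le ha ha' hda hage hlama chx cht chxx chxt hdxx
      hdtx hx0 ht0
  · exact hardy_bulkEnergy hε hT hlam0 ch chx hdx h0
  · exact hardy_lineEnergy hε hlam0 (continuous_slice ch 0) (continuous_slice chx 0)
      (fun x hx' => hdx x hx' 0 h0_mem) (h0 0 h0_mem)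

end MixedOperator

end Carleman

section Pointwise

variable {B a b c r k da db dc dr v v' : ℝ}

/-- The nonlinear expression `F` in terms of `a = q_xx`, `b = q_xt`, `c = q_t`, `r = q_x(x,0)` and
`v = 1 / q(x,0)`. -/
def Fval (a b c r v : ℝ) : ℝ := a - b * v ^ 2 / 2 + c * r * v ^ 3 / 2

/-- The linearization of `F` in the direction with `da = h_xx`, `db = h_xt`, `dc = h_t`,
`k = h(x,0)` and `dr = h_x(x,0)`. -/
def Lval (b c r v da db dc k dr : ℝ) : ℝ :=
  da - db * v ^ 2 / 2 + b * v ^ 3 * k + (dc * r + c * dr) * v ^ 3 / 2 - 3 / 2 * (c * r * v ^ 4 * k)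

/-- The coefficient of `h_xt h(x,0)` in the quadratic remainder of `F`, where `v = 1 / q(x,0)` and
`v' = 1 / (q + h)(x,0)`. -/
def mixedCoeff (v v' : ℝ) : ℝ := v * v' * (v + v') / 2

lemma Fval_sub (hv : v - v' = k * v * v') :
    Fval (a + da) (b + db) (c + dc) (r + dr) v' - Fval a b c r v = (da - v' ^ 2 / 2 * db)
      + ((b * mixedCoeff v v' - c * r * (v * v' * (v ^ 2 + v * v' + v' ^ 2)) / 2) * k
        + (c * dr + dc * (r + dr)) * v' ^ 3 / 2) := by
  unfold Fval mixedCoeff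
  linear_combination (b * (v + v') / 2 - c * r * (v ^ 2 + v * v' + v' ^ 2) / 2) * hv

lemma Fval_sub_Lval (hv : v - v' = k * v * v') :
    Fval (a + da) (b + db) (c + dc) (r + dr) v' - Fval a b c r v - Lval b c r v da db dc k dr
      = db * k * mixedCoeff v v'
        + ((c * r * (v ^ 2 * v' * (3 * v ^ 2 + 2 * v * v' + v' ^ 2)) / 2
            - b * (v ^ 3 * v' + v ^ 2 * v' ^ 2 / 2)) * k ^ 2
          - (dc * (r + dr) + c * dr) * (v * v' * (v ^ 2 + v * v' + v' ^ 2)) * k / 2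
          + dc * dr * v ^ 3 / 2) := by
  have sq_sub : v' ^ 2 - v ^ 2 = -(k * v * v') * (v + v') := by
    linear_combination (-(v + v')) * hv
  have cube_sub : v' ^ 3 - v ^ 3 = -(k * v * v') * (v ^ 2 + v * v' + v' ^ 2) := by
    linear_combination (-(v ^ 2 + v * v' + v' ^ 2)) * hv
  have sq_taylor :
      v' ^ 2 - v ^ 2 + 2 * v ^ 3 * k = 2 * k ^ 2 * (v ^ 3 * v' + v ^ 2 * v' ^ 2 / 2) := by
    linear_combination sq_sub + (k * v * (2 * v + v')) * hv
  have cube_taylor : v' ^ 3 - v ^ 3 + 3 * v ^ 4 * k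
      = k ^ 2 * (v ^ 2 * v' * (3 * v ^ 2 + 2 * v * v' + v' ^ 2)) := by
    linear_combination cube_sub + (k * v * (3 * v ^ 2 + 2 * v * v' + v' ^ 2)) * hv
  unfold Fval Lval mixedCoeff
  linear_combination (-db / 2) * sq_sub - b / 2 * sq_taylor + c * r / 2 * cube_taylor
    + (dc * r + c * dr + dc * dr) / 2 * cube_sub

lemma abs_mul_abs_le (x y : ℝ) : |x| * |y| ≤ (x ^ 2 + y ^ 2) / 2 := by
  nlinarith [sq_nonneg (|x| - |y|), sq_abs x, sq_abs y]

lemma abs_mixedCoeff_le (hv : |v| ≤ B) (hv' : |v'| ≤ B) : |mixedCoeff v v'| ≤ B ^ 3 := by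
  have hB : 0 ≤ B := (abs_nonneg v).trans hv
  calc |mixedCoeff v v'| = |v| * |v'| * |v + v'| / 2 := by simp [mixedCoeff, abs_mul, abs_div]
    _ ≤ B * B * (B + B) / 2 := by gcongr; exact (abs_add_le _ _).trans (add_le_add hv hv')
    _ = B ^ 3 := by ring

lemma abs_quartic_le (hv : |v| ≤ B) (hv' : |v'| ≤ B) :
    |v * v' * (v ^ 2 + v * v' + v' ^ 2)| ≤ 3 * B ^ 4 := by
  have hB : 0 ≤ B := (abs_nonneg v).trans hv
  have hsum : |v ^ 2 + v * v' + v' ^ 2| ≤ B ^ 2 + B * B + B ^ 2 := by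
    refine (abs_add_three _ _ _).trans ?_
    rw [abs_mul, abs_pow, abs_pow]
    gcongr
  calc |v * v' * (v ^ 2 + v * v' + v' ^ 2)| = |v| * |v'| * |v ^ 2 + v * v' + v' ^ 2| := by
        rw [abs_mul, abs_mul]
    _ ≤ B * B * (B ^ 2 + B * B + B ^ 2) := by gcongr
    _ = 3 * B ^ 4 := by ring

lemma abs_sq_taylor_le (hv : |v| ≤ B) (hv' : |v'| ≤ B) :
    |v ^ 3 * v' + v ^ 2 * v' ^ 2 / 2| ≤ 3 / 2 * B ^ 4 := by
  have hB : 0 ≤ B := (abs_nonneg v).trans hv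
  calc |v ^ 3 * v' + v ^ 2 * v' ^ 2 / 2| ≤ |v| ^ 3 * |v'| + |v| ^ 2 * |v'| ^ 2 / 2 :=
        (abs_add_le _ _).trans (le_of_eq (by simp [abs_mul, abs_div]))
    _ ≤ B ^ 3 * B + B ^ 2 * B ^ 2 / 2 := by gcongr
    _ = 3 / 2 * B ^ 4 := by ring

lemma abs_cube_taylor_le (hv : |v| ≤ B) (hv' : |v'| ≤ B) :
    |v ^ 2 * v' * (3 * v ^ 2 + 2 * v * v' + v' ^ 2)| ≤ 6 * B ^ 5 := by
  have hB : 0 ≤ B := (abs_nonneg v).trans hv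
  have hsum : |3 * v ^ 2 + 2 * v * v' + v' ^ 2| ≤ 3 * B ^ 2 + 2 * B * B + B ^ 2 := by
    refine (abs_add_three _ _ _).trans ?_
    rw [abs_mul, abs_mul, abs_mul, abs_pow, abs_pow, abs_two,
      abs_of_pos (by norm_num : (0 : ℝ) < 3)]
    gcongr
  calc |v ^ 2 * v' * (3 * v ^ 2 + 2 * v * v' + v' ^ 2)|
      = |v| ^ 2 * |v'| * |3 * v ^ 2 + 2 * v * v' + v' ^ 2| := by rw [abs_mul, abs_mul, abs_pow]
    _ ≤ B ^ 2 * B * (3 * B ^ 2 + 2 * B * B + B ^ 2) := by gcongr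
    _ = 6 * B ^ 5 := by ring

lemma abs_mul_add_mul_le (hc : |c| ≤ B) (hr : |r| ≤ B) :
    |dc * r + c * dr| ≤ B * (|dc| + |dr|) := by
  calc |dc * r + c * dr| ≤ |dc| * |r| + |c| * |dr| :=
        (abs_add_le _ _).trans (by rw [abs_mul, abs_mul])
    _ ≤ |dc| * B + B * |dr| := by gcongr
    _ = B * (|dc| + |dr|) := by ring

lemma abs_Fval_le (hB : 1 ≤ B) (ha : |a| ≤ B) (hb : |b| ≤ B) (hc : |c| ≤ B) (hr : |r| ≤ B)
    (hv : |v| ≤ B) : |Fval a b c r v| ≤ 2 * B ^ 5 := by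
  have hpow1 : B ≤ B ^ 5 := le_self_pow₀ hB (by norm_num)
  have hpow3 : B ^ 3 ≤ B ^ 5 := pow_le_pow_right₀ hB (by norm_num)
  calc |Fval a b c r v| ≤ |a| + |b| * |v| ^ 2 / 2 + |c| * |r| * |v| ^ 3 / 2 := by
        unfold Fval
        refine (abs_add_le _ _).trans (add_le_add ((abs_sub _ _).trans (le_of_eq ?_)) (le_of_eq ?_))
        all_goals simp [abs_mul, abs_div]
    _ ≤ B + B * B ^ 2 / 2 + B * B * B ^ 3 / 2 := by gcongr
    _ = B + B ^ 3 / 2 + B ^ 5 / 2 := by ring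
    _ ≤ 2 * B ^ 5 := by linarith

lemma abs_Lval_le {s : ℝ} (hB : 1 ≤ B) (hb : |b| ≤ B) (hc : |c| ≤ B) (hr : |r| ≤ B)
    (hv : |v| ≤ B) (hda : |da| ≤ s) (hdb : |db| ≤ s) (hdc : |dc| ≤ s) (hk : |k| ≤ s)
    (hdr : |dr| ≤ s) : |Lval b c r v da db dc k dr| ≤ 6 * B ^ 6 * s := by
  have hs : 0 ≤ s := (abs_nonneg _).trans hda
  have hpow0 : 1 * s ≤ B ^ 6 * s := by gcongr; exact one_le_pow₀ hB
  have hpow2 : B ^ 2 * s ≤ B ^ 6 * s := by gcongr; norm_num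
  have hpow4 : B ^ 4 * s ≤ B ^ 6 * s := by gcongr; norm_num
  calc |Lval b c r v da db dc k dr|
      ≤ |da| + |db| * |v| ^ 2 / 2 + |b| * |v| ^ 3 * |k|
        + |dc * r + c * dr| * |v| ^ 3 / 2 + 3 / 2 * (|c| * |r| * |v| ^ 4 * |k|) := by
        unfold Lval
        refine (abs_sub _ _).trans (add_le_add ((abs_add_le _ _).trans (add_le_add
          ((abs_add_le _ _).trans (add_le_add ((abs_sub _ _).trans (le_of_eq ?_)) (le_of_eq ?_)))
          (le_of_eq ?_))) (le_of_eq ?_))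
        all_goals simp [abs_mul, abs_div]
    _ ≤ s + s * B ^ 2 / 2 + B * B ^ 3 * s + B * (s + s) * B ^ 3 / 2
        + 3 / 2 * (B * B * B ^ 4 * s) := by
        gcongr
        exact (abs_mul_add_mul_le hc hr).trans (by gcongr)
    _ = 1 * s + B ^ 2 * s / 2 + 2 * (B ^ 4 * s) + 3 / 2 * (B ^ 6 * s) := by ring
    _ ≤ 6 * B ^ 6 * s := by linarith

lemma abs_Fval_sub_principal_le (hB : 1 ≤ B) (hb : |b| ≤ B) (hc : |c| ≤ B) (hr : |r| ≤ B)
    (hrr : |r + dr| ≤ B) (hv : |v| ≤ B) (hv' : |v'| ≤ B) (hvv : v - v' = k * v * v') :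
    |Fval (a + da) (b + db) (c + dc) (r + dr) v' - Fval a b c r v - (da - v' ^ 2 / 2 * db)|
      ≤ 3 * B ^ 6 * (|k| + |dc| + |dr|) := by
  have hpow4 : B ^ 4 ≤ B ^ 6 := pow_le_pow_right₀ hB (by norm_num)
  rw [Fval_sub hvv, add_sub_cancel_left, add_comm (c * dr)]
  have hcoeff : |b * mixedCoeff v v' - c * r * (v * v' * (v ^ 2 + v * v' + v' ^ 2)) / 2|
      ≤ 3 * B ^ 6 := by
    calc _ ≤ |b| * |mixedCoeff v v'| + |c| * |r| * |v * v' * (v ^ 2 + v * v' + v' ^ 2)| / 2 :=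
          (abs_sub _ _).trans (le_of_eq (by simp only [abs_mul, abs_div, abs_two]))
      _ ≤ B * B ^ 3 + B * B * (3 * B ^ 4) / 2 := by
          gcongr
          exacts [abs_mixedCoeff_le hv hv', abs_quartic_le hv hv']
      _ = B ^ 4 + 3 / 2 * B ^ 6 := by ring
      _ ≤ 3 * B ^ 6 := by linarith [show 0 ≤ B ^ 6 by positivity]
  have hlow : |(dc * (r + dr) + c * dr) * v' ^ 3 / 2| ≤ 3 * B ^ 6 * (|dc| + |dr|) := by
    calc _ = |dc * (r + dr) + c * dr| * |v'| ^ 3 / 2 := by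
          simp only [abs_mul, abs_div, abs_pow, abs_two]
      _ ≤ B * (|dc| + |dr|) * B ^ 3 / 2 := by
          gcongr
          exact abs_mul_add_mul_le hc hrr
      _ = B ^ 4 / 2 * (|dc| + |dr|) := by ring
      _ ≤ 3 * B ^ 6 * (|dc| + |dr|) := by
          gcongr
          linarith [show 0 ≤ B ^ 6 by positivity]
  calc _ ≤ 3 * B ^ 6 * |k| + 3 * B ^ 6 * (|dc| + |dr|) := by
        refine (abs_add_le _ _).trans (add_le_add ?_ hlow)
        rw [abs_mul]
        gcongr
    _ = 3 * B ^ 6 * (|k| + |dc| + |dr|) := by ring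

lemma abs_quadratic_coeff_le (hB : 1 ≤ B) (hb : |b| ≤ B) (hc : |c| ≤ B) (hr : |r| ≤ B)
    (hv : |v| ≤ B) (hv' : |v'| ≤ B) :
    |c * r * (v ^ 2 * v' * (3 * v ^ 2 + 2 * v * v' + v' ^ 2)) / 2
      - b * (v ^ 3 * v' + v ^ 2 * v' ^ 2 / 2)| ≤ 5 * B ^ 7 := by
  have hpow5 : B ^ 5 ≤ B ^ 7 := pow_le_pow_right₀ hB (by norm_num)
  calc _ ≤ |c| * |r| * |v ^ 2 * v' * (3 * v ^ 2 + 2 * v * v' + v' ^ 2)| / 2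
        + |b| * |v ^ 3 * v' + v ^ 2 * v' ^ 2 / 2| :=
        (abs_sub _ _).trans (le_of_eq (by simp only [abs_mul, abs_div, abs_two]))
    _ ≤ B * B * (6 * B ^ 5) / 2 + B * (3 / 2 * B ^ 4) := by
        gcongr
        exacts [abs_cube_taylor_le hv hv', abs_sq_taylor_le hv hv']
    _ = 3 * B ^ 7 + 3 / 2 * B ^ 5 := by ring
    _ ≤ 5 * B ^ 7 := by linarith [show 0 ≤ B ^ 7 by positivity]

lemma abs_cross_term_le (hB : 1 ≤ B) (hc : |c| ≤ B) (hrr : |r + dr| ≤ B) (hv : |v| ≤ B)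
    (hv' : |v'| ≤ B) :
    |(dc * (r + dr) + c * dr) * (v * v' * (v ^ 2 + v * v' + v' ^ 2)) * k / 2|
      ≤ B ^ 7 * (2 * k ^ 2 + dc ^ 2 + dr ^ 2) := by
  have hpow5 : B ^ 5 ≤ B ^ 7 := pow_le_pow_right₀ hB (by norm_num)
  calc _ = |dc * (r + dr) + c * dr| * |v * v' * (v ^ 2 + v * v' + v' ^ 2)| * |k| / 2 := by
        simp only [abs_mul, abs_div, abs_two]
    _ ≤ B * (|dc| + |dr|) * (3 * B ^ 4) * |k| / 2 := by
        gcongr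
        exacts [abs_mul_add_mul_le hc hrr, abs_quartic_le hv hv']
    _ = 3 / 2 * B ^ 5 * (|dc| * |k| + |dr| * |k|) := by ring
    _ ≤ 2 * B ^ 7 * ((dc ^ 2 + k ^ 2) / 2 + (dr ^ 2 + k ^ 2) / 2) := by
        gcongr
        exacts [by norm_num, abs_mul_abs_le _ _, abs_mul_abs_le _ _]
    _ = B ^ 7 * (2 * k ^ 2 + dc ^ 2 + dr ^ 2) := by ring

lemma abs_Fval_remainder_le (hB : 1 ≤ B) (hb : |b| ≤ B) (hc : |c| ≤ B) (hr : |r| ≤ B)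
    (hrr : |r + dr| ≤ B) (hv : |v| ≤ B) (hv' : |v'| ≤ B) (hvv : v - v' = k * v * v') :
    |Fval (a + da) (b + db) (c + dc) (r + dr) v' - Fval a b c r v - Lval b c r v da db dc k dr
      - db * k * mixedCoeff v v'| ≤ 10 * B ^ 7 * (k ^ 2 + dc ^ 2 + dr ^ 2) := by
  have hpow3 : B ^ 3 ≤ B ^ 7 := pow_le_pow_right₀ hB (by norm_num)
  rw [Fval_sub_Lval hvv, add_sub_cancel_left]
  have hlast : |dc * dr * v ^ 3 / 2| ≤ B ^ 7 * (dc ^ 2 + dr ^ 2) := by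
    calc _ = |dc| * |dr| * |v| ^ 3 / 2 := by simp only [abs_mul, abs_div, abs_pow, abs_two]
      _ ≤ (dc ^ 2 + dr ^ 2) / 2 * B ^ 3 / 2 := by
          gcongr
          exact abs_mul_abs_le _ _
      _ = B ^ 3 / 4 * (dc ^ 2 + dr ^ 2) := by ring
      _ ≤ B ^ 7 * (dc ^ 2 + dr ^ 2) := by gcongr; linarith [show 0 ≤ B ^ 3 by positivity]
  calc _ ≤ 5 * B ^ 7 * k ^ 2 + B ^ 7 * (2 * k ^ 2 + dc ^ 2 + dr ^ 2)
        + B ^ 7 * (dc ^ 2 + dr ^ 2) := by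
        refine (abs_add_le _ _).trans (add_le_add ((abs_sub _ _).trans
          (add_le_add ?_ (abs_cross_term_le hB hc hrr hv hv'))) hlast)
        rw [abs_mul, abs_of_nonneg (sq_nonneg k)]
        gcongr
        exact abs_quadratic_coeff_le hB hb hc hr hv hv'
    _ = B ^ 7 * (7 * k ^ 2 + 2 * dc ^ 2 + 2 * dr ^ 2) := by ring
    _ ≤ B ^ 7 * (10 * k ^ 2 + 10 * dc ^ 2 + 10 * dr ^ 2) := by gcongr <;> norm_num
    _ = 10 * B ^ 7 * (k ^ 2 + dc ^ 2 + dr ^ 2) := by ring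

end Pointwise

section Functional

variable {ε M T c₀ B lam α β : ℝ}

/-- `1 / q(x, 0)`, with `q(x, 0)` replaced by `c₀` where it is smaller, so that the function is
continuous and bounded by `1 / c₀` for every `q`. -/
def qinv (c₀ : ℝ) (q : H5 ε M T) (x : ℝ) : ℝ := (max c₀ (rep q 0 0 x 0))⁻¹

/-- `F(q)` in terms of the extended representatives. -/
def Frep (c₀ : ℝ) (q : H5 ε M T) (x t : ℝ) : ℝ :=
  Fval (rep q 2 0 x t) (rep q 1 1 x t) (rep q 0 1 x t) (rep q 1 0 x 0) (qinv c₀ q x)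

/-- The time derivative of `F(q)` in terms of the extended representatives; the coefficients of `F`
do not depend on time. -/
def FrepDt (c₀ : ℝ) (q : H5 ε M T) (x t : ℝ) : ℝ :=
  Fval (rep q 2 1 x t) (rep q 1 2 x t) (rep q 0 2 x t) (rep q 1 0 x 0) (qinv c₀ q x)

/-- The derivative of `F` at `q` in the direction `h`, in terms of the extended representatives. -/
def Lrep (c₀ : ℝ) (q h : H5 ε M T) (x t : ℝ) : ℝ :=
  Lval (rep q 1 1 x t) (rep q 0 1 x t) (rep q 1 0 x 0) (qinv c₀ q x)
    (rep h 2 0 x t) (rep h 1 1 x t) (rep h 0 1 x t) (rep h 0 0 x 0) (rep h 1 0 x 0)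

/-- The derivative of `J` at `q` in the direction `h`. -/
def dJ (lam α β c₀ : ℝ) (q h : H5 ε M T) : ℝ :=
  2 * (∫ z in rect ε M T, weight lam α z.1 z.2 * (Frep c₀ q z.1 z.2 * Lrep c₀ q h z.1 z.2))
    + 2 * β * inner ℝ q h

/-- The remainder `F(q + h)² - F(q)² - 2 F(q) F'(q)h` of `F²`, written so that its principal part
is a square. -/
def sqRemainder (c₀ : ℝ) (q h : H5 ε M T) (x t : ℝ) : ℝ :=
  (Frep c₀ (q + h) x t - Frep c₀ q x t) ^ 2
    + 2 * Frep c₀ q x t * (Frep c₀ (q + h) x t - Frep c₀ q x t - Lrep c₀ q h x t)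

/-- `q(x, 0) ≥ c₀` on `[ε, M]`. -/
def TraceGE (c₀ : ℝ) (q : H5 ε M T) : Prop := ∀ x ∈ Icc ε M, c₀ ≤ rep q 0 0 x 0

/-- `B ≥ 1` bounds all extended representatives of `q` and the reciprocal of its trace. -/
structure IsBoundedBy (c₀ B : ℝ) (q : H5 ε M T) : Prop where
  one_le : 1 ≤ B
  abs_rep_le : ∀ i j x t, |rep q i j x t| ≤ B
  abs_qinv_le : ∀ x, |qinv c₀ q x| ≤ B

lemma qinv_pos (hc : 0 < c₀) (q : H5 ε M T) (x : ℝ) : 0 < qinv c₀ q x :=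
  inv_pos.2 (lt_max_of_lt_left hc)

lemma qinv_le (hc : 0 < c₀) (q : H5 ε M T) (x : ℝ) : qinv c₀ q x ≤ c₀⁻¹ :=
  inv_anti₀ hc (le_max_left _ _)

lemma qinv_eq {q : H5 ε M T} (hq : TraceGE c₀ q) {x : ℝ} (hx : x ∈ Icc ε M) :
    qinv c₀ q x = (rep q 0 0 x 0)⁻¹ := by rw [qinv, max_eq_right (hq x hx)]

lemma abs_setIntegral_weight_mul_le {f : ℝ → ℝ → ℝ} {C : ℝ}
    (hf : ∀ x ∈ Icc ε M, ∀ t, |f x t| ≤ C) :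
    |∫ z in rect ε M T, weight lam α z.1 z.2 * f z.1 z.2|
      ≤ C * ∫ z in rect ε M T, weight lam α z.1 z.2 := by
  rw [← integral_const_mul, ← Real.norm_eq_abs]
  refine norm_integral_le_of_norm_le (integrableOn_rect_of_continuous (by fun_prop)) ?_
  filter_upwards [ae_restrict_mem measurableSet_rect] with z hz
  have hweight := (weight_pos lam α z.1 z.2).le
  rw [norm_mul, Real.norm_of_nonneg hweight, mul_comm C]
  exact mul_le_mul_of_nonneg_left (hf _ (Ioo_subset_Icc_self hz.1) _) hweight

lemma abs_Frep_le {q : H5 ε M T} (hq : IsBoundedBy c₀ B q) (x t : ℝ) :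
    |Frep c₀ q x t| ≤ 2 * B ^ 5 :=
  abs_Fval_le hq.one_le (hq.abs_rep_le _ _ _ _) (hq.abs_rep_le _ _ _ _) (hq.abs_rep_le _ _ _ _)
    (hq.abs_rep_le _ _ _ _) (hq.abs_qinv_le x)

lemma abs_FrepDt_le {q : H5 ε M T} (hq : IsBoundedBy c₀ B q) (x t : ℝ) :
    |FrepDt c₀ q x t| ≤ 2 * B ^ 5 :=
  abs_Fval_le hq.one_le (hq.abs_rep_le _ _ _ _) (hq.abs_rep_le _ _ _ _) (hq.abs_rep_le _ _ _ _)
    (hq.abs_rep_le _ _ _ _) (hq.abs_qinv_le x)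

lemma abs_Lrep_le {s : ℝ} {q h : H5 ε M T} (hq : IsBoundedBy c₀ B q)
    (hh : ∀ i j x t, |rep h i j x t| ≤ s) (x t : ℝ) : |Lrep c₀ q h x t| ≤ 6 * B ^ 6 * s :=
  abs_Lval_le hq.one_le (hq.abs_rep_le _ _ _ _) (hq.abs_rep_le _ _ _ _) (hq.abs_rep_le _ _ _ _)
    (hq.abs_qinv_le x) (hh _ _ _ _) (hh _ _ _ _) (hh _ _ _ _) (hh _ _ _ _) (hh _ _ _ _)

variable (hε : ε < M) (hT : 0 < T)
include hε hT

lemma exists_isBoundedBy (hc : 0 < c₀) (R : ℝ) :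
    ∃ B, ∀ q : H5 ε M T, ‖q‖ ≤ R → IsBoundedBy c₀ B q := by
  obtain ⟨K, hK0, hK⟩ := exists_abs_rep_le 5 hε hT
  have hinv : 0 < c₀⁻¹ := inv_pos.2 hc
  have hKR : 0 ≤ K * |R| := by positivity
  refine ⟨1 + K * |R| + c₀⁻¹, fun q hq => ⟨by linarith, fun i j x t => ?_, fun x => ?_⟩⟩
  · have hKq : K * ‖q‖ ≤ K * |R| := by gcongr; exact hq.trans (le_abs_self R)
    linarith [hK q i j x t]
  · rw [abs_of_pos (qinv_pos hc q x)]
    linarith [qinv_le hc q x]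

lemma continuous_qinv (hc : 0 < c₀) (q : H5 ε M T) : Continuous (qinv c₀ q) :=
  (continuous_const.max (continuous_slice (continuous_rep hε hT q 0 0) 0)).inv₀
    fun _ => (lt_max_of_lt_left hc).ne'

lemma continuous_Frep (hc : 0 < c₀) (q : H5 ε M T) :
    Continuous fun z : ℝ × ℝ => Frep c₀ q z.1 z.2 := by
  have hrep := continuous_rep hε hT q
  have htrace := continuous_slice (hrep 1 0) 0
  have hqinv := continuous_qinv hε hT hc q
  unfold Frep Fval
  fun_prop

lemma continuous_FrepDt (hc : 0 < c₀) (q : H5 ε M T) :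
    Continuous fun z : ℝ × ℝ => FrepDt c₀ q z.1 z.2 := by
  have hrep := continuous_rep hε hT q
  have htrace := continuous_slice (hrep 1 0) 0
  have hqinv := continuous_qinv hε hT hc q
  unfold FrepDt Fval
  fun_prop

lemma continuous_Lrep (hc : 0 < c₀) (q h : H5 ε M T) :
    Continuous fun z : ℝ × ℝ => Lrep c₀ q h z.1 z.2 := by
  have hrepq := continuous_rep hε hT q
  have hreph := continuous_rep hε hT h
  have htraceq := continuous_slice (hrepq 1 0) 0
  have htrace := continuous_slice (hreph 0 0) 0
  have htracex := continuous_slice (hreph 1 0) 0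
  have hqinv := continuous_qinv hε hT hc q
  unfold Lrep Lval
  fun_prop

lemma continuous_sqRemainder (hc : 0 < c₀) (q h : H5 ε M T) :
    Continuous fun z : ℝ × ℝ => sqRemainder c₀ q h z.1 z.2 := by
  have hFq := continuous_Frep hε hT hc q
  have hFqh := continuous_Frep hε hT hc (q + h)
  have hL := continuous_Lrep hε hT hc q h
  unfold sqRemainder
  fun_prop

lemma hasDerivAt_Frep_t (q : H5 ε M T) {x t : ℝ} (hx : x ∈ Icc ε M) (ht : t ∈ Ioo 0 T) :
    HasDerivAt (fun s => Frep c₀ q x s) (FrepDt c₀ q x t) t := by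
  have hxx := hasDerivAt_rep_t hε hT q (i := 2) (j := 0) (by norm_num) hx ht
  have hxt := hasDerivAt_rep_t hε hT q (i := 1) (j := 1) (by norm_num) hx ht
  have ht := hasDerivAt_rep_t hε hT q (i := 0) (j := 1) (by norm_num) hx ht
  exact (hxx.sub ((hxt.mul_const _).div_const 2)).add (((ht.mul_const _).mul_const _).div_const 2)

lemma F_eq_Frep {q : H5 ε M T} (hq : TraceGE c₀ q) {x t : ℝ} (hx : x ∈ Icc ε M)
    (ht : t ∈ Icc 0 T) : F q x t = Frep c₀ q x t := by
  have h0 : (0 : ℝ) ∈ Icc 0 T := ⟨le_rfl, hT.le⟩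
  rw [F, D_eq_rep hε hT q (by norm_num) hx ht, D_eq_rep hε hT q (by norm_num) hx ht,
    D_eq_rep hε hT q (by norm_num) hx ht, D_eq_rep hε hT q (by norm_num) hx h0,
    D_eq_rep hε hT q (by norm_num) hx h0, Frep, Fval, qinv_eq hq hx]
  simp only [div_eq_mul_inv, mul_inv, inv_pow]
  ring

lemma J_eq {q : H5 ε M T} (hq : TraceGE c₀ q) :
    J lam α β q = bulkEnergy ε M T lam α (Frep c₀ q) + β * ‖q‖ ^ 2 := by
  rw [J, bulkEnergy]
  congr 1
  refine setIntegral_congr_fun measurableSet_rect fun z hz => ?_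
  rw [F_eq_Frep hε hT hq (Ioo_subset_Icc_self hz.1) (Ioo_subset_Icc_self hz.2), sq_abs, weight]

lemma J_add_sub_sub_dJ (hc : 0 < c₀) {q h : H5 ε M T} (hq : TraceGE c₀ q)
    (hqh : TraceGE c₀ (q + h)) :
    J lam α β (q + h) - J lam α β q - dJ lam α β c₀ q h
      = (∫ z in rect ε M T, weight lam α z.1 z.2 * sqRemainder c₀ q h z.1 z.2)
        + β * ‖h‖ ^ 2 := by
  have hFq := continuous_Frep hε hT hc q
  have hFqh := continuous_Frep hε hT hc (q + h)
  have hL := continuous_Lrep hε hT hc q h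
  have hexpand (z : ℝ × ℝ) : weight lam α z.1 z.2 * sqRemainder c₀ q h z.1 z.2
      = weight lam α z.1 z.2 * Frep c₀ (q + h) z.1 z.2 ^ 2
        - weight lam α z.1 z.2 * Frep c₀ q z.1 z.2 ^ 2
        - 2 * (weight lam α z.1 z.2 * (Frep c₀ q z.1 z.2 * Lrep c₀ q h z.1 z.2)) := by
    rw [sqRemainder]
    ring
  rw [J_eq hε hT hq, J_eq hε hT hqh, dJ, norm_add_sq_real, bulkEnergy, bulkEnergy]
  simp only [hexpand]
  rw [integral_sub (integrableOn_rect_of_continuous (by fun_prop))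
      (integrableOn_rect_of_continuous (by fun_prop)),
    integral_sub (integrableOn_rect_of_continuous (by fun_prop))
      (integrableOn_rect_of_continuous (by fun_prop)), integral_const_mul]
  ring

lemma qinv_sub_qinv_add (hc : 0 < c₀) {q h : H5 ε M T} (hq : TraceGE c₀ q)
    (hqh : TraceGE c₀ (q + h)) {x : ℝ} (hx : x ∈ Icc ε M) :
    qinv c₀ q x - qinv c₀ (q + h) x = rep h 0 0 x 0 * qinv c₀ q x * qinv c₀ (q + h) x := by
  have hq0 : rep q 0 0 x 0 ≠ 0 := (hc.trans_le (hq x hx)).ne'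
  have hqh0 : rep (q + h) 0 0 x 0 ≠ 0 := (hc.trans_le (hqh x hx)).ne'
  have hsub : rep h 0 0 x 0 = rep (q + h) 0 0 x 0 - rep q 0 0 x 0 := by
    rw [rep_add hε hT, add_sub_cancel_left]
  rw [qinv_eq hq hx, qinv_eq hqh hx, hsub]
  field_simp

lemma Frep_add (q h : H5 ε M T) (x t : ℝ) : Frep c₀ (q + h) x t =
    Fval (rep q 2 0 x t + rep h 2 0 x t) (rep q 1 1 x t + rep h 1 1 x t)
      (rep q 0 1 x t + rep h 0 1 x t) (rep q 1 0 x 0 + rep h 1 0 x 0) (qinv c₀ (q + h) x) := by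
  simp only [Frep, rep_add hε hT]

section Increment

variable {q h : H5 ε M T} (hc : 0 < c₀) (hq : IsBoundedBy c₀ B q) (hqh : IsBoundedBy c₀ B (q + h))
  (tq : TraceGE c₀ q) (tqh : TraceGE c₀ (q + h)) {x : ℝ} (hx : x ∈ Icc ε M) (t : ℝ)
include hc hq hqh tq tqh hx

lemma abs_Frep_sub_principal_le : |Frep c₀ (q + h) x t - Frep c₀ q x t
      - (rep h 2 0 x t - qinv c₀ (q + h) x ^ 2 / 2 * rep h 1 1 x t)|
    ≤ 3 * B ^ 6 * (|rep h 0 0 x 0| + |rep h 0 1 x t| + |rep h 1 0 x 0|) := by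
  rw [Frep_add hε hT, Frep]
  refine abs_Fval_sub_principal_le hq.one_le (hq.abs_rep_le _ _ _ _) (hq.abs_rep_le _ _ _ _)
    (hq.abs_rep_le _ _ _ _) ?_ (hq.abs_qinv_le x) (hqh.abs_qinv_le x)
    (qinv_sub_qinv_add hε hT hc tq tqh hx)
  rw [← rep_add hε hT]
  exact hqh.abs_rep_le _ _ _ _

lemma abs_Frep_remainder_le : |Frep c₀ (q + h) x t - Frep c₀ q x t - Lrep c₀ q h x t
      - rep h 1 1 x t * rep h 0 0 x 0 * mixedCoeff (qinv c₀ q x) (qinv c₀ (q + h) x)|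
    ≤ 10 * B ^ 7 * (rep h 0 0 x 0 ^ 2 + rep h 0 1 x t ^ 2 + rep h 1 0 x 0 ^ 2) := by
  rw [Frep_add hε hT, Frep, Lrep]
  refine abs_Fval_remainder_le hq.one_le (hq.abs_rep_le _ _ _ _) (hq.abs_rep_le _ _ _ _)
    (hq.abs_rep_le _ _ _ _) ?_ (hq.abs_qinv_le x) (hqh.abs_qinv_le x)
    (qinv_sub_qinv_add hε hT hc tq tqh hx)
  rw [← rep_add hε hT]
  exact hqh.abs_rep_le _ _ _ _

lemma abs_Frep_sub_le {s : ℝ} (hs : ∀ i j x t, |rep h i j x t| ≤ s) :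
    |Frep c₀ (q + h) x t - Frep c₀ q x t| ≤ 11 * B ^ 6 * s := by
  have hB := hq.one_le
  have hs0 : 0 ≤ s := (abs_nonneg _).trans (hs 0 0 0 0)
  have hprincipal : |rep h 2 0 x t - qinv c₀ (q + h) x ^ 2 / 2 * rep h 1 1 x t|
      ≤ 2 * B ^ 6 * s := by
    calc _ ≤ |rep h 2 0 x t| + |qinv c₀ (q + h) x| ^ 2 / 2 * |rep h 1 1 x t| :=
          (abs_sub _ _).trans (le_of_eq (by simp [abs_mul, abs_div]))
      _ ≤ s + B ^ 2 / 2 * s := by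
          gcongr
          exacts [hs _ _ _ _, hqh.abs_qinv_le x, hs _ _ _ _]
      _ ≤ B ^ 6 * s + B ^ 6 * s := by
          gcongr
          · exact le_mul_of_one_le_left hs0 (one_le_pow₀ hB)
          · linarith [pow_le_pow_right₀ hB (show 2 ≤ 6 by norm_num), show 0 ≤ B ^ 2 by positivity]
      _ = 2 * B ^ 6 * s := by ring
  have hlow : 3 * B ^ 6 * (|rep h 0 0 x 0| + |rep h 0 1 x t| + |rep h 1 0 x 0|)
      ≤ 3 * B ^ 6 * (s + s + s) := by
    gcongr
    exacts [hs _ _ _ _, hs _ _ _ _, hs _ _ _ _]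
  linarith [abs_sub_abs_le_abs_sub (Frep c₀ (q + h) x t - Frep c₀ q x t)
    (rep h 2 0 x t - qinv c₀ (q + h) x ^ 2 / 2 * rep h 1 1 x t),
    abs_Frep_sub_principal_le hε hT hc hq hqh tq tqh hx t]

lemma abs_Frep_sub_sub_Lrep_le {s : ℝ} (hs : ∀ i j x t, |rep h i j x t| ≤ s) :
    |Frep c₀ (q + h) x t - Frep c₀ q x t - Lrep c₀ q h x t| ≤ 31 * B ^ 7 * s ^ 2 := by
  have hB := hq.one_le
  have hs0 : 0 ≤ s := (abs_nonneg _).trans (hs 0 0 0 0)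
  have hsq (i j : ℕ) (x t : ℝ) : rep h i j x t ^ 2 ≤ s ^ 2 :=
    sq_le_sq' (abs_le.1 (hs i j x t)).1 (abs_le.1 (hs i j x t)).2
  have hmixed : |rep h 1 1 x t * rep h 0 0 x 0
      * mixedCoeff (qinv c₀ q x) (qinv c₀ (q + h) x)| ≤ B ^ 7 * s ^ 2 := by
    calc _ = |rep h 1 1 x t| * |rep h 0 0 x 0|
          * |mixedCoeff (qinv c₀ q x) (qinv c₀ (q + h) x)| := by rw [abs_mul, abs_mul]
      _ ≤ s * s * B ^ 3 := by
          gcongr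
          exacts [hs _ _ _ _, hs _ _ _ _, abs_mixedCoeff_le (hq.abs_qinv_le x) (hqh.abs_qinv_le x)]
      _ = B ^ 3 * s ^ 2 := by ring
      _ ≤ B ^ 7 * s ^ 2 := by gcongr; norm_num
  have hrest : 10 * B ^ 7 * (rep h 0 0 x 0 ^ 2 + rep h 0 1 x t ^ 2 + rep h 1 0 x 0 ^ 2)
      ≤ 10 * B ^ 7 * (s ^ 2 + s ^ 2 + s ^ 2) := by
    gcongr ?_ * (?_ + ?_ + ?_)
    exacts [hsq _ _ _ _, hsq _ _ _ _, hsq _ _ _ _]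
  linarith [abs_sub_abs_le_abs_sub (Frep c₀ (q + h) x t - Frep c₀ q x t - Lrep c₀ q h x t)
    (rep h 1 1 x t * rep h 0 0 x 0 * mixedCoeff (qinv c₀ q x) (qinv c₀ (q + h) x)),
    abs_Frep_remainder_le hε hT hc hq hqh tq tqh hx t]

lemma abs_sqRemainder_le {s : ℝ} (hs : ∀ i j x t, |rep h i j x t| ≤ s) :
    |sqRemainder c₀ q h x t| ≤ 245 * B ^ 12 * s ^ 2 := by
  have hB := hq.one_le
  calc |sqRemainder c₀ q h x t|
      ≤ |Frep c₀ (q + h) x t - Frep c₀ q x t| ^ 2 + 2 * |Frep c₀ q x t|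
        * |Frep c₀ (q + h) x t - Frep c₀ q x t - Lrep c₀ q h x t| :=
        (abs_add_le _ _).trans (le_of_eq (by simp [abs_mul]))
    _ ≤ (11 * B ^ 6 * s) ^ 2 + 2 * (2 * B ^ 5) * (31 * B ^ 7 * s ^ 2) := by
        gcongr
        exacts [abs_Frep_sub_le hε hT hc hq hqh tq tqh hx t hs, abs_Frep_le hq x t,
          abs_Frep_sub_sub_Lrep_le hε hT hc hq hqh tq tqh hx t hs]
    _ = 245 * B ^ 12 * s ^ 2 := by ring

end Increment

lemma exists_taylor_le (hc : 0 < c₀) (R lam α β : ℝ) : ∃ C > 0, ∀ q h : H5 ε M T, ‖q‖ ≤ R →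
    ‖q + h‖ ≤ R → TraceGE c₀ q → TraceGE c₀ (q + h) →
      |J lam α β (q + h) - J lam α β q - dJ lam α β c₀ q h| ≤ C * ‖h‖ ^ 2 := by
  obtain ⟨K, hK0, hK⟩ := exists_abs_rep_le 5 hε hT
  obtain ⟨B, hB⟩ := exists_isBoundedBy hε hT hc R
  set w := ∫ z in rect ε M T, weight lam α z.1 z.2
  have hw : 0 ≤ w := integral_nonneg fun z => (weight_pos _ _ _ _).le
  refine ⟨245 * B ^ 12 * K ^ 2 * w + |β| + 1, by positivity, fun q h hq hqh tq tqh => ?_⟩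
  rw [J_add_sub_sub_dJ hε hT hc tq tqh]
  calc _ ≤ 245 * B ^ 12 * (K * ‖h‖) ^ 2 * w + |β| * ‖h‖ ^ 2 := by
        refine (abs_add_le _ _).trans (add_le_add ?_ (by simp [abs_mul]))
        exact abs_setIntegral_weight_mul_le fun x hx t =>
          abs_sqRemainder_le hε hT hc (hB q hq) (hB _ hqh) tq tqh hx t (hK h)
    _ ≤ (245 * B ^ 12 * K ^ 2 * w + |β| + 1) * ‖h‖ ^ 2 := by
        linarith [sq_nonneg ‖h‖]

end Functional

section MixedTerm

variable {ε M T lam α : ℝ}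

lemma two_mul_bulkEnergy_trace_le (hε : ε ≤ M) (hT : 0 ≤ T) {k : ℝ → ℝ} (hk : Continuous k) :
    2 * lam * α * bulkEnergy ε M T lam α (fun x _ => k x) ≤ lineEnergy ε M lam k := by
  have hftc := setIntegral_rect_deriv_t hε hT (G := fun z => weight lam α z.1 z.2 * k z.1 ^ 2)
    (g := fun z => -2 * lam * α * weight lam α z.1 z.2 * k z.1 ^ 2) (by fun_prop) (by fun_prop)
    (fun x _ t _ => (hasDerivAt_weight_t x t).mul_const (k x ^ 2))
  have hbulk : ∫ z in rect ε M T, -2 * lam * α * weight lam α z.1 z.2 * k z.1 ^ 2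
      = -(2 * lam * α * bulkEnergy ε M T lam α fun x _ => k x) := by
    rw [bulkEnergy, ← integral_const_mul, ← integral_neg]
    congr! 2
    ring
  rw [neg_eq_iff_eq_neg.1 (hbulk.symm.trans hftc), ← intervalIntegral.integral_neg]
  refine intervalIntegral.integral_mono_on hε (Continuous.intervalIntegrable (by fun_prop) _ _)
    (Continuous.intervalIntegrable (by fun_prop) _ _) fun x _ => ?_
  simp only [weight_zero_right]
  linarith [mul_nonneg (weight_pos lam α x T).le (sq_nonneg (k x))]

lemma abs_mul_mul_le {a b c C : ℝ} (h : |a| ≤ C) :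
    |a * (b * c)| ≤ C / 2 * (b ^ 2 + c ^ 2) := by
  have hC : 0 ≤ C := (abs_nonneg a).trans h
  calc |a * (b * c)| = |a| * (|b| * |c|) := by rw [abs_mul, abs_mul]
    _ ≤ C * ((b ^ 2 + c ^ 2) / 2) := by gcongr; exact abs_mul_abs_le b c
    _ = C / 2 * (b ^ 2 + c ^ 2) := by ring

lemma abs_setIntegral_weight_mul_mul_le {g p k : ℝ → ℝ → ℝ} {C : ℝ}
    (hp : Continuous fun z : ℝ × ℝ => p z.1 z.2) (hk : Continuous fun z : ℝ × ℝ => k z.1 z.2)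
    (hg : ∀ x ∈ Icc ε M, ∀ t, |g x t| ≤ C) :
    |∫ z in rect ε M T, weight lam α z.1 z.2 * (g z.1 z.2 * (p z.1 z.2 * k z.1 z.2))|
      ≤ C / 2 * (bulkEnergy ε M T lam α p + bulkEnergy ε M T lam α k) := by
  rw [bulkEnergy, bulkEnergy, ← integral_add (integrableOn_rect_of_continuous (by fun_prop))
    (integrableOn_rect_of_continuous (by fun_prop)), ← integral_const_mul, ← Real.norm_eq_abs]
  refine norm_integral_le_of_norm_le (integrableOn_rect_of_continuous (by fun_prop)) ?_
  filter_upwards [ae_restrict_mem measurableSet_rect] with z hz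
  have hweight := (weight_pos lam α z.1 z.2).le
  rw [norm_mul, Real.norm_of_nonneg hweight, Real.norm_eq_abs]
  linarith [mul_le_mul_of_nonneg_left (abs_mul_mul_le (b := p z.1 z.2) (c := k z.1 z.2)
    (hg z.1 (Ioo_subset_Icc_self hz.1) z.2)) hweight]

lemma abs_intervalIntegral_exp_mul_mul_le (hε : ε ≤ M) {g p k : ℝ → ℝ} {C : ℝ}
    (hp : Continuous p) (hk : Continuous k) (hg : ∀ x ∈ Icc ε M, |g x| ≤ C) :
    |∫ x in ε..M, Real.exp (-2 * lam * x) * (g x * (p x * k x))|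
      ≤ C / 2 * (lineEnergy ε M lam p + lineEnergy ε M lam k) := by
  rw [lineEnergy, lineEnergy,
    ← intervalIntegral.integral_add (Continuous.intervalIntegrable (by fun_prop) _ _)
      (Continuous.intervalIntegrable (by fun_prop) _ _),
    ← intervalIntegral.integral_const_mul, ← Real.norm_eq_abs]
  refine intervalIntegral.norm_integral_le_of_norm_le hε ?_
    (Continuous.intervalIntegrable (by fun_prop) _ _)
  refine .of_forall fun x hx => ?_
  have hexp := (Real.exp_pos (-2 * lam * x)).le
  rw [norm_mul, Real.norm_of_nonneg hexp, Real.norm_eq_abs]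
  linarith [mul_le_mul_of_nonneg_left
    (abs_mul_mul_le (b := p x) (c := k x) (hg x (Ioc_subset_Icc_self hx))) hexp]

section IntegrationByParts

variable {f f' p p' : ℝ → ℝ → ℝ} {k : ℝ → ℝ} (hε : ε ≤ M) (hT : 0 ≤ T)
  (cf : Continuous fun z : ℝ × ℝ => f z.1 z.2) (cf' : Continuous fun z : ℝ × ℝ => f' z.1 z.2)
  (cp : Continuous fun z : ℝ × ℝ => p z.1 z.2) (cp' : Continuous fun z : ℝ × ℝ => p' z.1 z.2)
  (ck : Continuous k)
  (hf : ∀ x ∈ Icc ε M, ∀ t ∈ Ioo 0 T, HasDerivAt (fun s => f x s) (f' x t) t)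
  (hp : ∀ x ∈ Icc ε M, ∀ t ∈ Ioo 0 T, HasDerivAt (fun s => p x s) (p' x t) t)
include hε hT cf cf' cp cp' ck hf hp

lemma setIntegral_weight_mul_dt_eq :
    ∫ z in rect ε M T, weight lam α z.1 z.2 * (f z.1 z.2 * (p' z.1 z.2 * k z.1))
      = Real.exp (-2 * lam * α * T)
          * (∫ x in ε..M, Real.exp (-2 * lam * x) * (f x T * (p x T * k x)))
        - (∫ x in ε..M, Real.exp (-2 * lam * x) * (f x 0 * (p x 0 * k x)))
        + ∫ z in rect ε M T, weight lam α z.1 z.2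
          * ((2 * lam * α * f z.1 z.2 - f' z.1 z.2) * (p z.1 z.2 * k z.1)) := by
  have hslice (t : ℝ) : Continuous fun x => Real.exp (-2 * lam * x) * (f x t * (p x t * k x)) := by
    have := continuous_slice cf t
    have := continuous_slice cp t
    fun_prop
  have hftc := setIntegral_rect_deriv_t hε hT
    (G := fun z => weight lam α z.1 z.2 * (f z.1 z.2 * p z.1 z.2) * k z.1)
    (g := fun z => (-2 * lam * α * weight lam α z.1 z.2 * (f z.1 z.2 * p z.1 z.2)
      + weight lam α z.1 z.2 * (f' z.1 z.2 * p z.1 z.2 + f z.1 z.2 * p' z.1 z.2)) * k z.1)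
    (by fun_prop) (by fun_prop) (fun x hx t ht =>
      ((hasDerivAt_weight_t x t).mul ((hf x hx t ht).mul (hp x hx t ht))).mul_const (k x))
  rw [← intervalIntegral.integral_const_mul, ← intervalIntegral.integral_sub
    ((hslice T).const_mul _ |>.intervalIntegrable _ _) ((hslice 0).intervalIntegrable _ _),
    eq_comm, ← eq_sub_iff_add_eq, ← integral_sub (integrableOn_rect_of_continuous (by fun_prop))
    (integrableOn_rect_of_continuous (by fun_prop))]
  refine Eq.trans ?_ (hftc.symm.trans ?_)
  · simp only [weight_zero_right, weight_eq _ T]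
    congr! 2 with x
    ring
  · congr! 2 with z
    ring

lemma abs_setIntegral_weight_mul_dt_le {A : ℝ} (hlamα : 0 ≤ lam * α)
    (bf : ∀ x ∈ Icc ε M, ∀ t, |f x t| ≤ A) (bf' : ∀ x ∈ Icc ε M, ∀ t, |f' x t| ≤ A) :
    |∫ z in rect ε M T, weight lam α z.1 z.2 * (f z.1 z.2 * (p' z.1 z.2 * k z.1))|
      ≤ A / 2 * (Real.exp (-2 * lam * α * T)
            * (lineEnergy ε M lam (fun x => p x T) + lineEnergy ε M lam k)
          + (lineEnergy ε M lam (fun x => p x 0) + lineEnergy ε M lam k)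
          + (2 * lam * α + 1)
            * (bulkEnergy ε M T lam α p + bulkEnergy ε M T lam α fun x _ => k x)) := by
  have hslice (t : ℝ) := abs_intervalIntegral_exp_mul_mul_le (lam := lam) hε (continuous_slice cp t)
    ck fun x hx => bf x hx t
  have hcoeff (x : ℝ) (hx : x ∈ Icc ε M) (t : ℝ) :
      |2 * lam * α * f x t - f' x t| ≤ (2 * lam * α + 1) * A := by
    calc _ ≤ 2 * (lam * α) * |f x t| + |f' x t| := by
          refine (abs_sub _ _).trans (le_of_eq ?_)
          rw [abs_mul, mul_assoc 2, abs_of_nonneg (by positivity : 0 ≤ 2 * (lam * α))]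
      _ ≤ 2 * (lam * α) * A + A := by
          gcongr
          exacts [bf x hx t, bf' x hx t]
      _ = (2 * lam * α + 1) * A := by ring
  have hbulk := abs_setIntegral_weight_mul_mul_le (T := T) (lam := lam) (α := α) cp
    (k := fun x _ => k x) (by fun_prop) hcoeff
  have hfinal := mul_le_mul_of_nonneg_left (hslice T) (Real.exp_pos (-2 * lam * α * T)).le
  rw [setIntegral_weight_mul_dt_eq hε hT cf cf' cp cp' ck hf hp]
  refine (abs_add_le _ _).trans ((add_le_add (abs_sub _ _) hbulk).trans ?_)
  rw [abs_mul, abs_of_pos (Real.exp_pos _)]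
  linarith [hslice 0]

end IntegrationByParts

end MixedTerm

section KeyInequality

variable {ε M T c₀ B lam α β : ℝ}

lemma mul_exp_neg_le_one {b C : ℝ} (hb : 0 < b) (hlam : 0 < lam)
    (h : 2 * C / b ^ 2 ≤ lam) : C * lam * Real.exp (-(b * lam)) ≤ 1 := by
  have hblam : 0 < b * lam := mul_pos hb hlam
  rw [Real.exp_neg, ← div_eq_mul_inv, div_le_one (Real.exp_pos _)]
  rw [div_le_iff₀ (by positivity)] at h
  calc C * lam = 2 * C * lam / 2 := by ring
    _ ≤ lam * b ^ 2 * lam / 2 := by gcongr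
    _ ≤ 1 + b * lam + (b * lam) ^ 2 / 2 := by linarith
    _ ≤ Real.exp (b * lam) := Real.quadratic_le_exp_of_nonneg hblam.le

@[fun_prop]
lemma continuous_mixedCoeff {X : Type*} [TopologicalSpace X] {f g : X → ℝ} (hf : Continuous f)
    (hg : Continuous g) : Continuous fun z => mixedCoeff (f z) (g z) := by
  unfold mixedCoeff
  fun_prop

lemma inv_le_qinv (hc : 0 < c₀) {q : H5 ε M T} (hq : IsBoundedBy c₀ B q) (tq : TraceGE c₀ q)
    {x : ℝ} (hx : x ∈ Icc ε M) : B⁻¹ ≤ qinv c₀ q x := by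
  rw [qinv_eq tq hx]
  exact inv_anti₀ (hc.trans_le (tq x hx)) ((le_abs_self _).trans (hq.abs_rep_le 0 0 x 0))

variable (hε : ε < M) (hT : 0 < T)
include hε hT

lemma rep_dt_eq_zero {h : H5 ε M T} (h0 : ∀ t ∈ Icc 0 T, rep h 0 0 ε t = 0) :
    ∀ t ∈ Icc 0 T, rep h 0 1 ε t = 0 := by
  have hopen : EqOn (fun t => rep h 0 1 ε t) (fun _ => 0) (Ioo 0 T) := fun t ht => by
    have hrep := hasDerivAt_rep_t hε hT h (i := 0) (j := 0) (by norm_num) ⟨le_rfl, hε.le⟩ ht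
    refine hrep.unique ((hasDerivAt_const t (0 : ℝ)).congr_of_eventuallyEq ?_)
    filter_upwards [Ioo_mem_nhds ht.1 ht.2] with s hs using h0 s (Ioo_subset_Icc_self hs)
  have hcont : Continuous fun t => rep h 0 1 ε t :=
    (continuous_rep hε hT h 0 1).comp (by fun_prop : Continuous fun t : ℝ => (ε, t))
  have hclosure := hopen.closure hcont continuous_const
  rwa [closure_Ioo hT.ne] at hclosure

lemma hasDerivAt_qinv_sq {q : H5 ε M T} (hc : 0 < c₀) (hq : TraceGE c₀ q) {x : ℝ}
    (hx : x ∈ Ioo ε M) : HasDerivAt (fun x => qinv c₀ q x ^ 2 / 2)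
      (-(qinv c₀ q x ^ 3 * rep q 1 0 x 0)) x := by
  have hrep := hasDerivAt_rep_x hε hT q (i := 0) (j := 0) (by norm_num) hx ⟨le_rfl, hT.le⟩
  have hne : rep q 0 0 x 0 ≠ 0 := (hc.trans_le (hq x (Ioo_subset_Icc_self hx))).ne'
  have hinv : HasDerivAt (fun x => (rep q 0 0 x 0)⁻¹ ^ 2 / 2)
      (-(qinv c₀ q x ^ 3 * rep q 1 0 x 0)) x := by
    refine ((hasDerivAt_sq (hrep.inv hne)).div_const 2).congr_deriv ?_
    rw [qinv_eq hq (Ioo_subset_Icc_self hx), Pi.inv_apply]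
    field_simp
  refine hinv.congr_of_eventuallyEq ?_
  filter_upwards [Ioo_mem_nhds hx.1 hx.2] with s hs
  rw [qinv_eq hq (Ioo_subset_Icc_self hs)]

section Estimates

variable {q h : H5 ε M T} (hc : 0 < c₀)
include hc

lemma carleman_estimate_rep (hα : 0 ≤ α) (hαc : α * (c₀⁻¹ ^ 2 / 2) < 1)
    (hq : IsBoundedBy c₀ B q) (tq : TraceGE c₀ q) (hlam : 8 * B ^ 6 ≤ lam)
    (h0 : ∀ t ∈ Icc 0 T, rep h 0 0 ε t = 0) (hx0 : ∀ t ∈ Icc 0 T, rep h 1 0 ε t = 0) :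
    lam ^ 2 * (bulkEnergy ε M T lam α (rep h 1 0) + bulkEnergy ε M T lam α (rep h 0 1)
          + bulkEnergy ε M T lam α (rep h 0 0))
        + lam * (lineEnergy ε M lam (fun x => rep h 1 0 x 0)
          + lineEnergy ε M lam fun x => rep h 0 0 x 0)
      ≤ carlemanConst (1 - α * (c₀⁻¹ ^ 2 / 2)) (B⁻¹ ^ 2 / 2) (c₀⁻¹ ^ 2 / 2)
        * (bulkEnergy ε M T lam α
            (fun x t => rep h 2 0 x t - qinv c₀ q x ^ 2 / 2 * rep h 1 1 x t)
          + lam * Real.exp (-2 * lam * α * T) * lineEnergy ε M lam fun x => rep h 1 0 x T) := by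
  have hB : 1 ≤ B := hq.one_le
  have hcont := continuous_rep hε hT h
  have hqinv := continuous_qinv hε hT hc q
  have htrace := continuous_slice (continuous_rep hε hT q 1 0) 0
  have hle (x : ℝ) : qinv c₀ q x ^ 2 / 2 ≤ c₀⁻¹ ^ 2 / 2 := by
    have := (qinv_pos hc q x).le
    gcongr
    exact qinv_le hc q x
  refine carleman_estimate hε.le hT.le (by linarith [one_le_pow₀ hB (n := 6)]) (by linarith)
    (by positivity) (a' := fun x => -(qinv c₀ q x ^ 3 * rep q 1 0 x 0)) (by fun_prop)
    (by fun_prop) (fun x hx => hasDerivAt_qinv_sq hε hT hc tq hx) (fun x hx => ?_)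
    (fun x _ => hle x) (fun x _ => ?_) (fun x _ => ?_) (hcont 0 0) (hcont 1 0) (hcont 0 1)
    (hcont 2 0) (hcont 1 1) (fun x hx t ht => hasDerivAt_rep_x hε hT h (by norm_num) hx ht)
    (fun x hx t ht => hasDerivAt_rep_x hε hT h (by norm_num) hx ht)
    (fun x hx t ht => hasDerivAt_rep_t hε hT h (by norm_num) hx ht)
    (fun x hx t ht => hasDerivAt_rep_x hε hT h (by norm_num) hx ht) h0 hx0
    (rep_dt_eq_zero hε hT h0)
  · gcongr
    exact inv_le_qinv hc hq tq hx
  · calc 4 * |-(qinv c₀ q x ^ 3 * rep q 1 0 x 0)| ≤ 4 * (B ^ 3 * B) := by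
          rw [abs_neg, abs_mul, abs_pow]
          gcongr
          exacts [hq.abs_qinv_le x, hq.abs_rep_le _ _ _ _]
      _ = 8 * B ^ 6 * (B⁻¹ ^ 2 / 2) := by field_simp; norm_num
      _ ≤ lam * (B⁻¹ ^ 2 / 2) := by gcongr
  · linarith [mul_le_mul_of_nonneg_left (hle x) hα]

variable (hq : IsBoundedBy c₀ B q) (hqh : IsBoundedBy c₀ B (q + h))
include hq hqh

lemma abs_setIntegral_mixedTerm_le (hlamα : 0 ≤ lam * α) :
    |∫ z in rect ε M T, weight lam α z.1 z.2
        * (Frep c₀ q z.1 z.2 * mixedCoeff (qinv c₀ q z.1) (qinv c₀ (q + h) z.1)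
          * (rep h 1 1 z.1 z.2 * rep h 0 0 z.1 0))|
      ≤ 67 * B ^ 12 / 2 * (Real.exp (-2 * lam * α * T)
            * (lineEnergy ε M lam (fun x => rep h 1 0 x T)
              + lineEnergy ε M lam fun x => rep h 0 0 x 0)
          + (lineEnergy ε M lam (fun x => rep h 1 0 x 0)
              + lineEnergy ε M lam fun x => rep h 0 0 x 0)
          + (2 * lam * α + 1) * (bulkEnergy ε M T lam α (rep h 1 0)
              + bulkEnergy ε M T lam α fun x _ => rep h 0 0 x 0)) := by
  have hB : 1 ≤ B := hq.one_le
  have hF := continuous_Frep hε hT hc q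
  have hFt := continuous_FrepDt hε hT hc q
  have hqinv := continuous_qinv hε hT hc q
  have hqhinv := continuous_qinv hε hT hc (q + h)
  have hbound {a : ℝ} (ha : |a| ≤ 2 * B ^ 5) (x : ℝ) :
      |a * mixedCoeff (qinv c₀ q x) (qinv c₀ (q + h) x)| ≤ 67 * B ^ 12 := by
    calc _ ≤ 2 * B ^ 5 * B ^ 3 := by
          rw [abs_mul]
          gcongr
          exact abs_mixedCoeff_le (hq.abs_qinv_le x) (hqh.abs_qinv_le x)
      _ = 2 * B ^ 8 := by ring
      _ ≤ 67 * B ^ 12 := by gcongr <;> norm_num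
  exact abs_setIntegral_weight_mul_dt_le hε.le hT.le
    (f := fun x t => Frep c₀ q x t * mixedCoeff (qinv c₀ q x) (qinv c₀ (q + h) x))
    (f' := fun x t => FrepDt c₀ q x t * mixedCoeff (qinv c₀ q x) (qinv c₀ (q + h) x))
    (by fun_prop) (by fun_prop) (continuous_rep hε hT h 1 0) (continuous_rep hε hT h 1 1)
    (continuous_slice (continuous_rep hε hT h 0 0) 0)
    (fun x hx t ht => (hasDerivAt_Frep_t hε hT q hx ht).mul_const _)
    (fun x hx t ht => hasDerivAt_rep_t hε hT h (by norm_num) hx ht) hlamα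
    (fun x _ t => hbound (abs_Frep_le hq x t) x) fun x _ t => hbound (abs_FrepDt_le hq x t) x

variable (tq : TraceGE c₀ q) (tqh : TraceGE c₀ (q + h))
include tq tqh

lemma le_sqRemainder {x : ℝ} (hx : x ∈ Icc ε M) (t : ℝ) :
    (rep h 2 0 x t - qinv c₀ (q + h) x ^ 2 / 2 * rep h 1 1 x t) ^ 2 / 2
        + 2 * (Frep c₀ q x t * mixedCoeff (qinv c₀ q x) (qinv c₀ (q + h) x)
          * (rep h 1 1 x t * rep h 0 0 x 0))
        - 67 * B ^ 12 * (rep h 0 0 x 0 ^ 2 + rep h 0 1 x t ^ 2 + rep h 1 0 x 0 ^ 2)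
      ≤ sqRemainder c₀ q h x t := by
  set δF := Frep c₀ (q + h) x t - Frep c₀ q x t with hδF
  set X := rep h 2 0 x t - qinv c₀ (q + h) x ^ 2 / 2 * rep h 1 1 x t
  set k := rep h 0 0 x 0
  set y := rep h 0 1 x t
  set r := rep h 1 0 x 0
  set m := rep h 1 1 x t * k * mixedCoeff (qinv c₀ q x) (qinv c₀ (q + h) x)
  have hB : 1 ≤ B := hq.one_le
  have hlow : (δF - X) ^ 2 ≤ 27 * B ^ 12 * (k ^ 2 + y ^ 2 + r ^ 2) := by
    calc (δF - X) ^ 2 ≤ (3 * B ^ 6 * (|k| + |y| + |r|)) ^ 2 :=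
          sq_le_sq.2 ((abs_Frep_sub_principal_le hε hT hc hq hqh tq tqh hx t).trans
            (le_abs_self _))
      _ = 9 * B ^ 12 * (|k| + |y| + |r|) ^ 2 := by ring
      _ ≤ 9 * B ^ 12 * (3 * (|k| ^ 2 + |y| ^ 2 + |r| ^ 2)) := by
          gcongr
          linarith [sq_nonneg (|k| - |y|), sq_nonneg (|y| - |r|), sq_nonneg (|k| - |r|)]
      _ = 27 * B ^ 12 * (k ^ 2 + y ^ 2 + r ^ 2) := by
          simp only [sq_abs]
          ring
  have hquad : |Frep c₀ q x t * (δF - Lrep c₀ q h x t - m)|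
      ≤ 20 * B ^ 12 * (k ^ 2 + y ^ 2 + r ^ 2) := by
    calc _ ≤ 2 * B ^ 5 * (10 * B ^ 7 * (k ^ 2 + y ^ 2 + r ^ 2)) := by
          rw [abs_mul]
          exact mul_le_mul (abs_Frep_le hq x t)
            (abs_Frep_remainder_le hε hT hc hq hqh tq tqh hx t) (abs_nonneg _) (by positivity)
      _ = 20 * B ^ 12 * (k ^ 2 + y ^ 2 + r ^ 2) := by ring
  have hsquare : X ^ 2 / 2 - (δF - X) ^ 2 ≤ δF ^ 2 := by linarith [sq_nonneg (2 * δF - X)]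
  rw [sqRemainder, ← hδF]
  linarith [(abs_le.1 hquad).1]

lemma le_setIntegral_sqRemainder :
    bulkEnergy ε M T lam α
          (fun x t => rep h 2 0 x t - qinv c₀ (q + h) x ^ 2 / 2 * rep h 1 1 x t) / 2
        + 2 * (∫ z in rect ε M T, weight lam α z.1 z.2
          * (Frep c₀ q z.1 z.2 * mixedCoeff (qinv c₀ q z.1) (qinv c₀ (q + h) z.1)
            * (rep h 1 1 z.1 z.2 * rep h 0 0 z.1 0)))
        - 67 * B ^ 12 * (bulkEnergy ε M T lam α (fun x _ => rep h 0 0 x 0)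
          + bulkEnergy ε M T lam α (rep h 0 1) + bulkEnergy ε M T lam α fun x _ => rep h 1 0 x 0)
      ≤ ∫ z in rect ε M T, weight lam α z.1 z.2 * sqRemainder c₀ q h z.1 z.2 := by
  have hF := continuous_Frep hε hT hc q
  have hqinv := continuous_qinv hε hT hc q
  have hqhinv := continuous_qinv hε hT hc (q + h)
  have hrep := continuous_rep hε hT h
  have htrace := continuous_slice (hrep 0 0) 0
  have htracex := continuous_slice (hrep 1 0) 0
  have hrem := continuous_sqRemainder hε hT hc q h
  have hint : ∀ {f : ℝ × ℝ → ℝ}, Continuous f → IntegrableOn f (rect ε M T) :=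
    integrableOn_rect_of_continuous
  simp only [bulkEnergy]
  rw [← integral_add (hint (by fun_prop)) (hint (by fun_prop)),
    ← integral_add (hint (by fun_prop)) (hint (by fun_prop)),
    ← integral_const_mul, ← integral_const_mul, ← integral_div,
    ← integral_add (hint (by fun_prop)) (hint (by fun_prop)),
    ← integral_sub (hint (by fun_prop)) (hint (by fun_prop))]
  refine setIntegral_rect_mono (by fun_prop) (by fun_prop) fun z hz => ?_
  linarith [mul_le_mul_of_nonneg_left
    (le_sqRemainder hε hT hc hq hqh tq tqh (Ioo_subset_Icc_self hz.1) z.2)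
    (weight_pos lam α z.1 z.2).le]

end Estimates

end KeyInequality

section Absorption

variable {A C κ lam α β P Y U P₀ U₀ P_T I_U I_P X Im n E : ℝ}

lemma le_half_of_carleman (hC : 0 < C) (hA : 2 * C * A ≤ lam) (hS : 0 ≤ lam * P + U)
    (hcar : lam ^ 2 * P + lam * U ≤ C * X) : A * (lam * P + U) ≤ X / 2 := by
  refine le_of_mul_le_mul_left ?_ (mul_pos two_pos hC)
  calc 2 * C * (A * (lam * P + U)) = 2 * C * A * (lam * P + U) := by ring
    _ ≤ lam * (lam * P + U) := by gcongr
    _ ≤ 2 * C * (X / 2) := by linarith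

lemma le_inv_mul_of_two_mul_le (hα : 0 < α) (hlam : 1 ≤ lam) (hU : 0 ≤ U)
    (h : 2 * lam * α * U ≤ P) : 2 * U ≤ α⁻¹ * P := by
  rw [inv_mul_eq_div, le_div_iff₀ hα]
  calc 2 * U * α = 1 * (2 * α * U) := by ring
    _ ≤ lam * (2 * α * U) := by gcongr
    _ ≤ P := by linarith

lemma lowerOrder_le (hα : 0 < α) (hlam : 1 ≤ lam) (hE : 0 ≤ E) (hE1 : E ≤ 1) (hP : 0 ≤ P)
    (hY : 0 ≤ Y) (hU : 0 ≤ U) (hP₀ : 0 ≤ P₀) (hU₀ : 0 ≤ U₀) (hP_T : 0 ≤ P_T) (hI_U : 0 ≤ I_U)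
    (hI_P : 0 ≤ I_P) (htrace : 2 * lam * α * I_U ≤ U₀) (htracex : 2 * lam * α * I_P ≤ P₀) :
    E * (P_T + U₀) + (P₀ + U₀) + (2 * lam * α + 1) * (P + I_U) + (I_U + Y + I_P)
      ≤ (3 + 2 * α + α⁻¹) * (lam * (P + Y + U) + (P₀ + U₀)) + lam * E * P_T := by
  have hI_U' := le_inv_mul_of_two_mul_le hα hlam hI_U htrace
  have hI_P' := le_inv_mul_of_two_mul_le hα hlam hI_P htracex
  have hEP : 1 * (E * P_T) ≤ lam * (E * P_T) := by gcongr
  have hEU : E * U₀ ≤ 1 * U₀ := by gcongr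
  have hlamP : 1 * P ≤ lam * P := by gcongr
  have hlamY : 1 * Y ≤ lam * Y := by gcongr
  have hrest : 0 ≤ 2 * (lam * (P + Y) + P₀) + 3 * lam * U + 2 * α * (lam * (Y + U) + P₀ + U₀)
      + α⁻¹ * (lam * (P + Y + U)) := by positivity
  linarith

lemma coercive_of_absorption (hα : 0 < α) (hlam : 1 ≤ lam) (hA : 0 ≤ A) (hC : 0 < C)
    (hlamA : 2 * C * (A * (3 + 2 * α + α⁻¹) + 1) ≤ lam) (hE : 0 ≤ E) (hE1 : E ≤ 1) (hP : 0 ≤ P)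
    (hY : 0 ≤ Y) (hU : 0 ≤ U) (hP₀ : 0 ≤ P₀) (hU₀ : 0 ≤ U₀) (hP_T : 0 ≤ P_T) (hI_U : 0 ≤ I_U)
    (hI_P : 0 ≤ I_P) (hn : 0 ≤ n) (htrace : 2 * lam * α * I_U ≤ U₀)
    (htracex : 2 * lam * α * I_P ≤ P₀)
    (hIm : |Im| ≤ A / 2 * (E * (P_T + U₀) + (P₀ + U₀) + (2 * lam * α + 1) * (P + I_U)))
    (hcar : lam ^ 2 * (P + Y + U) + lam * (P₀ + U₀) ≤ C * (X + lam * E * P_T))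
    (hκ : P_T ≤ κ * n) (hβ : (1 + 2 * A) * κ * lam * E ≤ β) :
    P + Y + U + (P₀ + U₀) + β / 2 * n
      ≤ X / 2 + 2 * Im - A * (I_U + Y + I_P) + β * n := by
  have hprincipal := le_half_of_carleman hC hlamA (by positivity) hcar
  have hlower := mul_le_mul_of_nonneg_left (lowerOrder_le hα hlam hE hE1 hP hY hU hP₀ hU₀ hP_T
    hI_U hI_P htrace htracex) hA
  have hS : 1 * (P + Y + U) ≤ lam * (P + Y + U) := by gcongr
  have hfinal : (1 + 2 * A) * (lam * E * P_T) ≤ β * n := by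
    calc _ ≤ (1 + 2 * A) * (lam * E * (κ * n)) := by gcongr
      _ = (1 + 2 * A) * κ * lam * E * n := by ring
      _ ≤ β * n := by gcongr
  linarith [(abs_le.1 hIm).1]

end Absorption

section Convexity

variable {ε M T c₀ α : ℝ}

lemma mul_exp_le_of_two_mul_exp_le {b C lam β : ℝ} (hb : 0 < b) (hlam : 0 < lam)
    (h : C / b ^ 2 ≤ lam) (hβ : 2 * Real.exp (-(b * lam)) ≤ β) :
    C * lam * Real.exp (-(2 * (b * lam))) ≤ β := by
  have hle := mul_exp_neg_le_one (C := C / 2) hb hlam (by rwa [mul_div_cancel₀ _ two_ne_zero])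
  calc C * lam * Real.exp (-(2 * (b * lam)))
      = 2 * (C / 2 * lam * Real.exp (-(b * lam))) * Real.exp (-(b * lam)) := by
        rw [show -(2 * (b * lam)) = -(b * lam) + -(b * lam) by ring, Real.exp_add]
        ring
    _ ≤ 2 * 1 * Real.exp (-(b * lam)) := by gcongr
    _ ≤ β := by linarith

lemma exists_coercive_taylor_remainder (h0 : 0 ≤ ε) (hε : ε < M) (hT : 0 < T) (hα : 0 < α)
    (hc : 0 < c₀) (hαc : α * (c₀⁻¹ ^ 2 / 2) < 1) (R : ℝ) :
    ∃ lam₁, ∀ lam ≥ lam₁, ∀ β ≥ 2 * Real.exp (-lam * α * T), ∀ q h : H5 ε M T,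
      ‖q‖ ≤ R → ‖q + h‖ ≤ R → TraceGE c₀ q → TraceGE c₀ (q + h) →
      (∀ t ∈ Icc 0 T, rep h 0 0 ε t = 0) → (∀ t ∈ Icc 0 T, rep h 1 0 ε t = 0) →
      bulkEnergy ε M T lam α (rep h 1 0) + bulkEnergy ε M T lam α (rep h 0 1)
          + bulkEnergy ε M T lam α (rep h 0 0)
          + (lineEnergy ε M lam (fun x => rep h 1 0 x 0)
            + lineEnergy ε M lam fun x => rep h 0 0 x 0) + β / 2 * ‖h‖ ^ 2
        ≤ J lam α β (q + h) - J lam α β q - dJ lam α β c₀ q h := by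
  obtain ⟨K, -, hK⟩ := exists_abs_rep_le 5 hε hT
  obtain ⟨B, hB⟩ := exists_isBoundedBy hε hT hc R
  set A := 67 * B ^ 12
  set C := carlemanConst (1 - α * (c₀⁻¹ ^ 2 / 2)) (B⁻¹ ^ 2 / 2) (c₀⁻¹ ^ 2 / 2)
  set κ := (M - ε) * K ^ 2 with hκ
  refine ⟨max (8 * B ^ 6) (max (2 * C * (A * (3 + 2 * α + α⁻¹) + 1))
    ((1 + 2 * A) * κ / (α * T) ^ 2)), fun lam hlam β hβ q h hq hqh tq tqh z zx => ?_⟩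
  rw [ge_iff_le, max_le_iff, max_le_iff] at hlam
  have hB1 : 1 ≤ B := (hB q hq).one_le
  have hlam1 : 1 ≤ lam := by linarith [one_le_pow₀ hB1 (n := 6)]
  have hrep := continuous_rep hε hT h
  have hexp : Real.exp (-2 * lam * α * T) = Real.exp (-(2 * (α * T * lam))) := by ring_nf
  rw [J_add_sub_sub_dJ hε hT hc tq tqh]
  refine (coercive_of_absorption (κ := κ) hα hlam1 (by positivity)
    (carlemanConst_pos (by linarith) (by positivity) (by positivity)) hlam.2.1
    (Real.exp_pos _).le ?_ (bulkEnergy_nonneg _) (bulkEnergy_nonneg _)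
    (bulkEnergy_nonneg _) (lineEnergy_nonneg hε.le _) (lineEnergy_nonneg hε.le _)
    (lineEnergy_nonneg hε.le _) (bulkEnergy_nonneg _) (bulkEnergy_nonneg _) (sq_nonneg _)
    (two_mul_bulkEnergy_trace_le hε.le hT.le (continuous_slice (hrep 0 0) 0))
    (two_mul_bulkEnergy_trace_le hε.le hT.le (continuous_slice (hrep 1 0) 0))
    (abs_setIntegral_mixedTerm_le hε hT hc (hB q hq) (hB _ hqh) (by positivity))
    (carleman_estimate_rep hε hT hc hα.le hαc (hB _ hqh) tqh hlam.1 z zx) ?_ ?_).trans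
    (add_le_add_left (le_setIntegral_sqRemainder hε hT hc (hB q hq) (hB _ hqh) tq tqh) _)
  · rw [Real.exp_le_one_iff]
    linarith [show 0 ≤ lam * α * T by positivity]
  · refine (lineEnergy_le_of_abs_le h0 hε.le (by linarith) (continuous_slice (hrep 1 0) T)
      fun x => hK h 1 0 x T).trans_eq ?_
    rw [hκ]
    ring
  · rw [hexp]
    exact mul_exp_le_of_two_mul_exp_le (mul_pos hα hT) (by linarith) hlam.2.2
      (by convert hβ.le using 3; ring)

end Convexity

section StrongConvexity

variable {E : Type*} [NormedAddCommGroup E] {S : Set E} {f : E → ℝ} {m L : ℝ}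

lemma mul_sq_norm_sub_le_of_strongConvexOn [NormedSpace ℝ E] (hf : StrongConvexOn S m f)
    (hL : ∀ x ∈ S, L ≤ f x) {x y : E} (hx : x ∈ S) (hy : y ∈ S) :
    m / 4 * ‖x - y‖ ^ 2 ≤ (f x - L) + (f y - L) := by
  have hmid := hf.2 hx hy one_half_pos.le one_half_pos.le (add_halves 1)
  have hle := hL _ (hf.1 hx hy one_half_pos.le one_half_pos.le (add_halves 1))
  simp only [smul_eq_mul] at hmid
  linarith

lemma cauchySeq_of_strongConvexOn [NormedSpace ℝ E] (hf : StrongConvexOn S m f) (hm : 0 < m)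
    (hL : ∀ x ∈ S, L ≤ f x) {u : ℕ → E} (hu : ∀ n, u n ∈ S)
    (hlim : Filter.Tendsto (fun n => f (u n)) Filter.atTop (𝓝 L)) : CauchySeq u := by
  refine Metric.cauchySeq_iff'.2 fun η hη => ?_
  obtain ⟨N, hN⟩ := Filter.eventually_atTop.1 <|
    hlim.eventually_lt_const (lt_add_of_pos_right L (show 0 < m / 8 * η ^ 2 by positivity))
  refine ⟨N, fun n hn => ?_⟩
  have hsq : m / 4 * ‖u n - u N‖ ^ 2 < m / 4 * η ^ 2 := by
    linarith [mul_sq_norm_sub_le_of_strongConvexOn hf hL (hu n) (hu N), hN n hn, hN N le_rfl]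
  rw [dist_eq_norm]
  exact lt_of_pow_lt_pow_left₀ 2 hη.le (lt_of_mul_lt_mul_left hsq (by positivity))

lemma exists_isMinOn_of_strongConvexOn [NormedSpace ℝ E] [CompleteSpace E]
    (hf : StrongConvexOn S m f) (hm : 0 < m) (hlsc : LowerSemicontinuousOn f S)
    (hS : IsClosed S) (hne : S.Nonempty) (hbdd : BddBelow (f '' S)) : ∃ x ∈ S, IsMinOn f S x := by
  have hL (x : E) (hx : x ∈ S) : sInf (f '' S) ≤ f x := csInf_le hbdd (mem_image_of_mem f hx)
  obtain ⟨v, -, hv, hvS⟩ := exists_seq_tendsto_sInf (hne.image f) hbdd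
  choose u hu huv using hvS
  have hlim : Filter.Tendsto (fun n => f (u n)) Filter.atTop (𝓝 (sInf (f '' S))) := by
    simpa only [huv] using hv
  obtain ⟨x, hx⟩ := cauchySeq_tendsto_of_complete (cauchySeq_of_strongConvexOn hf hm hL hu hlim)
  have hxS : x ∈ S := hS.mem_of_tendsto hx (.of_forall hu)
  have hxu : Filter.Tendsto u Filter.atTop (𝓝[S] x) :=
    tendsto_nhdsWithin_iff.2 ⟨hx, .of_forall hu⟩
  have hmin : f x ≤ sInf (f '' S) := le_of_forall_lt_imp_le_of_dense fun y hy =>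
    ge_of_tendsto hlim ((hxu.eventually (hlsc x hxS y hy)).mono fun _ h => h.le)
  exact ⟨x, hxS, fun y hy => hmin.trans (hL y hy)⟩

variable [InnerProductSpace ℝ E]

lemma strongConvexOn_of_gradient_ineq (hS : Convex ℝ S)
    (h : ∀ x ∈ S, ∃ g : E, ∀ y ∈ S, f x + inner ℝ g (y - x) + m / 2 * ‖y - x‖ ^ 2 ≤ f y) :
    StrongConvexOn S m f := by
  refine ⟨hS, fun x hx y hy a b ha hb hab => ?_⟩
  obtain ⟨g, hg⟩ := h _ (hS hx hy ha hb hab)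
  have hxz : x - (a • x + b • y) = b • (x - y) := by
    rw [eq_sub_of_add_eq hab]
    module
  have hyz : y - (a • x + b • y) = -(a • (x - y)) := by
    rw [eq_sub_of_add_eq' hab]
    module
  have hgx := mul_le_mul_of_nonneg_left (hg x hx) ha
  have hgy := mul_le_mul_of_nonneg_left (hg y hy) hb
  rw [hxz, inner_smul_right, norm_smul, mul_pow, Real.norm_eq_abs, sq_abs] at hgx
  rw [hyz, inner_neg_right, inner_smul_right, norm_neg, norm_smul, mul_pow, Real.norm_eq_abs,
    sq_abs] at hgy
  obtain rfl := eq_sub_of_add_eq hab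
  simp only [smul_eq_mul]
  linarith

lemma lowerSemicontinuousOn_of_gradient_ineq
    (h : ∀ x ∈ S, ∃ g : E, ∀ y ∈ S, f x + inner ℝ g (y - x) ≤ f y) :
    LowerSemicontinuousOn f S := by
  intro x hx c hc
  obtain ⟨g, hg⟩ := h x hx
  have haffine : Continuous fun y => f x + inner ℝ g (y - x) := by fun_prop
  have hlt := haffine.continuousAt.eventually_const_lt (show c < f x + inner ℝ g (x - x) by simpa)
  filter_upwards [mem_nhdsWithin_of_mem_nhds hlt, self_mem_nhdsWithin] with y hy hyS
    using hy.trans_le (hg y hyS)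

lemma existsUnique_isMinOn_of_gradient_ineq [CompleteSpace E] (hm : 0 < m) (hS : Convex ℝ S)
    (hSc : IsClosed S) (hne : S.Nonempty) (hbdd : BddBelow (f '' S))
    (h : ∀ x ∈ S, ∃ g : E, ∀ y ∈ S, f x + inner ℝ g (y - x) + m / 2 * ‖y - x‖ ^ 2 ≤ f y) :
    ∃! x, x ∈ S ∧ IsMinOn f S x := by
  have hstrong := strongConvexOn_of_gradient_ineq hS h
  have hlsc : LowerSemicontinuousOn f S := lowerSemicontinuousOn_of_gradient_ineq fun x hx =>
    (h x hx).imp fun g hg y hy => by linarith [hg y hy, show 0 ≤ m / 2 * ‖y - x‖ ^ 2 by positivity]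
  obtain ⟨x, hx, hmin⟩ := exists_isMinOn_of_strongConvexOn hstrong hm hlsc hSc hne hbdd
  exact ⟨x, ⟨hx, hmin⟩, fun y ⟨hy, hymin⟩ =>
    (hstrong.strictConvexOn hm).eq_of_isMinOn hymin hmin hy hx⟩

end StrongConvexity

section InnerProduct

variable {E : Type*} [NormedAddCommGroup E] [InnerProductSpace ℝ E]

lemma exists_mem_inner_eq (V : Submodule ℝ E) [CompleteSpace V] (L : E →L[ℝ] ℝ) :
    ∃ g ∈ V, ∀ h ∈ V, inner ℝ g h = L h :=
  let g := (InnerProductSpace.toDual ℝ V).symm (L.comp V.subtypeL)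
  ⟨g, g.2, fun h hh => InnerProductSpace.toDual_symm_apply (x := (⟨h, hh⟩ : V))⟩

lemma eq_of_hasFDerivWithinAt_submodule {V : Submodule ℝ E} {f : E → ℝ} {g₁ g₂ x : E}
    (hx : x ∈ V) (hg₁ : g₁ ∈ V) (hg₂ : g₂ ∈ V) (h₁ : HasFDerivWithinAt f (innerSL ℝ g₁) V x)
    (h₂ : HasFDerivWithinAt f (innerSL ℝ g₂) V x) : g₁ = g₂ := by
  have htangent : g₁ - g₂ ∈ tangentConeAt ℝ (V : Set E) x :=
    mem_tangentConeAt_of_add_smul_mem (Filter.tendsto_id (x := 𝓝[≠] (0 : ℝ)))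
      (.of_forall fun s => V.add_mem hx (V.smul_mem s (V.sub_mem hg₁ hg₂)))
  have heq : inner ℝ g₁ (g₁ - g₂) = inner ℝ g₂ (g₁ - g₂) := h₁.unique_on h₂ htangent
  rw [← sub_eq_zero, ← inner_self_eq_zero (𝕜 := ℝ), inner_sub_left, heq, sub_self]

lemma sub_le_of_taylor {f : E → ℝ} {q k h : E} {C a₁ a₂ b : ℝ} (hC : 0 ≤ C)
    (hk : |f (q + k) - f q - b| ≤ C * ‖k‖ ^ 2)
    (hkh : |f (q + k + h) - f q - (b + a₁)| ≤ C * ‖k + h‖ ^ 2)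
    (hh : |f (q + k + h) - f (q + k) - a₂| ≤ C * ‖h‖ ^ 2) :
    a₂ - a₁ ≤ 3 * C * (‖k‖ ^ 2 + ‖h‖ ^ 2) := by
  have hsq : C * ‖k + h‖ ^ 2 ≤ C * (2 * (‖k‖ ^ 2 + ‖h‖ ^ 2)) := by
    gcongr
    linarith [parallelogram_law_with_norm ℝ k h, mul_self_nonneg ‖k - h‖]
  linarith [(abs_le.1 hh).1, (abs_le.1 hkh).2, (abs_le.1 hk).1]

lemma norm_le_of_inner_smul_le {g : E} {C r δ θ : ℝ} (hC : 0 ≤ C) (hr : 0 < r) (hθ : 0 < θ)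
    (hθ1 : θ ≤ 1) (hθr : θ * r ≤ δ)
    (h : ∀ s : ℝ, ‖s • g‖ ≤ δ → inner ℝ g (s • g) ≤ C * (r ^ 2 + ‖s • g‖ ^ 2)) :
    ‖g‖ ≤ 2 * C / θ * r := by
  rcases eq_or_ne g 0 with rfl | hg
  · rw [norm_zero]
    positivity
  have hg0 : 0 < ‖g‖ := norm_pos_iff.2 hg
  have hnorm : ‖(θ * r / ‖g‖) • g‖ = θ * r := by
    rw [norm_smul, Real.norm_of_nonneg (by positivity), div_mul_cancel₀ _ hg0.ne']
  have hinner := h (θ * r / ‖g‖) (hnorm.trans_le hθr)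
  rw [hnorm, inner_smul_right, real_inner_self_eq_norm_sq] at hinner
  refine le_of_mul_le_mul_left ?_ (mul_pos hθ hr)
  calc θ * r * ‖g‖ = θ * r / ‖g‖ * ‖g‖ ^ 2 := by field_simp
    _ ≤ C * (r ^ 2 + (θ * r) ^ 2) := hinner
    _ ≤ C * (r ^ 2 + (1 * r) ^ 2) := by gcongr
    _ = θ * r * (2 * C / θ * r) := by
        field_simp
        norm_num

end InnerProduct

section Completeness

variable {Ω : Set (ℝ × ℝ)} {φ : ℝ × ℝ → ℝ}

lemma IsTest.memLp (h : IsTest Ω φ) : MemLp φ 2 (volume.restrict Ω) :=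
  (h.1.continuous.memLp_of_hasCompactSupport h.2.1).restrict Ω

lemma continuous_integral_mul_test (h : IsTest Ω φ) :
    Continuous fun u : L2 Ω => ∫ p in Ω, u p * φ p := by
  have hinner (u : L2 Ω) : ∫ p in Ω, u p * φ p = inner ℝ u (h.memLp.toLp φ) := by
    rw [L2.inner_def]
    refine integral_congr_ae ?_
    filter_upwards [h.memLp.coeFn_toLp] with p hp
    rw [hp, Real.inner_apply]
  simp only [hinner]
  fun_prop

lemma isClosed_sobolev (k : ℕ) (Ω : Set (ℝ × ℝ)) :
    IsClosed (sobolev k Ω : Set (PiLp 2 (fun _ : MIdx k => L2 Ω))) := by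
  have hInter : (sobolev k Ω : Set (PiLp 2 (fun _ : MIdx k => L2 Ω)))
      = ⋂ (a : MIdx k) (φ : ℝ × ℝ → ℝ) (_ : IsTest Ω φ),
        {u | ∫ p in Ω, u (MIdx.zero k) p * mixedDeriv a.1.1 a.1.2 φ p
          = (-1) ^ (a.1.1.val + a.1.2.val) * ∫ p in Ω, u a p * φ p} := by
    simp only [← ofPred_forall]
    rfl
  rw [hInter]
  exact isClosed_iInter fun a => isClosed_iInter fun φ => isClosed_iInter fun hφ => isClosed_eq
    ((continuous_integral_mul_test (hφ.mixedDeriv _ _)).comp (PiLp.continuous_apply 2 _ _))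
    (continuous_const.mul ((continuous_integral_mul_test hφ).comp (PiLp.continuous_apply 2 _ _)))

instance (k : ℕ) (Ω : Set (ℝ × ℝ)) : CompleteSpace (sobolev k Ω) :=
  (isClosed_sobolev k Ω).completeSpace_coe

end Completeness

section Spaces

variable {ε M T cbar R : ℝ} {g₀ g₁ : ℝ → ℝ} (hε : ε < M) (hT : 0 < T)
include hε hT

/-- Point evaluation of the extended representative of `∂ₓⁱ ∂ₜʲ q`, as a bounded functional. -/
def repCLM (i j : ℕ) (x t : ℝ) : H5 ε M T →L[ℝ] ℝ :=
  LinearMap.mkContinuousOfExistsBound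
    { toFun := fun q => rep q i j x t
      map_add' := fun q h => rep_add hε hT q h i j x t
      map_smul' := fun c q => rep_smul c q i j x t }
    (let ⟨K, _, hK⟩ := exists_abs_rep_le 5 hε hT
     ⟨K, fun q => hK q i j x t⟩)

lemma continuous_rep_apply (i j : ℕ) (x t : ℝ) : Continuous fun q : H5 ε M T => rep q i j x t :=
  (repCLM hε hT i j x t).continuous

lemma isClosed_setOf_boundaryValues (a b : ℝ → ℝ) : IsClosed {q : H5 ε M T | ∀ t ∈ Icc 0 T,
    rep q 0 0 ε t = a t ∧ rep q 1 0 ε t = b t ∧ rep q 1 0 M t = 0} := by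
  simp only [ofPred_forall]
  exact isClosed_biInter fun t _ =>
    (isClosed_eq (continuous_rep_apply hε hT _ _ _ _) continuous_const).inter
      ((isClosed_eq (continuous_rep_apply hε hT _ _ _ _) continuous_const).inter
        (isClosed_eq (continuous_rep_apply hε hT _ _ _ _) continuous_const))

lemma mem_H0_iff (h : H5 ε M T) : h ∈ H0 ε M T ↔ ∀ t ∈ Icc 0 T,
    rep h 0 0 ε t = 0 ∧ rep h 1 0 ε t = 0 ∧ rep h 1 0 M t = 0 := by
  refine forall₂_congr fun t ht => ?_
  rw [D_eq_rep hε hT h (by norm_num) ⟨le_rfl, hε.le⟩ ht,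
    D_eq_rep hε hT h (by norm_num) ⟨le_rfl, hε.le⟩ ht,
    D_eq_rep hε hT h (by norm_num) ⟨hε.le, le_rfl⟩ ht]

lemma isClosed_H0 : IsClosed (H0 ε M T) :=
  (Set.ext (mem_H0_iff hε hT) : H0 ε M T = _) ▸ isClosed_setOf_boundaryValues hε hT 0 0

/-- `H₀` as a linear subspace of `H⁵(Ω_T)`. -/
def H0submodule : Submodule ℝ (H5 ε M T) where
  carrier := H0 ε M T
  zero_mem' := (mem_H0_iff hε hT 0).2 fun t _ =>
    ⟨map_zero (repCLM hε hT 0 0 ε t), map_zero (repCLM hε hT 1 0 ε t),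
      map_zero (repCLM hε hT 1 0 M t)⟩
  add_mem' {u v} hu hv := by
    rw [mem_H0_iff hε hT] at *
    intro t ht
    simp [rep_add hε hT, hu t ht, hv t ht]
  smul_mem' c u hu := by
    rw [mem_H0_iff hε hT] at *
    intro t ht
    simp [rep_smul, hu t ht]

lemma mem_admissible_iff (q : H5 ε M T) : q ∈ admissible ε M T cbar g₀ g₁ ↔
    (∀ t ∈ Icc 0 T, rep q 0 0 ε t = g₀ (t + ε) ∧
      rep q 1 0 ε t = g₁ (t + ε) + derivWithin g₀ (Icc ε (T + ε)) (t + ε) ∧ rep q 1 0 M t = 0) ∧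
    TraceGE (1 / (2 * cbar ^ (1 / 4 : ℝ))) q := by
  refine and_congr (forall₂_congr fun t ht => ?_) (forall₂_congr fun x hx => ?_)
  · rw [D_eq_rep hε hT q (by norm_num) ⟨le_rfl, hε.le⟩ ht,
      D_eq_rep hε hT q (by norm_num) ⟨le_rfl, hε.le⟩ ht,
      D_eq_rep hε hT q (by norm_num) ⟨hε.le, le_rfl⟩ ht]
  · rw [D_eq_rep hε hT q (by norm_num) hx ⟨le_rfl, hT.le⟩]

lemma traceGE_of_mem_admissible {q : H5 ε M T} (hq : q ∈ admissible ε M T cbar g₀ g₁) :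
    TraceGE (1 / (2 * cbar ^ (1 / 4 : ℝ))) q := ((mem_admissible_iff hε hT q).1 hq).2

lemma sub_mem_H0 {p q : H5 ε M T} (hp : p ∈ admissible ε M T cbar g₀ g₁)
    (hq : q ∈ admissible ε M T cbar g₀ g₁) : p - q ∈ H0 ε M T := by
  rw [mem_admissible_iff hε hT] at hp hq
  rw [mem_H0_iff hε hT]
  intro t ht
  simp [rep_sub hε hT, hp.1 t ht, hq.1 t ht]

lemma isClosed_setOf_traceGE (c₀ : ℝ) : IsClosed {q : H5 ε M T | TraceGE c₀ q} := by
  simp only [TraceGE, ofPred_forall]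
  exact isClosed_biInter fun x _ =>
    isClosed_le continuous_const (continuous_rep_apply hε hT 0 0 x 0)

lemma isClosed_feasible : IsClosed (feasible ε M T cbar R g₀ g₁) := by
  have hadm : IsClosed (admissible ε M T cbar g₀ g₁) :=
    (Set.ext (mem_admissible_iff hε hT) : admissible ε M T cbar g₀ g₁ = _) ▸
      (isClosed_setOf_boundaryValues hε hT _ _).inter (isClosed_setOf_traceGE hε hT _)
  exact Metric.isClosed_closedBall.inter hadm

lemma convex_admissible : Convex ℝ (admissible ε M T cbar g₀ g₁) := by
  intro p hp q hq a b ha hb hab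
  rw [mem_admissible_iff hε hT] at *
  have hrep (i j : ℕ) (x t : ℝ) :
      rep (a • p + b • q) i j x t = a * rep p i j x t + b * rep q i j x t := by
    rw [rep_add hε hT, rep_smul, rep_smul]
  refine ⟨fun t ht => ?_, fun x hx => ?_⟩
  · simp only [hrep, hp.1 t ht, hq.1 t ht, ← add_mul, hab, one_mul, mul_zero, add_zero, and_self]
  · rw [hrep]
    calc 1 / (2 * cbar ^ (1 / 4 : ℝ))
        = a * (1 / (2 * cbar ^ (1 / 4 : ℝ))) + b * (1 / (2 * cbar ^ (1 / 4 : ℝ))) := by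
          rw [← add_mul, hab, one_mul]
      _ ≤ a * rep p 0 0 x 0 + b * rep q 0 0 x 0 := by
          gcongr
          exacts [hp.2 x hx, hq.2 x hx]

lemma convex_feasible : Convex ℝ (feasible ε M T cbar R g₀ g₁) :=
  (convex_closedBall _ _).inter (convex_admissible hε hT)

end Spaces

section Frechet

variable {ε M T c₀ lam α β : ℝ} (hε : ε < M) (hT : 0 < T)

lemma TraceGE.half (hc : 0 < c₀) {q : H5 ε M T} (hq : TraceGE c₀ q) : TraceGE (c₀ / 2) q :=
  fun x hx => (half_le_self hc.le).trans (hq x hx)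

lemma dJ_half (hc : 0 < c₀) {q : H5 ε M T} (hq : TraceGE c₀ q) (h : H5 ε M T) :
    dJ lam α β (c₀ / 2) q h = dJ lam α β c₀ q h := by
  rw [dJ, dJ]
  congr 2
  refine setIntegral_congr_fun measurableSet_rect fun z hz => ?_
  have hx := Ioo_subset_Icc_self hz.1
  simp only [Frep, Lrep, qinv_eq hq hx, qinv_eq (hq.half hc) hx]

lemma dJ_smul (q h : H5 ε M T) (s : ℝ) : dJ lam α β c₀ q (s • h) = s * dJ lam α β c₀ q h := by
  have hint : ∫ z in rect ε M T, weight lam α z.1 z.2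
        * (Frep c₀ q z.1 z.2 * Lrep c₀ q (s • h) z.1 z.2)
      = s * ∫ z in rect ε M T, weight lam α z.1 z.2
          * (Frep c₀ q z.1 z.2 * Lrep c₀ q h z.1 z.2) := by
    rw [← integral_const_mul]
    congr 1 with z
    simp only [Lrep, Lval, rep_smul]
    ring
  have hinner : inner ℝ q (s • h) = s * inner ℝ q h := real_inner_smul_right q h s
  rw [dJ, dJ, hint, hinner]
  ring

include hε hT

lemma dJ_add (hc : 0 < c₀) (q h k : H5 ε M T) :
    dJ lam α β c₀ q (h + k) = dJ lam α β c₀ q h + dJ lam α β c₀ q k := by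
  have hF := continuous_Frep hε hT hc q
  have hLh := continuous_Lrep hε hT hc q h
  have hLk := continuous_Lrep hε hT hc q k
  have hint : ∫ z in rect ε M T, weight lam α z.1 z.2
        * (Frep c₀ q z.1 z.2 * Lrep c₀ q (h + k) z.1 z.2)
      = (∫ z in rect ε M T, weight lam α z.1 z.2 * (Frep c₀ q z.1 z.2 * Lrep c₀ q h z.1 z.2))
        + ∫ z in rect ε M T, weight lam α z.1 z.2
          * (Frep c₀ q z.1 z.2 * Lrep c₀ q k z.1 z.2) := by
    rw [← integral_add (integrableOn_rect_of_continuous (by fun_prop))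
      (integrableOn_rect_of_continuous (by fun_prop))]
    congr 1 with z
    simp only [Lrep, Lval, rep_add hε hT]
    ring
  rw [dJ, dJ, dJ, hint, inner_add_right]
  ring

lemma exists_abs_dJ_le (hc : 0 < c₀) (lam α β : ℝ) (q : H5 ε M T) :
    ∃ C, ∀ h : H5 ε M T, |dJ lam α β c₀ q h| ≤ C * ‖h‖ := by
  obtain ⟨K, -, hK⟩ := exists_abs_rep_le 5 hε hT
  obtain ⟨B, hB⟩ := exists_isBoundedBy hε hT hc ‖q‖
  have hq := hB q le_rfl
  have hB1 : 1 ≤ B := hq.one_le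
  set w := ∫ z in rect ε M T, weight lam α z.1 z.2
  refine ⟨24 * B ^ 11 * K * w + 2 * |β| * ‖q‖, fun h => ?_⟩
  have hint := abs_setIntegral_weight_mul_le (lam := lam) (α := α) (T := T)
    (f := fun x t => Frep c₀ q x t * Lrep c₀ q h x t)
    (C := 2 * B ^ 5 * (6 * B ^ 6 * (K * ‖h‖))) (ε := ε) (M := M) fun x _ t => by
      rw [abs_mul]
      gcongr
      exacts [abs_Frep_le hq x t, abs_Lrep_le hq (hK h) x t]
  calc |dJ lam α β c₀ q h|
      ≤ 2 * (2 * B ^ 5 * (6 * B ^ 6 * (K * ‖h‖)) * w) + 2 * |β| * (‖q‖ * ‖h‖) := by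
        refine (abs_add_le _ _).trans ?_
        rw [abs_mul 2, abs_mul (2 * β), abs_mul 2, abs_two]
        gcongr
        exact abs_real_inner_le_norm q h
    _ = (24 * B ^ 11 * K * w + 2 * |β| * ‖q‖) * ‖h‖ := by ring

lemma exists_inner_eq_dJ (hc : 0 < c₀) (lam α β : ℝ) (q : H5 ε M T) :
    ∃ G ∈ H0 ε M T, ∀ h ∈ H0 ε M T, inner ℝ G h = dJ lam α β c₀ q h := by
  have : CompleteSpace (H0submodule hε hT) := (isClosed_H0 hε hT).completeSpace_coe
  exact exists_mem_inner_eq (H0submodule hε hT) <| LinearMap.mkContinuousOfExistsBound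
    { toFun := dJ lam α β c₀ q
      map_add' := dJ_add hε hT hc q
      map_smul' := fun s h => dJ_smul q h s }
    (exists_abs_dJ_le hε hT hc lam α β q)

lemma exists_traceGE_half_of_norm_sub_le (hc : 0 < c₀) :
    ∃ δ > 0, ∀ p q : H5 ε M T, TraceGE c₀ p → ‖q - p‖ ≤ δ → TraceGE (c₀ / 2) q := by
  obtain ⟨K, hK0, hK⟩ := exists_abs_rep_le 5 hε hT
  refine ⟨c₀ / (2 * K), by positivity, fun p q hp hqp x hx => ?_⟩
  have hsmall : K * ‖q - p‖ ≤ c₀ / 2 := by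
    calc K * ‖q - p‖ ≤ K * (c₀ / (2 * K)) := by gcongr
      _ = c₀ / 2 := by field_simp
  have hsub := (abs_le.1 (hK (q - p) 0 0 x 0)).1
  rw [rep_sub hε hT] at hsub
  linarith [hp x hx]

lemma exists_taylor_le_near (hc : 0 < c₀) (R lam α β : ℝ) :
    ∃ C > 0, ∃ δ > 0, ∀ p q h : H5 ε M T, ‖p‖ ≤ R → ‖q‖ ≤ R → TraceGE c₀ p → TraceGE c₀ q →
      ‖q + h - p‖ ≤ δ →
      |J lam α β (q + h) - J lam α β q - dJ lam α β c₀ q h| ≤ C * ‖h‖ ^ 2 := by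
  obtain ⟨δ, hδ, htrace⟩ := exists_traceGE_half_of_norm_sub_le hε hT hc
  obtain ⟨C, hC, htaylor⟩ := exists_taylor_le hε hT (half_pos hc) (R + δ) lam α β
  refine ⟨C, hC, δ, hδ, fun p q h hp hq tp tq hqp => ?_⟩
  have hnorm : ‖q + h‖ ≤ R + δ := by
    linarith [norm_le_norm_add_norm_sub' (q + h) p]
  rw [← dJ_half hc tq]
  exact htaylor q h (by linarith) hnorm (tq.half hc) (htrace p _ tp hqp)

lemma isFrechetDeriv_of_inner_eq (hc : 0 < c₀) {q G : H5 ε M T} (hq : TraceGE c₀ q)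
    (hG : G ∈ H0 ε M T) (h : ∀ h ∈ H0 ε M T, inner ℝ G h = dJ lam α β c₀ q h) :
    IsFrechetDeriv (J lam α β) q G := by
  obtain ⟨C, -, δ, hδ, htaylor⟩ := exists_taylor_le_near hε hT hc ‖q‖ lam α β
  have hO : (fun h => J lam α β (q + h) - J lam α β q - innerSL ℝ G h)
      =O[𝓝[H0 ε M T] 0] fun h => ‖h - 0‖ ^ 2 := by
    refine .of_bound C ?_
    filter_upwards [mem_nhdsWithin_of_mem_nhds (Metric.ball_mem_nhds _ hδ), self_mem_nhdsWithin]
      with k hk hk0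
    rw [mem_ball_zero_iff] at hk
    rw [sub_zero, innerSL_apply_apply, h k hk0, Real.norm_eq_abs, norm_pow, norm_norm]
    exact htaylor q q k le_rfl le_rfl hq hq (by rw [add_sub_cancel_left]; exact hk.le)
  have hremainder := hO.hasFDerivWithinAt (𝕜 := ℝ) (H0submodule hε hT).zero_mem one_lt_two
  have hsum := ((hremainder.add (innerSL ℝ G).hasFDerivWithinAt).add_const
    (J lam α β q)).congr_fderiv (zero_add _)
  exact ⟨hG, hsum.congr (fun h _ => by simp) (by simp)⟩

lemma IsFrechetDeriv.unique {I : H5 ε M T → ℝ} {q G₁ G₂ : H5 ε M T} (h₁ : IsFrechetDeriv I q G₁)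
    (h₂ : IsFrechetDeriv I q G₂) : G₁ = G₂ :=
  eq_of_hasFDerivWithinAt_submodule (H0submodule hε hT).zero_mem h₁.1 h₂.1 h₁.2 h₂.2

lemma existsUnique_isFrechetDeriv (hc : 0 < c₀) {q : H5 ε M T} (hq : TraceGE c₀ q) :
    ∃! G : H5 ε M T, IsFrechetDeriv (J lam α β) q G := by
  obtain ⟨G, hG, hinner⟩ := exists_inner_eq_dJ hε hT hc lam α β q
  have hderiv := isFrechetDeriv_of_inner_eq hε hT hc hq hG hinner
  exact ⟨G, hderiv, fun G' hG' => hG'.unique hε hT hderiv⟩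

lemma IsFrechetDeriv.inner_eq_dJ (hc : 0 < c₀) {q G : H5 ε M T} (hq : TraceGE c₀ q)
    (hG : IsFrechetDeriv (J lam α β) q G) {h : H5 ε M T} (hh : h ∈ H0 ε M T) :
    inner ℝ G h = dJ lam α β c₀ q h := by
  obtain ⟨G', hG', hinner⟩ := exists_inner_eq_dJ hε hT hc lam α β q
  rw [hG.unique hε hT (isFrechetDeriv_of_inner_eq hε hT hc hq hG' hinner)]
  exact hinner h hh

lemma exists_inner_sub_le (hc : 0 < c₀) (R lam α β : ℝ) :
    ∃ C > 0, ∃ δ > 0, ∀ q₁ q₂ G₁ G₂ : H5 ε M T, ‖q₁‖ ≤ R → ‖q₂‖ ≤ R → TraceGE c₀ q₁ →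
      TraceGE c₀ q₂ → IsFrechetDeriv (J lam α β) q₁ G₁ → IsFrechetDeriv (J lam α β) q₂ G₂ →
      ∀ h ∈ H0 ε M T, ‖h‖ ≤ δ → inner ℝ (G₂ - G₁) h ≤ C * (‖q₂ - q₁‖ ^ 2 + ‖h‖ ^ 2) := by
  obtain ⟨C, hC, δ, hδ, htaylor⟩ := exists_taylor_le_near hε hT hc R lam α β
  refine ⟨3 * C, by positivity, δ, hδ, fun q₁ q₂ G₁ G₂ n₁ n₂ t₁ t₂ hG₁ hG₂ h hh hhδ => ?_⟩
  obtain ⟨k, rfl⟩ : ∃ k, q₂ = q₁ + k := ⟨q₂ - q₁, (add_sub_cancel _ _).symm⟩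
  rw [add_sub_cancel_left, inner_sub_left, hG₂.inner_eq_dJ hε hT hc t₂ hh,
    hG₁.inner_eq_dJ hε hT hc t₁ hh]
  have hkh := htaylor (q₁ + k) q₁ (k + h) n₂ n₁ t₂ t₁ (by rwa [← add_assoc, add_sub_cancel_left])
  rw [dJ_add hε hT hc, ← add_assoc] at hkh
  exact sub_le_of_taylor hC.le
    (htaylor (q₁ + k) q₁ k n₂ n₁ t₂ t₁ (by rw [sub_self, norm_zero]; exact hδ.le)) hkh
    (htaylor (q₁ + k) (q₁ + k) h n₂ n₂ t₂ t₂ (by rwa [add_sub_cancel_left]))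

lemma exists_lipschitz_isFrechetDeriv (hc : 0 < c₀) (R lam α β : ℝ) :
    ∃ K > 0, ∀ q₁ q₂ G₁ G₂ : H5 ε M T, ‖q₁‖ ≤ R → ‖q₂‖ ≤ R → TraceGE c₀ q₁ → TraceGE c₀ q₂ →
      IsFrechetDeriv (J lam α β) q₁ G₁ → IsFrechetDeriv (J lam α β) q₂ G₂ →
      ‖G₂ - G₁‖ ≤ K * ‖q₂ - q₁‖ := by
  obtain ⟨C, hC, δ, hδ, hinner⟩ := exists_inner_sub_le hε hT hc R lam α β
  set θ := δ / (2 * |R| + δ)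
  have hθ : 0 < θ := by positivity
  refine ⟨2 * C / θ, by positivity, fun q₁ q₂ G₁ G₂ n₁ n₂ t₁ t₂ hG₁ hG₂ => ?_⟩
  rcases eq_or_ne q₂ q₁ with rfl | hne
  · simp [hG₂.unique hε hT hG₁]
  have hnorm : ‖q₂ - q₁‖ ≤ 2 * |R| + δ := by
    linarith [norm_sub_le q₂ q₁, le_abs_self R]
  refine norm_le_of_inner_smul_le hC.le (norm_pos_iff.2 (sub_ne_zero.2 hne)) hθ
    (div_le_one_of_le₀ (by linarith [abs_nonneg R]) (by positivity)) ?_ fun s =>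
    hinner q₁ q₂ G₁ G₂ n₁ n₂ t₁ t₂ hG₁ hG₂ _
      ((H0submodule hε hT).smul_mem s ((H0submodule hε hT).sub_mem hG₂.1 hG₁.1))
  calc θ * ‖q₂ - q₁‖ ≤ θ * (2 * |R| + δ) := by gcongr
    _ = δ := div_mul_cancel₀ _ (by positivity)

end Frechet

section Minimizer

variable {E : Type*} [NormedAddCommGroup E] [InnerProductSpace ℝ E] {f : E → ℝ} {S V : Set E}
  {g x y : E} {m : ℝ}

lemma inner_sub_nonpos_of_isMinOn (hS : Convex ℝ S) (hV : ∀ y ∈ S, y - x ∈ V)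
    (hf : HasFDerivWithinAt (fun h => f (x + h)) (innerSL ℝ g) V 0) (hmin : IsMinOn f S x)
    (hx : x ∈ S) (hy : y ∈ S) : inner ℝ g (x - y) ≤ 0 := by
  set directions : Set E := (fun h => x + h) ⁻¹' S
  have hdirections : Convex ℝ directions := hS.translate_preimage_right x
  have hmin0 : IsMinOn (fun h => f (x + h)) directions 0 := fun h hh => by
    simpa only [mem_ofPred_eq, add_zero] using hmin hh
  have hsubset : directions ⊆ V := fun h hh => by simpa only [add_sub_cancel_left] using hV _ hh
  have hcone : y - x ∈ posTangentConeAt directions 0 := by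
    refine mem_posTangentConeAt_of_segment_subset ?_
    exact hdirections.segment_subset (by simpa [directions]) (by simpa [directions])
  have hnonneg := hmin0.localize.hasFDerivWithinAt_nonneg (hf.mono hsubset) hcone
  rw [innerSL_apply_apply] at hnonneg
  rwa [← neg_sub, inner_neg_right, neg_nonpos]

lemma isMinOn_of_gradient_ineq (hm : 0 ≤ m)
    (hgrad : ∀ y ∈ S, f x + inner ℝ g (y - x) + m / 2 * ‖y - x‖ ^ 2 ≤ f y)
    (h : ∀ y ∈ S, inner ℝ g (x - y) ≤ 0) : IsMinOn f S x := fun y hy => by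
  have hy' := h y hy
  rw [← neg_sub, inner_neg_right] at hy'
  have hsq : 0 ≤ m / 2 * ‖y - x‖ ^ 2 := by positivity
  simp only [mem_ofPred_eq]
  linarith [hgrad y hy]

end Minimizer

section Convexity

variable {ε M T cbar R lam α β : ℝ} {g₀ g₁ : ℝ → ℝ}

lemma J_nonneg (hβ : 0 ≤ β) (q : H5 ε M T) : 0 ≤ J lam α β q :=
  add_nonneg (integral_nonneg fun z => by positivity) (by positivity)

lemma inv_trace_bound_sq (hc : 0 < cbar) :
    (1 / (2 * cbar ^ (1 / 4 : ℝ)))⁻¹ ^ 2 / 2 = 2 * √cbar := by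
  have hsqrt : (cbar ^ (1 / 4 : ℝ)) ^ 2 = √cbar := by
    rw [← Real.rpow_natCast, ← Real.rpow_mul hc.le, Real.sqrt_eq_rpow]
    norm_num
  rw [one_div, inv_inv, mul_pow, hsqrt]
  ring

variable (hε : ε < M) (hT : 0 < T)
include hε hT

lemma setIntegral_weighted_D_sq_eq (h : H5 ε M T) :
    (∫ p in rect ε M T, Real.exp (-2 * lam * (p.1 + α * p.2)) *
        (|D h 1 0 p.1 p.2| ^ 2 + |D h 0 1 p.1 p.2| ^ 2 + |D h 0 0 p.1 p.2| ^ 2))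
      = bulkEnergy ε M T lam α (rep h 1 0) + bulkEnergy ε M T lam α (rep h 0 1)
          + bulkEnergy ε M T lam α (rep h 0 0) := by
  have hint (i j : ℕ) :
      IntegrableOn (fun z => weight lam α z.1 z.2 * rep h i j z.1 z.2 ^ 2) (rect ε M T) := by
    have hcont := continuous_rep hε hT h i j
    exact integrableOn_rect_of_continuous (by fun_prop)
  simp only [bulkEnergy]
  rw [← integral_add (hint 1 0) (hint 0 1),
    ← integral_add ((hint 1 0).fun_add (hint 0 1)) (hint 0 0)]
  refine setIntegral_congr_fun measurableSet_rect fun z hz => ?_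
  have hx := Ioo_subset_Icc_self hz.1
  have ht := Ioo_subset_Icc_self hz.2
  simp only [sq_abs]
  rw [D_eq_rep hε hT h (by norm_num) hx ht, D_eq_rep hε hT h (by norm_num) hx ht,
    D_eq_rep hε hT h (by norm_num) hx ht, weight]
  ring

lemma integral_weighted_D_trace_sq_eq (h : H5 ε M T) :
    (∫ x in ε..M, Real.exp (-2 * lam * x) * (|D h 1 0 x 0| ^ 2 + |D h 0 0 x 0| ^ 2))
      = lineEnergy ε M lam (fun x => rep h 1 0 x 0)
          + lineEnergy ε M lam fun x => rep h 0 0 x 0 := by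
  have hint (i j : ℕ) : IntervalIntegrable
      (fun x => Real.exp (-2 * lam * x) * rep h i j x 0 ^ 2) volume ε M := by
    have hcont := continuous_slice (continuous_rep hε hT h i j) 0
    exact Continuous.intervalIntegrable (by fun_prop) _ _
  simp only [lineEnergy]
  rw [← intervalIntegral.integral_add (hint 1 0) (hint 0 0)]
  refine intervalIntegral.integral_congr fun x hx => ?_
  rw [uIcc_of_le hε.le] at hx
  have h0 : (0 : ℝ) ∈ Icc 0 T := left_mem_Icc.2 hT.le
  simp only [sq_abs]
  rw [D_eq_rep hε hT h (by norm_num) hx h0, D_eq_rep hε hT h (by norm_num) hx h0]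
  ring

lemma exists_convexity_inequality (h0 : 0 ≤ ε) (hc : 0 < cbar)
    (hα : α ∈ Ioo 0 (1 / (2 * √cbar))) (R : ℝ) :
    ∃ lam₁, ∀ g₀ g₁ : ℝ → ℝ, ∀ lam ≥ lam₁, ∀ β ≥ 2 * Real.exp (-lam * α * T),
      ∀ q h : H5 ε M T, q ∈ feasible ε M T cbar R g₀ g₁ → q + h ∈ feasible ε M T cbar R g₀ g₁ →
      ∀ G : H5 ε M T, IsFrechetDeriv (J lam α β) q G →
        J lam α β (q + h) - J lam α β q - inner ℝ G h ≥
          (∫ p in rect ε M T, Real.exp (-2 * lam * (p.1 + α * p.2)) *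
              (|D h 1 0 p.1 p.2| ^ 2 + |D h 0 1 p.1 p.2| ^ 2 + |D h 0 0 p.1 p.2| ^ 2))
            + (∫ x in ε..M, Real.exp (-2 * lam * x) * (|D h 1 0 x 0| ^ 2 + |D h 0 0 x 0| ^ 2))
            + β / 2 * ‖h‖ ^ 2 := by
  have hc₀ : 0 < 1 / (2 * cbar ^ (1 / 4 : ℝ)) := by positivity
  have hαc : α * ((1 / (2 * cbar ^ (1 / 4 : ℝ)))⁻¹ ^ 2 / 2) < 1 := by
    rw [inv_trace_bound_sq hc]
    exact (lt_div_iff₀ (by positivity)).1 hα.2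
  obtain ⟨lam₁, hcoercive⟩ := exists_coercive_taylor_remainder h0 hε hT hα.1 hc₀ hαc R
  refine ⟨lam₁, fun g₀ g₁ lam hlam β hβ q h hq hqh G hG => ?_⟩
  have hh : h ∈ H0 ε M T := by
    simpa only [add_sub_cancel_left] using sub_mem_H0 hε hT hqh.2 hq.2
  have hboundary := (mem_H0_iff hε hT h).1 hh
  have htrace := traceGE_of_mem_admissible hε hT hq.2
  rw [hG.inner_eq_dJ hε hT hc₀ htrace hh, setIntegral_weighted_D_sq_eq hε hT,
    integral_weighted_D_trace_sq_eq hε hT]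
  exact hcoercive lam hlam β hβ q h (mem_closedBall_zero_iff.1 hq.1)
    (mem_closedBall_zero_iff.1 hqh.1) htrace (traceGE_of_mem_admissible hε hT hqh.2)
    (fun t ht => (hboundary t ht).1) fun t ht => (hboundary t ht).2.1

omit hT in
lemma weighted_D_integrals_nonneg (h : H5 ε M T) :
    0 ≤ (∫ p in rect ε M T, Real.exp (-2 * lam * (p.1 + α * p.2)) *
          (|D h 1 0 p.1 p.2| ^ 2 + |D h 0 1 p.1 p.2| ^ 2 + |D h 0 0 p.1 p.2| ^ 2))
        + ∫ x in ε..M, Real.exp (-2 * lam * x) * (|D h 1 0 x 0| ^ 2 + |D h 0 0 x 0| ^ 2) :=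
  add_nonneg (integral_nonneg fun p => by positivity)
    (intervalIntegral.integral_nonneg hε.le fun x _ => by positivity)

lemma exists_gradient_ineq_of_isFrechetDeriv (hc : 0 < cbar)
    (hgrad : ∀ q ∈ feasible ε M T cbar R g₀ g₁, ∀ G : H5 ε M T, IsFrechetDeriv (J lam α β) q G →
      ∀ p ∈ feasible ε M T cbar R g₀ g₁,
        J lam α β q + inner ℝ G (p - q) + β / 2 * ‖p - q‖ ^ 2 ≤ J lam α β p) :
    ∀ q ∈ feasible ε M T cbar R g₀ g₁, ∃ G : H5 ε M T, ∀ p ∈ feasible ε M T cbar R g₀ g₁,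
      J lam α β q + inner ℝ G (p - q) + β / 2 * ‖p - q‖ ^ 2 ≤ J lam α β p := fun q hq =>
  have htrace := traceGE_of_mem_admissible hε hT hq.2
  have ⟨G, hG⟩ := (existsUnique_isFrechetDeriv hε hT (by positivity) htrace).exists
  ⟨G, hgrad q hq G hG⟩

lemma isMinOn_feasible_iff_inner_sub_nonpos (hβ : 0 ≤ β) {q G : H5 ε M T}
    (hq : q ∈ feasible ε M T cbar R g₀ g₁) (hG : IsFrechetDeriv (J lam α β) q G)
    (hgrad : ∀ p ∈ feasible ε M T cbar R g₀ g₁,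
      J lam α β q + inner ℝ G (p - q) + β / 2 * ‖p - q‖ ^ 2 ≤ J lam α β p) :
    IsMinOn (J lam α β) (feasible ε M T cbar R g₀ g₁) q ↔
      ∀ p ∈ feasible ε M T cbar R g₀ g₁, inner ℝ G (q - p) ≤ 0 :=
  ⟨fun hmin _ hp => inner_sub_nonpos_of_isMinOn (convex_feasible hε hT)
    (fun _ hp => sub_mem_H0 hε hT hp.2 hq.2) hG.2 hmin hq hp, isMinOn_of_gradient_ineq hβ hgrad⟩

end Convexity

end Convexification

end

open Convexification in
theorem theorem5p1_general (ε M T cbar R : ℝ) (hε : 0 ≤ ε) (hεM : ε < M) (hT : 0 < T)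
    (hc : 0 < cbar) :
    (∀ (g₀ g₁ : ℝ → ℝ) (lam α β : ℝ),
      (∀ q ∈ admissible ε M T cbar g₀ g₁, ∃! G : H5 ε M T, IsFrechetDeriv (J lam α β) q G) ∧
      ∃ K > 0, ∀ q₁ ∈ feasible ε M T cbar R g₀ g₁, ∀ q₂ ∈ feasible ε M T cbar R g₀ g₁,
        ∀ G₁ G₂ : H5 ε M T, IsFrechetDeriv (J lam α β) q₁ G₁ → IsFrechetDeriv (J lam α β) q₂ G₂ →
          ‖G₂ - G₁‖ ≤ K * ‖q₂ - q₁‖) ∧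
    (∀ α ∈ Set.Ioo 0 (1 / (2 * √cbar)), ∃ lam₁ : ℝ,
      ∀ (g₀ g₁ : ℝ → ℝ), ∀ lam ≥ lam₁, ∀ β ≥ 2 * Real.exp (-lam * α * T),
        StrictConvexOn ℝ (feasible ε M T cbar R g₀ g₁) (J lam α β) ∧
        (∀ q h : H5 ε M T, q ∈ feasible ε M T cbar R g₀ g₁ →
          q + h ∈ feasible ε M T cbar R g₀ g₁ →
          ∀ G : H5 ε M T, IsFrechetDeriv (J lam α β) q G →
            J lam α β (q + h) - J lam α β q - inner ℝ G h ≥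
              (∫ p in rect ε M T, Real.exp (-2 * lam * (p.1 + α * p.2)) *
                  (|D h 1 0 p.1 p.2| ^ 2 + |D h 0 1 p.1 p.2| ^ 2
                    + |D h 0 0 p.1 p.2| ^ 2))
                + (∫ x in ε..M, Real.exp (-2 * lam * x) *
                  (|D h 1 0 x 0| ^ 2 + |D h 0 0 x 0| ^ 2))
                + β / 2 * ‖h‖ ^ 2) ∧
        ((feasible ε M T cbar R g₀ g₁).Nonempty →
          (∃! qmin : H5 ε M T, qmin ∈ feasible ε M T cbar R g₀ g₁ ∧
            ∀ q ∈ feasible ε M T cbar R g₀ g₁, J lam α β qmin ≤ J lam α β q) ∧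
          ∀ qmin ∈ feasible ε M T cbar R g₀ g₁, ∀ G : H5 ε M T,
            IsFrechetDeriv (J lam α β) qmin G →
              ((∀ q ∈ feasible ε M T cbar R g₀ g₁, J lam α β qmin ≤ J lam α β q) ↔
                ∀ q ∈ feasible ε M T cbar R g₀ g₁, inner ℝ G (qmin - q) ≤ 0))) := by
  have hc₀ : 0 < 1 / (2 * cbar ^ (1 / 4 : ℝ)) := by positivity
  refine ⟨fun g₀ g₁ lam α β => ⟨fun q hq => existsUnique_isFrechetDeriv hεM hT hc₀
    (traceGE_of_mem_admissible hεM hT hq), ?_⟩, fun α hα => ?_⟩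
  · obtain ⟨K, hK, hlipschitz⟩ := exists_lipschitz_isFrechetDeriv hεM hT hc₀ R lam α β
    exact ⟨K, hK, fun q₁ hq₁ q₂ hq₂ G₁ G₂ => hlipschitz q₁ q₂ G₁ G₂
      (mem_closedBall_zero_iff.1 hq₁.1) (mem_closedBall_zero_iff.1 hq₂.1)
      (traceGE_of_mem_admissible hεM hT hq₁.2) (traceGE_of_mem_admissible hεM hT hq₂.2)⟩
  obtain ⟨lam₁, hconvexity⟩ := exists_convexity_inequality hεM hT hε hc hα R
  refine ⟨lam₁, fun g₀ g₁ lam hlam β hβ => ?_⟩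
  have hβ₀ : 0 < β := lt_of_lt_of_le (by positivity) hβ
  have hgrad : ∀ q ∈ feasible ε M T cbar R g₀ g₁, ∀ G : H5 ε M T,
      IsFrechetDeriv (J lam α β) q G → ∀ p ∈ feasible ε M T cbar R g₀ g₁,
        J lam α β q + inner ℝ G (p - q) + β / 2 * ‖p - q‖ ^ 2 ≤ J lam α β p := by
    intro q hq G hG p hp
    have hpq := hconvexity g₀ g₁ lam hlam β hβ q (p - q) hq (by rwa [add_sub_cancel]) G hG
    rw [add_sub_cancel] at hpq
    linarith [weighted_D_integrals_nonneg (lam := lam) (α := α) hεM (p - q)]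
  have hexists := exists_gradient_ineq_of_isFrechetDeriv hεM hT hc hgrad
  have hconvex : Convex ℝ (feasible ε M T cbar R g₀ g₁) := convex_feasible hεM hT
  have hbdd : BddBelow (J lam α β '' feasible ε M T cbar R g₀ g₁) :=
    ⟨0, forall_mem_image.2 fun q _ => J_nonneg hβ₀.le q⟩
  exact ⟨(strongConvexOn_of_gradient_ineq hconvex hexists).strictConvexOn hβ₀,
    hconvexity g₀ g₁ lam hlam β hβ, fun hne =>
      ⟨existsUnique_isMinOn_of_gradient_ineq hβ₀ hconvex (isClosed_feasible hεM hT) hne hbdd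
        hexists, fun q hq G hG => isMinOn_feasible_iff_inner_sub_nonpos hεM hT hβ₀.le hq hG
        (hgrad q hq G hG)⟩⟩

open Convexification in
theorem theorem5p1 (ε M T cbar R : ℝ) (hε : 0 < ε) (hε1 : ε < 1) (hM : 1 < M) (hT : 0 < T)
    (hc : 0 < cbar) (hR : 0 < R) :
    (∀ (g₀ g₁ : ℝ → ℝ) (lam α β : ℝ),
      (∀ q ∈ admissible ε M T cbar g₀ g₁, ∃! G : H5 ε M T, IsFrechetDeriv (J lam α β) q G) ∧
      ∃ K > 0, ∀ q₁ ∈ feasible ε M T cbar R g₀ g₁, ∀ q₂ ∈ feasible ε M T cbar R g₀ g₁,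
        ∀ G₁ G₂ : H5 ε M T, IsFrechetDeriv (J lam α β) q₁ G₁ → IsFrechetDeriv (J lam α β) q₂ G₂ →
          ‖G₂ - G₁‖ ≤ K * ‖q₂ - q₁‖) ∧
    (∀ α ∈ Set.Ioo 0 (1 / (2 * √cbar)), ∃ C > 0, ∀ lam₀ ≥ (1 : ℝ), ∃ lam₁ ≥ lam₀,
      ∀ (g₀ g₁ : ℝ → ℝ), ∀ lam ≥ lam₁, ∀ β ∈ Set.Ico (2 * Real.exp (-lam * α * T)) 1,
        StrictConvexOn ℝ (feasible ε M T cbar R g₀ g₁) (J lam α β) ∧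
        (∀ q h : H5 ε M T, q ∈ feasible ε M T cbar R g₀ g₁ →
          q + h ∈ feasible ε M T cbar R g₀ g₁ →
          ∀ G : H5 ε M T, IsFrechetDeriv (J lam α β) q G →
            J lam α β (q + h) - J lam α β q - inner ℝ G h ≥
              C * (∫ p in rect ε M T, Real.exp (-2 * lam * (p.1 + α * p.2)) *
                  (|D h 1 0 p.1 p.2| ^ 2 + |D h 0 1 p.1 p.2| ^ 2
                    + |D h 0 0 p.1 p.2| ^ 2))
                + C * (∫ x in ε..M, Real.exp (-2 * lam * x) *
                  (|D h 1 0 x 0| ^ 2 + |D h 0 0 x 0| ^ 2))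
                + β / 2 * ‖h‖ ^ 2) ∧
        ((feasible ε M T cbar R g₀ g₁).Nonempty →
          (∃! qmin : H5 ε M T, qmin ∈ feasible ε M T cbar R g₀ g₁ ∧
            ∀ q ∈ feasible ε M T cbar R g₀ g₁, J lam α β qmin ≤ J lam α β q) ∧
          ∀ qmin ∈ feasible ε M T cbar R g₀ g₁, ∀ G : H5 ε M T,
            IsFrechetDeriv (J lam α β) qmin G →
              ((∀ q ∈ feasible ε M T cbar R g₀ g₁, J lam α β qmin ≤ J lam α β q) ↔
                ∀ q ∈ feasible ε M T cbar R g₀ g₁, inner ℝ G (qmin - q) ≤ 0))) := by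
  obtain ⟨hderiv, hconvexity⟩ := theorem5p1_general ε M T cbar R hε.le (hε1.trans hM) hT hc
  refine ⟨hderiv, fun α hα => ⟨1, one_pos, fun lam₀ _ => ?_⟩⟩
  obtain ⟨lam₁, hlam₁⟩ := hconvexity α hα
  refine ⟨max lam₀ lam₁, le_max_left _ _, fun g₀ g₁ lam hlam β hβ => ?_⟩
  simpa only [one_mul] using hlam₁ g₀ g₁ lam (le_of_max_le_right hlam) β hβ.1
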